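/- **Setting.** Let $X\neq\emptyset$ be a countable set and let $b:X\times X\to[0,\infty)$ satisfy $b(x,x)=0$, $b(x,y)=b(y,x)$ and $\sum_{z}b(x,z)<\infty$ for all $x,y\in X$ (a weighted graph); write $x\sim y$ if $b(x,y)>0$. Let $\mu:X\to(0,\infty)$ and $V:X\to\mathbb R$. All functions are real-valued; $\ell^2(X,\mu)$ is the real Hilbert space of functions with $\sum_x f(x)^2\mu(x)<\infty$, with norm $\|\cdot\|_2$. On $\mathcal F=\{f:X\to\mathbb R : \sum_y b(x,y)|f(y)|<\infty \text{ for all } x\}$ let $$\mathcal Hf(x)=\frac1{\mu(x)}\sum_{y}b(x,y)(f(x)-f(y))+V(x)f(x).$$ A *realization* of $\mathcal H$ is a lower semi-bounded self-adjoint operator $H$ on $\ell^2(X,\mu)$ whose form domain contains all finitely supported functions and which satisfies $D(H)\subseteq\mathcal F$ and $Hf=\mathcal Hf$ for all $f\in D(H)$. It is *Markovian* if its quadratic form is a Dirichlet form, i.e. is nonnegative and every normal contraction operates on it. Let $V\ge 0$. Let $Q^{(N)}$ be the closed form with domain $D(Q^{(N)})$ consisting of all $f\in\ell^2(X,\mu)$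 for which $$Q^{(N)}(f)=\frac12\sum_{x,y}b(x,y)(f(x)-f(y))^2+\sum_x V(x)f(x)^2\mu(x)$$ is finite, and let $H^{(N)}$ be its associated self-adjoint operator. For $\alpha>0$ and $h:X\to[0,\infty)$ let $(H^{(N)}+\alpha)^{-1}h$ be the pointwise supremum of $(H^{(N)}+\alpha)^{-1}f$ over all $f\in\ell^2(X,\mu)$ with $0\le f\le h$. The function $h$ is *$1$-excessive* if $\beta(H^{(N)}+\beta+1)^{-1}h\le h$ for all $\beta>0$. For a $1$-excessive $h$ and $U\subseteq X$ let $$\mathrm{cap}_h(U)=\inf\{Q^{(N)}(f)+\|f\|_2^2 : f\in D(Q^{(N)}),\ f\ge 1_Uh\}\qquad(\inf\emptyset=\infty),$$ $$\mathrm{cap}_h(\partial X)=\inf\{\mathrm{cap}_h(X\setminus K): K\subseteq X\text{ finite}\}.$$ For a pseudo metric $\rho$ on $X$ with completion $\overline X^\rho$ and Cauchy boundary $\partial_\rho X=\overline X^\rho\setminus X$ let $$\mathrm{cap}_h(\partial_\rho X)=\inf\{\mathrm{cap}_h(X\cap O): O\subseteq\overline X^\rho\text{ an open neighborhood of }\partial_\rho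 X\}.$$ If $(X,b)$ is connected (any two vertices are joined by a finite path), a *strongly intrinsic path metric* is a pseudo metric of the form $$\rho_\sigma(x,y)=\inf\Big\{\sum_{i=1}^n\sigma(x_{i-1},x_i): x=x_0\sim x_1\sim\dots\sim x_n=y\Big\},$$ where $\sigma:X\times X\to[0,\infty)$ is symmetric, $\sigma(x,y)>0$ if and only if $x\sim y$, and $\sum_y b(x,y)\sigma(x,y)^2\le\mu(x)$ for all $x\in X$. **Theorem.** If $V\ge0$, the following are equivalent. 1. $\mathcal H$ has exactly one Markovian realization. 2. $\mathrm{cap}_h(\partial X)=0$ for every $1$-excessive $h\in D(Q^{(N)})$. 3. $\mathrm{cap}_h(\partial X)=0$ for some strictly positive $1$-excessive $h\in D(Q^{(N)})$. If, additionally, $(X,b)$ is connected and locally finite (every vertex has only finitely many neighbors), then these are also equivalent to each of the following. 4. (one) There is a strongly intrinsic path metric $\rho$ such that $\mathrm{cap}_h(\partial_\rho X)=0$ for every $1$-excessive $h\in D(Q^{(N)})$. 5. (any) For every strongly intrinsic path metric $\rho$, $\mathrm{cap}_h(\partial_\rho X)=0$ for every $1$-excessive $h\in D(Q^{(N)})$.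 6. (one) There is a strongly intrinsic path metric $\rho$ such that $\mathrm{cap}_h(\partial_\rho X)=0$ for some strictly positive $1$-excessive $h\in D(Q^{(N)})$. 7. (any) For every strongly intrinsic path metric $\rho$, $\mathrm{cap}_h(\partial_\rho X)=0$ for some strictly positive $1$-excessive $h\in D(Q^{(N)})$. -/

import Mathlib

open MeasureTheory Filter Topology
open scoped ENNReal InnerProductSpace

noncomputable section

namespace DiscreteSchrodinger

/-! ## Weighted graphs, weights and the formal operator -/

/-- A symmetric weighted graph on the vertex set `X`. -/
structure WeightedGraph (X : Type*) where
  /-- the edge weights -/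
  b : X → X → ℝ
  nonneg : ∀ x y, 0 ≤ b x y
  loopless : ∀ x, b x x = 0
  symm : ∀ x y, b x y = b y x
  summable : ∀ x, Summable fun z => b x z

/-- A weight: a strictly positive function on the vertices. -/
structure Weight (X : Type*) where
  /-- the underlying function -/
  toFun : X → ℝ
  pos : ∀ x, 0 < toFun x

instance {X : Type*} : CoeFun (Weight X) fun _ => X → ℝ := ⟨Weight.toFun⟩

namespace WeightedGraph

variable {X : Type*} (G : WeightedGraph X)

/-- The combinatorial graph of `G`: `x ∼ y` if and only if `b x y > 0`. -/
def toSimpleGraph : SimpleGraph X where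
  Adj x y := 0 < G.b x y
  symm := ⟨fun x y h => by rw [G.symm y x]; exact h⟩
  loopless := ⟨fun x h => by rw [G.loopless x] at h; exact lt_irrefl _ h⟩

/-- Any two vertices are joined by a finite path. -/
def Connected : Prop := G.toSimpleGraph.Connected

/-- Every vertex has only finitely many neighbors. -/
def LocallyFinite : Prop := ∀ x, {y | 0 < G.b x y}.Finite

/-- The domain `𝓕` of the formal Schrödinger operator. -/
def FormalDomain (f : X → ℝ) : Prop := ∀ x, Summable fun y => G.b x y * |f y|

/-- The formal Schrödinger operator
`𝓗 f (x) = μ(x)⁻¹ ∑ y, b(x,y) (f(x) - f(y)) + V(x) f(x)`. -/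
def formalOp (μ : Weight X) (V : X → ℝ) (f : X → ℝ) (x : X) : ℝ :=
  (μ x)⁻¹ * ∑' y, G.b x y * (f x - f y) + V x * f x

/-- Functions of finite energy:
`∑ x y, b(x,y) (f(x) - f(y))² + ∑ x, |V(x)| f(x)² μ(x) < ∞`. -/
def FiniteEnergy (μ : Weight X) (V : X → ℝ) (f : X → ℝ) : Prop :=
  (Summable fun p : X × X => G.b p.1 p.2 * (f p.1 - f p.2) ^ 2) ∧
    Summable fun x => |V x| * f x ^ 2 * μ x

/-- The Schrödinger form
`𝓠(f,g) = 1/2 ∑ x y, b(x,y) (f(x) - f(y)) (g(x) - g(y)) + ∑ x, V(x) f(x) g(x) μ(x)`. -/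
def energy (μ : Weight X) (V : X → ℝ) (f g : X → ℝ) : ℝ :=
  1 / 2 * ∑' p : X × X, G.b p.1 p.2 * ((f p.1 - f p.2) * (g p.1 - g p.2)) +
    ∑' x, V x * f x * g x * μ x

/-- Square summability with respect to a weight passes to sums. -/
theorem summable_sq_add {ι : Type*} {w f g : ι → ℝ} (hf : Summable fun i => w i * f i ^ 2)
    (hg : Summable fun i => w i * g i ^ 2) : Summable fun i => w i * (f i + g i) ^ 2 := by
  refine Summable.of_norm_bounded ((hf.abs.mul_left 2).add (hg.abs.mul_left 2)) fun i => ?_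
  rw [Real.norm_eq_abs, abs_mul, abs_mul, abs_mul, abs_of_nonneg (sq_nonneg (f i)),
    abs_of_nonneg (sq_nonneg (g i)), abs_of_nonneg (sq_nonneg (f i + g i))]
  nlinarith [abs_nonneg (w i), mul_nonneg (abs_nonneg (w i)) (sq_nonneg (f i - g i))]

/-- Products of square summable functions are summable. -/
theorem summable_sq_mul {ι : Type*} {w f g : ι → ℝ} (hf : Summable fun i => w i * f i ^ 2)
    (hg : Summable fun i => w i * g i ^ 2) : Summable fun i => w i * (f i * g i) := by
  refine (((summable_sq_add hf hg).sub hf).sub hg).mul_left (1 / 2) |>.congr fun i => ?_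
  ring

variable {G}
variable {μ : Weight X} {V : X → ℝ} {f f₁ g : X → ℝ}

theorem FiniteEnergy.add (hf : G.FiniteEnergy μ V f) (hg : G.FiniteEnergy μ V g) :
    G.FiniteEnergy μ V fun x => f x + g x := by
  constructor
  · refine (summable_sq_add hf.1 hg.1).congr fun p => ?_
    ring
  · have h1 : Summable fun x => (|V x| * μ x) * f x ^ 2 := hf.2.congr fun x => by ring
    have h2 : Summable fun x => (|V x| * μ x) * g x ^ 2 := hg.2.congr fun x => by ring
    refine (summable_sq_add h1 h2).congr fun x => ?_
    ring

theorem FiniteEnergy.smul (c : ℝ) (hf : G.FiniteEnergy μ V f) :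
    G.FiniteEnergy μ V fun x => c * f x := by
  constructor
  · refine (hf.1.mul_left (c ^ 2)).congr fun p => ?_
    ring
  · refine (hf.2.mul_left (c ^ 2)).congr fun x => ?_
    ring

theorem FiniteEnergy.summable_edge (hf : G.FiniteEnergy μ V f) (hg : G.FiniteEnergy μ V g) :
    Summable fun p : X × X => G.b p.1 p.2 * ((f p.1 - f p.2) * (g p.1 - g p.2)) :=
  summable_sq_mul hf.1 hg.1

theorem FiniteEnergy.summable_vertex (hf : G.FiniteEnergy μ V f) (hg : G.FiniteEnergy μ V g) :
    Summable fun x => V x * f x * g x * μ x := by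
  have key : ∀ k : X → ℝ, (Summable fun x => |V x| * k x ^ 2 * μ x) →
      Summable fun x => (V x * μ x) * k x ^ 2 := fun k hk => by
    refine Summable.of_abs (hk.congr fun x => ?_)
    rw [abs_mul, abs_mul, abs_of_pos (μ.pos x), abs_of_nonneg (sq_nonneg (k x))]
    ring
  refine (summable_sq_mul (key f hf.2) (key g hg.2)).congr fun x => ?_
  ring

theorem energy_add_left (hf : G.FiniteEnergy μ V f) (hf₁ : G.FiniteEnergy μ V f₁)
    (hg : G.FiniteEnergy μ V g) :
    G.energy μ V (fun x => f x + f₁ x) g = G.energy μ V f g + G.energy μ V f₁ g := by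
  have e1 := (hf.summable_edge hg).tsum_add (hf₁.summable_edge hg)
  have e2 := (hf.summable_vertex hg).tsum_add (hf₁.summable_vertex hg)
  unfold energy
  rw [show (∑' p : X × X, G.b p.1 p.2 * ((f p.1 + f₁ p.1 - (f p.2 + f₁ p.2)) * (g p.1 - g p.2)))
      = _ from (tsum_congr fun p => by ring).trans e1,
    show (∑' x, V x * (f x + f₁ x) * g x * μ x) = _ from (tsum_congr fun x => by ring).trans e2]
  ring

theorem energy_smul_left (c : ℝ) :
    G.energy μ V (fun x => c * f x) g = c * G.energy μ V f g := by
  have e1 := tsum_mul_left (L := .unconditional _) (a := c)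
    (f := fun p : X × X => G.b p.1 p.2 * ((f p.1 - f p.2) * (g p.1 - g p.2)))
  have e2 := tsum_mul_left (L := .unconditional _) (a := c) (f := fun x => V x * f x * g x * μ x)
  unfold energy
  rw [show (∑' p : X × X, G.b p.1 p.2 * ((c * f p.1 - c * f p.2) * (g p.1 - g p.2)))
      = _ from (tsum_congr fun p => by ring).trans e1,
    show (∑' x, V x * (c * f x) * g x * μ x) = _ from (tsum_congr fun x => by ring).trans e2]
  ring

theorem energy_comm : G.energy μ V f g = G.energy μ V g f := by
  unfold energy
  refine congrArg₂ (fun s t : ℝ => 1 / 2 * s + t) (tsum_congr fun p => ?_) (tsum_congr fun x => ?_)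
  · rw [mul_comm (f p.1 - f p.2)]
  · rw [mul_right_comm (V x)]

end WeightedGraph

/-! ## The Hilbert space `ℓ²(X, μ)` -/

section ell2

variable {X : Type*} [Countable X] [MeasurableSpace X] [DiscreteMeasurableSpace X]

/-- The measure `μ(A) = ∑ x ∈ A, μ(x)`. -/
def Weight.measure (μ : Weight X) : Measure X :=
  Measure.sum fun x => ENNReal.ofReal (μ x) • Measure.dirac x

/-- The real Hilbert space `ℓ²(X, μ)`. As every point has positive mass, its elements are genuine
functions. -/
abbrev Ell2 (μ : Weight X) : Type _ := Lp ℝ 2 μ.measure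

/-- Almost everywhere means everywhere. -/
theorem Weight.ae_measure_iff (μ : Weight X) {p : X → Prop} :
    (∀ᵐ x ∂μ.measure, p x) ↔ ∀ x, p x := by
  unfold Weight.measure
  rw [Measure.ae_sum_iff]
  refine forall_congr' fun x => ?_
  rw [Measure.ae_ennreal_smul_measure_iff (by simpa using μ.pos x), ae_dirac_eq]
  simp

theorem Ell2.add_apply {μ : Weight X} (f g : Ell2 μ) (x : X) : (f + g) x = f x + g x :=
  μ.ae_measure_iff.1 (Lp.coeFn_add f g) x

theorem Ell2.smul_apply {μ : Weight X} (c : ℝ) (f : Ell2 μ) (x : X) : (c • f) x = c * f x :=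
  μ.ae_measure_iff.1 (Lp.coeFn_smul c f) x

theorem Ell2.coe_add {μ : Weight X} (f g : Ell2 μ) : ((f + g : Ell2 μ) : X → ℝ) =
    fun x => f x + g x :=
  funext (Ell2.add_apply f g)

theorem Ell2.coe_smul {μ : Weight X} (c : ℝ) (f : Ell2 μ) : ((c • f : Ell2 μ) : X → ℝ) =
    fun x => c * f x :=
  funext (Ell2.smul_apply c f)

theorem Ell2.zero_apply {μ : Weight X} (x : X) : (0 : Ell2 μ) x = 0 :=
  μ.ae_measure_iff.1 (Lp.coeFn_zero ℝ 2 μ.measure) x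

end ell2

/-! ## Quadratic forms and their operators -/

section forms

variable {E : Type*} [NormedAddCommGroup E] [InnerProductSpace ℝ E]

/-- A real quadratic form on a subspace, given by its symmetric bilinear form; the quadratic form
is `f ↦ q f f` on the domain and `∞` outside. -/
structure SymForm (E : Type*) [NormedAddCommGroup E] [InnerProductSpace ℝ E] where
  /-- the form domain -/
  domain : Submodule ℝ E
  /-- the bilinear form -/
  form : domain →ₗ[ℝ] domain →ₗ[ℝ] ℝ
  symm : ∀ f g, form f g = form g f

namespace SymForm

variable (q : SymForm E)

def DenselyDefined : Prop := Dense (q.domain : Set E)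

def LowerSemibounded : Prop := ∃ C : ℝ, ∀ f : q.domain, C * ‖(f : E)‖ ^ 2 ≤ q.form f f

/-- The form domain is complete in the form norm: a sequence that is Cauchy in `E` and with
respect to `q` converges in `E` and with respect to `q` to an element of the domain. -/
def Closed : Prop :=
  ∀ u : ℕ → q.domain, CauchySeq (fun n => (u n : E)) →
    Tendsto (fun p : ℕ × ℕ => q.form (u p.1 - u p.2) (u p.1 - u p.2)) atTop (𝓝 0) →
    ∃ f : q.domain, Tendsto (fun n => (u n : E)) atTop (𝓝 (f : E)) ∧
      Tendsto (fun n => q.form (u n - f) (u n - f)) atTop (𝓝 0)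

/-- The set of pairs `(f, g)` with `f ∈ D(q)` and `q(f, h) = ⟨g, h⟩` for all `h ∈ D(q)`. -/
def operatorGraph : Submodule ℝ (E × E) where
  carrier := {p | ∃ f : q.domain, (f : E) = p.1 ∧ ∀ h : q.domain, q.form f h = ⟪p.2, (h : E)⟫_ℝ}
  zero_mem' := ⟨0, by simp, fun h => by simp⟩
  add_mem' := by
    rintro p p₁ ⟨f, hf, hq⟩ ⟨f₁, hf₁, hq₁⟩
    refine ⟨f + f₁, by simp [hf, hf₁], fun h => ?_⟩
    simp [hq h, hq₁ h, inner_add_left]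
  smul_mem' := by
    rintro c p ⟨f, hf, hq⟩
    refine ⟨c • f, by simp [hf], fun h => ?_⟩
    simp [hq h, inner_smul_left]

/-- The operator associated with a densely defined form. -/
def operator : E →ₗ.[ℝ] E := q.operatorGraph.toLinearPMap

/-- `q` is the form of the operator `L`: the densely defined, lower semi-bounded, closed form
whose associated operator is `L`. -/
structure IsFormOf (L : E →ₗ.[ℝ] E) : Prop where
  dense : q.DenselyDefined
  lowerSemibounded : q.LowerSemibounded
  closed : q.Closed
  operator_eq : q.operator = L

end SymForm

/-- `u = (L + α)⁻¹ f`. -/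
def IsResolvent (L : E →ₗ.[ℝ] E) (α : ℝ) (f u : E) : Prop :=
  ∃ hu : u ∈ L.domain, L ⟨u, hu⟩ + α • u = f

end forms

section realizations

variable {X : Type*} [Countable X] [MeasurableSpace X] [DiscreteMeasurableSpace X]
  (G : WeightedGraph X) (μ : Weight X) (V : X → ℝ)

/-! ## Markovian realizations -/

/-- A nonnegative, densely defined, closed form satisfying the second Beurling-Deny criterion:
every normal contraction operates on it. -/
structure IsDirichletForm {μ : Weight X} (q : SymForm (Ell2 μ)) : Prop where
  nonneg : ∀ f, 0 ≤ q.form f f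
  dense : q.DenselyDefined
  closed : q.Closed
  contraction : ∀ C : ℝ → ℝ, C 0 = 0 → (∀ s t, |C s - C t| ≤ |s - t|) → ∀ f : q.domain,
    ∃ g : q.domain, (∀ x, (g : Ell2 μ) x = C ((f : Ell2 μ) x)) ∧ q.form g g ≤ q.form f f

/-- Realizations of the formal operator `𝓗`: self-adjoint, lower semi-bounded restrictions of `𝓗`
whose form domain contains all finitely supported functions. (A lower semi-bounded self-adjoint
operator has exactly one form in the sense of `SymForm.IsFormOf`.) -/
structure IsRealization (H : Ell2 μ →ₗ.[ℝ] Ell2 μ) : Prop where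
  selfAdjoint : IsSelfAdjoint H
  lowerSemibounded : ∃ C : ℝ, ∀ f : H.domain,
    C * ‖(f : Ell2 μ)‖ ^ 2 ≤ ⟪(f : Ell2 μ), H f⟫_ℝ
  finsupp_mem : ∃ q : SymForm (Ell2 μ), q.IsFormOf H ∧
    ∀ φ : Ell2 μ, (Function.support φ).Finite → φ ∈ q.domain
  formal : ∀ f : H.domain, G.FormalDomain (f : Ell2 μ) ∧
    ∀ x, (H f) x = G.formalOp μ V (f : Ell2 μ) x

/-- A realization of `𝓗` whose form is a Dirichlet form. -/
def IsMarkovianRealization (H : Ell2 μ →ₗ.[ℝ] Ell2 μ) : Prop :=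
  IsRealization G μ V H ∧ ∃ q : SymForm (Ell2 μ), q.IsFormOf H ∧ IsDirichletForm q

/-! ## The Neumann form, excessive functions and capacities -/

/-- The form `Q^(N)`: the restriction of the Schrödinger form to the functions of finite energy
in `ℓ²(X, μ)`. -/
def neumannForm : SymForm (Ell2 μ) where
  domain :=
    { carrier := {f | G.FiniteEnergy μ V f}
      zero_mem' := by
        have h : ((0 : Ell2 μ) : X → ℝ) = fun _ => 0 := funext Ell2.zero_apply
        rw [Set.mem_ofPred_eq, h]
        simp [WeightedGraph.FiniteEnergy, summable_zero]
      add_mem' := fun {f g} hf hg => by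
        rw [Set.mem_ofPred_eq, Ell2.coe_add]
        exact hf.add hg
      smul_mem' := fun c f hf => by
        rw [Set.mem_ofPred_eq, Ell2.coe_smul]
        exact hf.smul c }
  form := LinearMap.mk₂ ℝ (fun f g => G.energy μ V (f : Ell2 μ) (g : Ell2 μ))
    (fun f f₁ g => by
      rw [Submodule.coe_add, Ell2.coe_add]
      exact WeightedGraph.energy_add_left f.2 f₁.2 g.2)
    (fun c f g => by
      rw [Submodule.coe_smul, Ell2.coe_smul]
      exact WeightedGraph.energy_smul_left c)
    (fun g f f₁ => by
      rw [Submodule.coe_add, Ell2.coe_add, WeightedGraph.energy_comm,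
        WeightedGraph.energy_add_left f.2 f₁.2 g.2, WeightedGraph.energy_comm,
        WeightedGraph.energy_comm (f := (f₁ : Ell2 μ))])
    (fun c g f => by
      rw [Submodule.coe_smul, Ell2.coe_smul, WeightedGraph.energy_comm,
        WeightedGraph.energy_smul_left, WeightedGraph.energy_comm, smul_eq_mul])
  symm _ _ := WeightedGraph.energy_comm

/-- The operator `H^(N)` of the form `Q^(N)`. -/
def neumannOp : Ell2 μ →ₗ.[ℝ] Ell2 μ := (neumannForm G μ V).operator

/-- The resolvent `(H^(N) + α)⁻¹ h` of a nonnegative function `h`, as the pointwise supremum of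
`(H^(N) + α)⁻¹ f` over all `f ∈ ℓ²(X, μ)` with `0 ≤ f ≤ h`. -/
def neumannResolvent (α : ℝ) (h : X → ℝ) (x : X) : EReal :=
  ⨆ (f : Ell2 μ) (u : Ell2 μ) (_ : ∀ y, 0 ≤ f y ∧ f y ≤ h y)
    (_ : IsResolvent (neumannOp G μ V) α f u), ((u x : ℝ) : EReal)

/-- `h` is `1`-excessive: `h ≥ 0` and `β (H^(N) + β + 1)⁻¹ h ≤ h` for all `β > 0`. -/
def IsOneExcessive (h : X → ℝ) : Prop :=
  (∀ x, 0 ≤ h x) ∧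
    ∀ β : ℝ, 0 < β → ∀ x, (β : EReal) * neumannResolvent G μ V (β + 1) h x ≤ (h x : EReal)

/-- The capacity of `U` with respect to `h` and `Q^(N)`; an empty infimum is `∞`. -/
def cap (h : X → ℝ) (U : Set X) : ℝ≥0∞ :=
  ⨅ (f : (neumannForm G μ V).domain) (_ : ∀ x, U.indicator h x ≤ (f : Ell2 μ) x),
    ENNReal.ofReal ((neumannForm G μ V).form f f + ‖(f : Ell2 μ)‖ ^ 2)

/-- The capacity of the boundary `∂X`. -/
def capBoundary (h : X → ℝ) : ℝ≥0∞ :=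
  ⨅ K : Finset X, cap G μ V h (K : Set X)ᶜ

/-- The capacity of the Cauchy boundary with respect to a pseudo metric `d`: the boundary is the
complement of `X` in the completion, and the infimum is over its open neighborhoods. -/
def capCauchyBoundary (d : PseudoMetricSpace X) (h : X → ℝ) : ℝ≥0∞ :=
  letI := d
  ⨅ (O : Set (UniformSpace.Completion X)) (_ : IsOpen O)
    (_ : (Set.range ((↑) : X → UniformSpace.Completion X))ᶜ ⊆ O),
    cap G μ V h (((↑) : X → UniformSpace.Completion X) ⁻¹' O)

end realizations

/-! ## Path metrics -/

section pathMetric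

variable {X : Type*} (G : WeightedGraph X)

/-- Edge lengths: a symmetric nonnegative function that is positive exactly on the edges. -/
structure EdgeLength where
  /-- the length of an edge -/
  σ : X → X → ℝ
  nonneg : ∀ x y, 0 ≤ σ x y
  symm : ∀ x y, σ x y = σ y x
  pos_iff : ∀ x y, 0 < σ x y ↔ 0 < G.b x y

namespace EdgeLength

variable {G} (s : EdgeLength G)

/-- The length of a finite path. -/
def length : {x y : X} → G.toSimpleGraph.Walk x y → ℝ
  | _, _, .nil => 0
  | x, _, .cons (v := z) _ p => s.σ x z + length p

theorem length_nonneg {x y : X} (p : G.toSimpleGraph.Walk x y) : 0 ≤ s.length p := by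
  induction p with
  | nil => exact le_rfl
  | cons _ p ih => exact add_nonneg (s.nonneg _ _) ih

theorem length_append {x y z : X} (p : G.toSimpleGraph.Walk x y) (r : G.toSimpleGraph.Walk y z) :
    s.length (p.append r) = s.length p + s.length r := by
  induction p with
  | nil => simp [length]
  | cons _ p ih => simp [length, ih, add_assoc]

theorem length_reverse {x y : X} (p : G.toSimpleGraph.Walk x y) :
    s.length p.reverse = s.length p := by
  induction p with
  | nil => rfl
  | cons _ p ih =>
    rw [SimpleGraph.Walk.reverse_cons, length_append, ih]
    simp [length, s.symm, add_comm]

/-- The infimum of the lengths of all finite paths from `x` to `y`. -/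
def pathDist (x y : X) : ℝ := ⨅ p : G.toSimpleGraph.Walk x y, s.length p

theorem bddBelow (x y : X) :
    BddBelow (Set.range fun p : G.toSimpleGraph.Walk x y => s.length p) :=
  ⟨0, by rintro _ ⟨p, rfl⟩; exact s.length_nonneg p⟩

theorem pathDist_self (x : X) : s.pathDist x x = 0 :=
  le_antisymm (ciInf_le (s.bddBelow x x) SimpleGraph.Walk.nil)
    (Real.iInf_nonneg fun p => s.length_nonneg p)

theorem pathDist_comm (x y : X) : s.pathDist x y = s.pathDist y x :=
  Equiv.iInf_congr ⟨fun p => p.reverse, fun p => p.reverse, fun p => by simp, fun p => by simp⟩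
    fun p => s.length_reverse p

theorem pathDist_triangle (hG : G.Connected) (x y z : X) :
    s.pathDist x z ≤ s.pathDist x y + s.pathDist y z := by
  have : Nonempty (G.toSimpleGraph.Walk x y) := hG.preconnected x y
  have : Nonempty (G.toSimpleGraph.Walk y z) := hG.preconnected y z
  refine le_ciInf_add_ciInf fun p r => ?_
  rw [← s.length_append]
  exact ciInf_le (s.bddBelow x z) (p.append r)

/-- The path pseudo metric on a connected graph. -/
abbrev pathMetric (hG : G.Connected) : PseudoMetricSpace X where
  dist := s.pathDist
  dist_self := s.pathDist_self
  dist_comm := s.pathDist_comm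
  dist_triangle := s.pathDist_triangle hG

/-- `∑ y, b(x,y) σ(x,y)² ≤ μ(x)` for all `x`: the path metric of `σ` is strongly intrinsic. -/
def StronglyIntrinsic (μ : Weight X) : Prop :=
  ∀ x, (Summable fun y => G.b x y * s.σ x y ^ 2) ∧ ∑' y, G.b x y * s.σ x y ^ 2 ≤ μ x

end EdgeLength

end pathMetric

end DiscreteSchrodinger

end

open DiscreteSchrodinger

noncomputable section

namespace DiscreteSchrodinger

/-! ## Weak limits in Hilbert spaces -/

/-! The conditions all say that the finitely supported functions are dense in D(Q^(N)) for the form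
norm Q^(N) + ‖·‖².

Markov uniqueness and density (`existsUnique_isMarkovianRealization_iff`). Q^(N) and its restriction
to the form closure of the finitely supported functions are both Dirichlet forms whose operators are
Markovian realizations, so uniqueness forces their domains to agree. Conversely, let q be the form
of a Markovian realization, with resolvents G_α. The forms α⟨f - αG_α f, f⟩ lie below q(f) and split
into a jump and a killing part. Since the formal operator is continuous under bounded pointwise
convergence, the jump weights converge to b and the killing weights to V as α → ∞. Hence Q^(N) ≤ q
on D(q) (`partialEnergy_le_form`). For finitely supported φ the same forms converge to the energy of
φ, which gives q(φ) ≤ Q^(N)(φ) (`exists_form_le_energy`). The two forms therefore agree on finitely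
supported functions, and density carries this over to the full domains (`operator_eq_neumannOp`).

Density and capacity. If φ is finitely supported and close to h, then |h - φ| is admissible for the
complement of the support of φ, so the boundary has capacity zero. Conversely
(`neumannForm_domain_le_of_cap`), take k_n of small form norm with k_n ≥ h on U_n. If 0 ≤ f ≤ ch,
then (f - c k_n)₊ vanishes on U_n, has bounded energy and converges pointwise to f. A general f ≥ 0
is the limit of f ∧ nh, and this truncation does not increase the form norm because h is excessive.
Pointwise convergence with bounded form norm is enough, as closed subspaces of the form Hilbert
space are weakly closed.

Cauchy boundary. The complement of a finite set is a neighborhood of the Cauchy boundary, so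
cap_h(∂_ρ X) ≤ cap_h(∂X). Conversely, let g vanish on a neighborhood O of the boundary and let A be
the complement of O. An infinite ball for paths inside A would produce, by König's lemma, an
infinite path of finite length in A. Its limit would lie in X, where points are isolated, which is
impossible (`not_summable_of_notMem`). The balls are thus finite, and distance cutoffs inside A
approximate g by finitely supported functions of bounded energy (`mem_formClosure_of_cutoff`). -/

/-- A bounded family in a Hilbert space whose pairings with a total set converge has a weak
limit. -/
theorem exists_weak_limit {F : Type*} [NormedAddCommGroup F] [InnerProductSpace ℝ F]
    [CompleteSpace F] {ι : Type*} {l : Filter ι} [l.NeBot] {S : Set F}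
    (hS : (Submodule.span ℝ S).topologicalClosure = ⊤) {u : ι → F} {M : ℝ} (hM : 0 ≤ M)
    (hu : ∀ᶠ i in l, ‖u i‖ ≤ M) (hc : ∀ s ∈ S, ∃ c : ℝ, Tendsto (fun i => ⟪u i, s⟫_ℝ) l (𝓝 c)) :
    ∃ v : F, ‖v‖ ≤ M ∧ ∀ w, Tendsto (fun i => ⟪u i, w⟫_ℝ) l (𝓝 ⟪v, w⟫_ℝ) := by
  let C : Submodule ℝ F :=
    { carrier := {w | ∃ c : ℝ, Tendsto (fun i => ⟪u i, w⟫_ℝ) l (𝓝 c)}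
      zero_mem' := ⟨0, by simp⟩
      add_mem' := by
        rintro a b ⟨c, hc⟩ ⟨d, hd⟩
        exact ⟨c + d, by simpa [inner_add_right] using hc.add hd⟩
      smul_mem' := by
        rintro r a ⟨c, hc⟩
        exact ⟨r * c, by simpa [inner_smul_right] using hc.const_mul r⟩ }
  have hSC : Submodule.span ℝ S ≤ C := Submodule.span_le.2 hc
  have hCd : Dense (C : Set F) := by
    exact ((Submodule.dense_iff_topologicalClosure_eq_top).2 hS).mono hSC
  choose φ hφ using fun w : C => w.2
  have hb : ∀ w : C, ‖φ w‖ ≤ M * ‖w‖ := fun w => by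
    refine le_of_tendsto (hφ w).norm ?_
    filter_upwards [hu] with i hi
    exact (norm_inner_le_norm _ _).trans (mul_le_mul_of_nonneg_right hi (norm_nonneg _))
  let L : C →ₗ[ℝ] ℝ :=
    { toFun := φ
      map_add' := fun a b => tendsto_nhds_unique (hφ (a + b)) (by
        simpa [inner_add_right] using (hφ a).add (hφ b))
      map_smul' := fun r a => tendsto_nhds_unique (hφ (r • a)) (by
        simpa [inner_smul_right] using (hφ a).const_mul r) }
  -- The limit functional lives only on the dense subspace `C` of vectors whose pairings converge.
  -- Hahn–Banach extends it with the same norm bound, and Riesz turns it into `v`.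
  obtain ⟨g, hg, hgn⟩ := exists_extension_norm_eq C (L.mkContinuous M hb)
  let v : F := (InnerProductSpace.toDual ℝ F).symm g
  have hv : ∀ w, ⟪v, w⟫_ℝ = g w := fun w => InnerProductSpace.toDual_symm_apply
  have hvM : ‖v‖ ≤ M := by
    rw [LinearIsometryEquiv.norm_map, hgn]
    exact L.mkContinuous_norm_le hM hb
  refine ⟨v, hvM, fun w => Metric.tendsto_nhds.2 fun ε hε => ?_⟩
  -- The factor 2M bounds ‖u i - v‖, and the added 1 covers M = 0.
  have hδ : 0 < ε / (2 * (2 * M + 1)) := by positivity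
  obtain ⟨w', hw', hd⟩ := Metric.dense_iff.1 hCd w _ hδ
  rw [Metric.mem_ball, dist_comm, dist_eq_norm] at hw'
  have h1 : ⟪v, w'⟫_ℝ = φ ⟨w', hd⟩ := (hv w').trans (hg ⟨w', hd⟩)
  have h2 := Metric.tendsto_nhds.1 (hφ ⟨w', hd⟩) (ε / 2) (by positivity)
  filter_upwards [hu, h2] with i hi h2
  rw [← h1, Real.dist_eq] at h2
  rw [Real.dist_eq]
  have h3 : |⟪u i - v, w - w'⟫_ℝ| ≤ 2 * M * (ε / (2 * (2 * M + 1))) := by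
    refine (abs_real_inner_le_norm _ _).trans (mul_le_mul ?_ hw'.le (norm_nonneg _) (by positivity))
    calc ‖u i - v‖ ≤ ‖u i‖ + ‖v‖ := norm_sub_le _ _
      _ ≤ 2 * M := by linarith
  have h4 : ⟪u i, w⟫_ℝ - ⟪v, w⟫_ℝ = ⟪u i - v, w - w'⟫_ℝ + (⟪u i, w'⟫_ℝ - ⟪v, w'⟫_ℝ) := by
    simp [inner_sub_left, inner_sub_right]
  have h5 : 2 * M * (ε / (2 * (2 * M + 1))) < ε / 2 := by
    have : 2 * M * (ε / (2 * (2 * M + 1))) = ε / 2 * (2 * M / (2 * M + 1)) := by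
      field_simp
    rw [this]
    have : 2 * M / (2 * M + 1) < 1 := by rw [div_lt_one (by positivity)]; linarith
    nlinarith
  rw [h4]
  exact (abs_add_le _ _).trans_lt (by linarith)

/-! ## The Hilbert space of a coercive form -/

namespace SymForm

variable {E : Type*} [NormedAddCommGroup E] [InnerProductSpace ℝ E]

/-- The form dominates a positive multiple of the norm. -/
def Coercive (q : SymForm E) : Prop :=
  ∃ c : ℝ, 0 < c ∧ ∀ f : q.domain, c * ‖(f : E)‖ ^ 2 ≤ q.form f f

/-- The form domain of a coercive form, as an inner product space with inner product `q`. -/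
def FormSpace (q : SymForm E) (_ : q.Coercive) : Type _ := q.domain

namespace FormSpace

variable {q : SymForm E} (hq : q.Coercive)

instance : AddCommGroup (FormSpace q hq) := inferInstanceAs (AddCommGroup q.domain)

instance : Module ℝ (FormSpace q hq) := inferInstanceAs (Module ℝ q.domain)

/-- The identification of the form domain with the inner product space. -/
def of : q.domain ≃ₗ[ℝ] FormSpace q hq := LinearEquiv.refl ℝ q.domain

/-- The inner product of the form. -/
@[reducible]
def core : InnerProductSpace.Core ℝ (FormSpace q hq) where
  inner f g := q.form ((of hq).symm f) ((of hq).symm g)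
  conj_inner_symm f g := q.symm _ _
  re_inner_nonneg f := by
    obtain ⟨c, hc, h⟩ := id hq
    exact (by positivity : 0 ≤ c * ‖((of hq).symm f : E)‖ ^ 2).trans (h _)
  add_left f g h := by simp
  smul_left f g r := by simp
  definite f hf := by
    obtain ⟨c, hc, h⟩ := id hq
    have h1 := h ((of hq).symm f)
    rw [hf] at h1
    have h2 : ‖((of hq).symm f : E)‖ ^ 2 ≤ 0 := by
      by_contra hn
      push Not at hn
      nlinarith
    have h3 : ((of hq).symm f : E) = 0 := norm_eq_zero.1
      (by nlinarith [norm_nonneg ((of hq).symm f : E)])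
    have h4 : (of hq).symm f = 0 := Subtype.ext h3
    simpa using h4

instance : NormedAddCommGroup (FormSpace q hq) := (core hq).toNormedAddCommGroup

instance : InnerProductSpace ℝ (FormSpace q hq) := InnerProductSpace.ofCore (core hq).toCore

theorem inner_of (f g : q.domain) : ⟪of hq f, of hq g⟫_ℝ = q.form f g := rfl

theorem norm_sq (f : FormSpace q hq) :
    ‖f‖ ^ 2 = q.form ((of hq).symm f) ((of hq).symm f) := by
  rw [← real_inner_self_eq_norm_sq]; rfl

/-- Closedness of the form asks for a sequence that is Cauchy in `E` as well. Coercivity supplies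
this, since the form norm dominates the ambient norm. -/
theorem complete (hcl : q.Closed) : CompleteSpace (FormSpace q hq) := by
  refine Metric.complete_of_cauchySeq_tendsto fun u hu => ?_
  obtain ⟨c, hc, hcq⟩ := id hq
  have hF : Tendsto (fun p : ℕ × ℕ => ‖u p.1 - u p.2‖ ^ 2) atTop (𝓝 0) := by
    have := cauchySeq_iff_tendsto_dist_atTop_0.1 hu
    simp only [dist_eq_norm] at this
    simpa using this.pow 2
  replace hF : Tendsto (fun p : ℕ × ℕ => q.form ((of hq).symm (u p.1) - (of hq).symm (u p.2))
      ((of hq).symm (u p.1) - (of hq).symm (u p.2))) atTop (𝓝 0) :=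
    hF.congr fun p => norm_sq hq _
  have hE : CauchySeq fun n => ((of hq).symm (u n) : E) := by
    rw [cauchySeq_iff_tendsto_dist_atTop_0]
    have h2 : Tendsto (fun p : ℕ × ℕ =>
        dist ((of hq).symm (u p.1) : E) ((of hq).symm (u p.2) : E) ^ 2) atTop (𝓝 0) := by
      refine squeeze_zero (fun p => by positivity) (fun p => ?_)
        (by have := hF.const_mul c⁻¹; rwa [mul_zero] at this)
      rw [dist_eq_norm, ← Submodule.coe_sub, inv_mul_eq_div, le_div_iff₀ hc, mul_comm]
      exact hcq ((of hq).symm (u p.1) - (of hq).symm (u p.2))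
    have := h2.sqrt
    simpa [Real.sqrt_sq] using this
  obtain ⟨f, _, hf⟩ := hcl (fun n => (of hq).symm (u n)) hE hF
  refine ⟨of hq f, ?_⟩
  rw [tendsto_iff_norm_sub_tendsto_zero]
  have h3 : Tendsto (fun n => ‖u n - of hq f‖ ^ 2) atTop (𝓝 0) := by
    exact hf.congr fun n => (norm_sq hq _).symm
  simpa [Real.sqrt_sq] using h3.sqrt

end FormSpace

open FormSpace

variable {q : SymForm E}

/-- The Riesz representation theorem for coercive closed forms. -/
theorem Coercive.exists_representative (hq : q.Coercive) (hcl : q.Closed) (e : E) :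
    ∃ u : q.domain, ∀ h : q.domain, q.form u h = ⟪e, (h : E)⟫_ℝ := by
  have := FormSpace.complete hq hcl
  obtain ⟨c, hc, hcq⟩ := id hq
  let L : FormSpace q hq →ₗ[ℝ] ℝ :=
    (innerₛₗ ℝ e) ∘ₗ q.domain.subtype ∘ₗ (of hq).symm.toLinearMap
  have hb : ∀ f : FormSpace q hq, ‖L f‖ ≤ ‖e‖ * Real.sqrt c⁻¹ * ‖f‖ := fun f => by
    refine (norm_inner_le_norm (𝕜 := ℝ) e ((of hq).symm f : E)).trans ?_
    rw [mul_assoc]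
    refine mul_le_mul_of_nonneg_left ?_ (norm_nonneg _)
    refine abs_le_of_sq_le_sq' ?_ (by positivity) |>.2
    rw [mul_pow, Real.sq_sqrt (by positivity), inv_mul_eq_div, le_div_iff₀ hc, mul_comm,
      FormSpace.norm_sq hq f]
    exact hcq _
  let v := (InnerProductSpace.toDual ℝ (FormSpace q hq)).symm (L.mkContinuous _ hb)
  refine ⟨(of hq).symm v, fun h => ?_⟩
  rw [← FormSpace.inner_of hq, LinearEquiv.apply_symm_apply]
  exact InnerProductSpace.toDual_symm_apply (𝕜 := ℝ) (E := FormSpace q hq)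
    (x := of hq h) (y := L.mkContinuous _ hb)

/-- A family that is bounded in form norm and converges weakly on a total set converges weakly in
the form domain. -/
theorem Coercive.exists_weak_limit (hq : q.Coercive) (hcl : q.Closed) {S : Set E}
    (hS : ∀ w : E, (∀ s ∈ S, ⟪s, w⟫_ℝ = 0) → w = 0) {ι : Type*} {l : Filter ι} [l.NeBot]
    {u : ι → q.domain} {M : ℝ} (hu : ∀ᶠ i in l, q.form (u i) (u i) ≤ M)
    (hc : ∀ s ∈ S, ∃ c : ℝ, Tendsto (fun i => ⟪s, (u i : E)⟫_ℝ) l (𝓝 c)) :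
    ∃ v : q.domain, q.form v v ≤ M ∧
      (∀ w, Tendsto (fun i => q.form (u i) w) l (𝓝 (q.form v w))) ∧
      ∀ e : E, Tendsto (fun i => ⟪e, (u i : E)⟫_ℝ) l (𝓝 ⟪e, (v : E)⟫_ℝ) := by
  have := FormSpace.complete hq hcl
  have hM : 0 ≤ M := by
    obtain ⟨i, hi⟩ := hu.exists
    rw [← inner_of hq, real_inner_self_eq_norm_sq] at hi
    exact (sq_nonneg _).trans hi
  -- `J e` represents the pairing with `e` in the form inner product. Pairings in `E` with elements
  -- of `S` thus become pairings with the set `S'` below, which is total in the form space because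
  -- `S` separates points of `E`.
  choose J hJ using hq.exists_representative hcl
  have hJ' : ∀ e (f : q.domain), ⟪of hq f, of hq (J e)⟫_ℝ = ⟪e, (f : E)⟫_ℝ := fun e f => by
    rw [inner_of, q.symm, hJ]
  let S' : Set (FormSpace q hq) := (fun e => of hq (J e)) '' S
  have hS' : (Submodule.span ℝ S').topologicalClosure = ⊤ := by
    rw [Submodule.topologicalClosure_eq_top_iff, Submodule.eq_bot_iff]
    intro w hw
    rw [Submodule.mem_orthogonal'] at hw
    have h0 : ((of hq).symm w : E) = 0 := hS _ fun s hs => by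
      rw [← hJ', LinearEquiv.apply_symm_apply]
      exact hw _ (Submodule.subset_span ⟨s, hs, rfl⟩)
    have h4 : (of hq).symm w = 0 := Subtype.ext h0
    simpa using h4
  obtain ⟨v, hv, hw⟩ := DiscreteSchrodinger.exists_weak_limit hS'
    (u := fun i => of hq (u i)) (Real.sqrt_nonneg M) (by
      filter_upwards [hu] with i hi
      rw [← inner_of hq, real_inner_self_eq_norm_sq] at hi
      exact Real.le_sqrt_of_sq_le hi) (by
      rintro _ ⟨s, hs, rfl⟩
      simpa only [hJ'] using hc s hs)
  obtain ⟨v, rfl⟩ := (of hq).surjective v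
  refine ⟨v, ?_, fun w => hw (of hq w), fun e => ?_⟩
  · rw [← inner_of hq, real_inner_self_eq_norm_sq]
    calc _ ≤ Real.sqrt M ^ 2 := by gcongr
      _ = M := Real.sq_sqrt hM
  · simpa only [hJ'] using hw (of hq (J e))

end SymForm

/-! ### Nonnegative closed forms and their variational resolvents. -/

namespace SymForm

variable {E : Type*} [NormedAddCommGroup E] [InnerProductSpace ℝ E] {q : SymForm E}

/-- A nonnegative closed form. -/
structure NonnegClosed (q : SymForm E) : Prop where
  nonneg : ∀ f, 0 ≤ q.form f f
  closed : q.Closed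

/-- The form `q + c ⟪·, ·⟫`. -/
@[reducible]
def shift (q : SymForm E) (c : ℝ) : SymForm E where
  domain := q.domain
  form := q.form + c • (innerₗ E).compl₁₂ q.domain.subtype q.domain.subtype
  symm f g := by simp [q.symm f g, real_inner_comm]

theorem shift_apply (c : ℝ) (f g : q.domain) :
    (q.shift c).form f g = q.form f g + c * ⟪(f : E), (g : E)⟫_ℝ := rfl

theorem shift_self (c : ℝ) (f : q.domain) :
    (q.shift c).form f f = q.form f f + c * ‖(f : E)‖ ^ 2 := by
  rw [shift_apply, real_inner_self_eq_norm_sq]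

theorem form_add_self (f g : q.domain) :
    q.form (f + g) (f + g) = q.form f f + 2 * q.form f g + q.form g g := by
  simp only [map_add, LinearMap.add_apply, q.symm g f]; ring

theorem form_sub_self (f g : q.domain) :
    q.form (f - g) (f - g) = q.form f f - 2 * q.form f g + q.form g g := by
  simp only [map_sub, LinearMap.sub_apply, q.symm g f]; ring

theorem form_smul_self (c : ℝ) (f : q.domain) :
    q.form (c • f) (c • f) = c ^ 2 * q.form f f := by
  simp only [map_smul, LinearMap.smul_apply, smul_eq_mul]; ring

theorem NonnegClosed.shift (hq : q.NonnegClosed) {c : ℝ} (hc : 0 ≤ c) :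
    (q.shift c).NonnegClosed where
  nonneg f := by
    rw [shift_self]
    have := hq.nonneg f
    positivity
  closed u hu hs := by
    have h1 : Tendsto (fun p : ℕ × ℕ => c * ‖(u p.1 : E) - u p.2‖ ^ 2) atTop (𝓝 0) := by
      have := cauchySeq_iff_tendsto_dist_atTop_0.1 hu
      simp only [dist_eq_norm] at this
      simpa using (this.pow 2).const_mul c
    obtain ⟨f, hf, hqf⟩ := hq.closed u hu (by
      have := hs.sub h1
      rw [sub_zero] at this
      refine this.congr fun p => ?_
      rw [shift_self, Submodule.coe_sub]; simp)
    refine ⟨f, hf, ?_⟩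
    have h2 : Tendsto (fun n => c * ‖(u n : E) - f‖ ^ 2) atTop (𝓝 0) := by
      simpa using ((tendsto_iff_norm_sub_tendsto_zero.1 hf).pow 2).const_mul c
    have := hqf.add h2
    rw [zero_add] at this
    refine this.congr fun p => ?_
    rw [shift_self, Submodule.coe_sub]

theorem NonnegClosed.coercive_shift (hq : q.NonnegClosed) {c : ℝ} (hc : 0 < c) :
    (q.shift c).Coercive :=
  ⟨c, hc, fun f => by
    rw [shift_self]
    linarith [hq.nonneg f]⟩

/-- A family in the domain of a nonnegative closed form that is bounded in form norm and converges
weakly on a total set converges weakly in the form domain. -/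
theorem NonnegClosed.exists_weak_limit (hq : q.NonnegClosed) {S : Set E}
    (hS : ∀ w : E, (∀ s ∈ S, ⟪s, w⟫_ℝ = 0) → w = 0) {ι : Type*} {l : Filter ι} [l.NeBot]
    {u : ι → q.domain} {M : ℝ} (hu : ∀ᶠ i in l, (q.shift 1).form (u i) (u i) ≤ M)
    (hc : ∀ s ∈ S, ∃ c : ℝ, Tendsto (fun i => ⟪s, (u i : E)⟫_ℝ) l (𝓝 c)) :
    ∃ v : q.domain, (q.shift 1).form v v ≤ M ∧
      (∀ w : q.domain, Tendsto (fun i => (q.shift 1).form (u i) w) l (𝓝 ((q.shift 1).form v w))) ∧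
      ∀ e : E, Tendsto (fun i => ⟪e, (u i : E)⟫_ℝ) l (𝓝 ⟪e, (v : E)⟫_ℝ) :=
  (hq.coercive_shift one_pos).exists_weak_limit (hq.shift zero_le_one).closed hS hu hc

/-! ### Resolvents of forms -/

/-- The resolvent `(q + α)⁻¹ f` of a form. -/
def resolvent (q : SymForm E) (α : ℝ) (f : E) : q.domain :=
  -- The choice operator makes the resolvent a total function. Its value has meaning once a solution
  -- exists, which holds for nonnegative closed forms and α > 0.
  Classical.epsilon fun u => ∀ h : q.domain, q.form u h + α * ⟪(u : E), (h : E)⟫_ℝ = ⟪f, (h : E)⟫_ℝ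

variable {α : ℝ}

theorem NonnegClosed.resolvent_spec (hq : q.NonnegClosed) (hα : 0 < α) (f : E) (h : q.domain) :
    q.form (q.resolvent α f) h + α * ⟪(q.resolvent α f : E), (h : E)⟫_ℝ = ⟪f, (h : E)⟫_ℝ :=
  Classical.epsilon_spec
    (p := fun u : q.domain => ∀ h : q.domain,
      q.form u h + α * ⟪(u : E), (h : E)⟫_ℝ = ⟪f, (h : E)⟫_ℝ)
    ((hq.coercive_shift hα).exists_representative (hq.shift hα.le).closed f) h

theorem NonnegClosed.eq_resolvent (hq : q.NonnegClosed) (hα : 0 < α) {f : E} {u : q.domain}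
    (hu : ∀ h : q.domain, q.form u h + α * ⟪(u : E), (h : E)⟫_ℝ = ⟪f, (h : E)⟫_ℝ) :
    u = q.resolvent α f := by
  set v := q.resolvent α f
  have h1 : q.form (u - v) (u - v) + α * ‖((u - v : q.domain) : E)‖ ^ 2 = 0 := by
    have := hu (u - v)
    rw [← hq.resolvent_spec hα f (u - v)] at this
    have h0 : q.form (u - v) (u - v) = q.form u (u - v) - q.form v (u - v) := by
      rw [map_sub q.form, LinearMap.sub_apply]
    have h0' : ‖((u - v : q.domain) : E)‖ ^ 2 =
        ⟪(u : E), ((u - v : q.domain) : E)⟫_ℝ - ⟪(v : E), ((u - v : q.domain) : E)⟫_ℝ := by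
      rw [← inner_sub_left, ← Submodule.coe_sub, real_inner_self_eq_norm_sq]
    rw [h0, h0']
    linarith
  have h2 := hq.nonneg (u - v)
  have h3 : ‖((u - v : q.domain) : E)‖ ^ 2 = 0 := by
    have : 0 ≤ ‖((u - v : q.domain) : E)‖ ^ 2 := sq_nonneg _
    nlinarith
  exact sub_eq_zero.1 (Subtype.ext (by simpa using h3))

theorem NonnegClosed.resolvent_add (hq : q.NonnegClosed) (hα : 0 < α) (f g : E) :
    q.resolvent α (f + g) = q.resolvent α f + q.resolvent α g :=
  (hq.eq_resolvent hα fun h => by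
    rw [inner_add_left, ← hq.resolvent_spec hα f, ← hq.resolvent_spec hα g]
    simp only [map_add, LinearMap.add_apply, Submodule.coe_add, inner_add_left]; ring).symm

theorem NonnegClosed.resolvent_smul (hq : q.NonnegClosed) (hα : 0 < α) (c : ℝ) (f : E) :
    q.resolvent α (c • f) = c • q.resolvent α f :=
  (hq.eq_resolvent hα fun h => by
    rw [real_inner_smul_left, ← hq.resolvent_spec hα f]
    simp only [map_smul, LinearMap.smul_apply, Submodule.coe_smul, real_inner_smul_left,
      smul_eq_mul]
    ring).symm

theorem NonnegClosed.norm_resolvent_le (hq : q.NonnegClosed) (hα : 0 < α) (f : E) :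
    α * ‖(q.resolvent α f : E)‖ ≤ ‖f‖ := by
  have h1 := hq.resolvent_spec hα f (q.resolvent α f)
  have h2 := hq.nonneg (q.resolvent α f)
  have h3 := real_inner_le_norm f (q.resolvent α f : E)
  rw [real_inner_self_eq_norm_sq] at h1
  by_contra! h4
  have h5 : 0 < ‖(q.resolvent α f : E)‖ := by
    by_contra! h6
    have := norm_nonneg f
    nlinarith
  nlinarith

/-- The resolvent as a bounded operator, multiplied by `α`. -/
def scaledResolvent (hq : q.NonnegClosed) (hα : 0 < α) : E →L[ℝ] E :=
  LinearMap.mkContinuous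
    { toFun := fun f => α • (q.resolvent α f : E)
      map_add' := fun f g => by simp [hq.resolvent_add hα]
      map_smul' := fun c f => by simp [hq.resolvent_smul hα, smul_comm α c] } 1 fun f => by
    simpa [norm_smul, abs_of_pos hα] using hq.norm_resolvent_le hα f

theorem scaledResolvent_apply (hq : q.NonnegClosed) (hα : 0 < α) (f : E) :
    scaledResolvent hq hα f = α • (q.resolvent α f : E) := rfl

theorem norm_scaledResolvent_le (hq : q.NonnegClosed) (hα : 0 < α) (f : E) :
    ‖scaledResolvent hq hα f‖ ≤ ‖f‖ := by
  simpa [scaledResolvent_apply, norm_smul, abs_of_pos hα] using hq.norm_resolvent_le hα f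

theorem NonnegClosed.resolvent_symm (hq : q.NonnegClosed) (hα : 0 < α) (f g : E) :
    ⟪(q.resolvent α f : E), g⟫_ℝ = ⟪f, (q.resolvent α g : E)⟫_ℝ := by
  rw [← hq.resolvent_spec hα f, real_inner_comm, ← hq.resolvent_spec hα g, q.symm,
    real_inner_comm]

/-- `q(αG f, h) = α ⟪f - αG f, h⟫` for the resolvent `G` at `α`. -/
theorem NonnegClosed.form_resolvent (hq : q.NonnegClosed) (hα : 0 < α) (f : E) (h : q.domain) :
    q.form (α • q.resolvent α f) h = α * ⟪f - α • (q.resolvent α f : E), (h : E)⟫_ℝ := by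
  have := hq.resolvent_spec hα f h
  rw [inner_sub_left, real_inner_smul_left, ← this]
  simp

theorem NonnegClosed.form_resolvent_self (hq : q.NonnegClosed) (hα : 0 < α) (f : E) :
    q.form (α • q.resolvent α f) (α • q.resolvent α f) =
      α * ⟪f - α • (q.resolvent α f : E), f⟫_ℝ - α * ‖f - α • (q.resolvent α f : E)‖ ^ 2 := by
  rw [hq.form_resolvent hα, ← real_inner_self_eq_norm_sq, ← mul_sub, ← inner_sub_right]
  simp

/-- This is the expansion of 0 ≤ q(αGf - f). The approximating form α⟨f - αGf, f⟩ stays below q(f),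
and the surplus α‖f - αGf‖² is kept because it yields the rate of convergence in
`norm_sub_resolvent_sq_le`. -/
theorem NonnegClosed.inner_resolvent_le (hq : q.NonnegClosed) (hα : 0 < α) (f : q.domain) :
    α * ⟪(f : E) - α • (q.resolvent α f : E), (f : E)⟫_ℝ ≤
      q.form f f - α * ‖(f : E) - α • (q.resolvent α f : E)‖ ^ 2 := by
  have h1 := hq.nonneg (α • q.resolvent α f - f)
  rw [form_sub_self, hq.form_resolvent_self hα, hq.form_resolvent hα] at h1
  linarith

theorem NonnegClosed.form_resolvent_le (hq : q.NonnegClosed) (hα : 0 < α) (f : q.domain) :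
    q.form (α • q.resolvent α f) (α • q.resolvent α f) ≤ q.form f f := by
  have h1 := hq.inner_resolvent_le hα f
  rw [hq.form_resolvent_self hα]
  have : 0 ≤ α * ‖(f : E) - α • (q.resolvent α f : E)‖ ^ 2 := by positivity
  linarith

theorem NonnegClosed.shift_resolvent_le (hq : q.NonnegClosed) (hα : 0 < α) (f : q.domain) :
    (q.shift 1).form (α • q.resolvent α f : q.domain) (α • q.resolvent α f : q.domain) ≤
      (q.shift 1).form f f := by
  rw [shift_self, shift_self]
  have h1 := hq.form_resolvent_le hα f
  have h2 : ‖((α • q.resolvent α f : q.domain) : E)‖ ≤ ‖(f : E)‖ :=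
    norm_scaledResolvent_le hq hα f
  gcongr

theorem NonnegClosed.norm_sub_resolvent_sq_le (hq : q.NonnegClosed) (hα : 0 < α) (f : q.domain) :
    ‖(f : E) - α • (q.resolvent α f : E)‖ ^ 2 ≤ q.form f f / (2 * α) := by
  have h1 := hq.inner_resolvent_le hα f
  have h2 := hq.form_resolvent_self hα f
  have h3 := hq.nonneg (α • q.resolvent α f)
  rw [le_div_iff₀ (by positivity)]
  linarith

/-- On the form domain ‖f - αGf‖² is at most q(f)/(2α). Since the operators αG are contractions, the
convergence extends from the dense domain to all of `E`. -/
theorem NonnegClosed.tendsto_resolvent (hq : q.NonnegClosed) (hd : q.DenselyDefined) (f : E) :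
    Tendsto (fun α : ℝ => α • (q.resolvent α f : E)) atTop (𝓝 f) := by
  rw [Metric.tendsto_nhds]
  intro ε hε
  obtain ⟨g, hg, hgd⟩ := Metric.dense_iff.1 hd f (ε / 4) (by positivity)
  rw [Metric.mem_ball, dist_eq_norm] at hg
  have h1 : Tendsto (fun α : ℝ => q.form ⟨g, hgd⟩ ⟨g, hgd⟩ / (2 * α)) atTop (𝓝 0) :=
    Tendsto.div_atTop tendsto_const_nhds (Tendsto.const_mul_atTop two_pos tendsto_id)
  filter_upwards [h1.eventually (gt_mem_nhds (show 0 < (ε / 4) ^ 2 by positivity)),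
    eventually_gt_atTop 0] with α h2 hα
  have h3 := (hq.norm_sub_resolvent_sq_le hα ⟨g, hgd⟩).trans_lt h2
  have h4 : ‖g - α • (q.resolvent α g : E)‖ < ε / 4 := lt_of_pow_lt_pow_left₀ 2 (by positivity) h3
  have h5 : ‖scaledResolvent hq hα (f - g)‖ ≤ ‖f - g‖ := norm_scaledResolvent_le hq hα _
  rw [map_sub, scaledResolvent_apply, scaledResolvent_apply] at h5
  rw [dist_eq_norm]
  have h6 : α • (q.resolvent α f : E) - f = (α • (q.resolvent α f : E) - α • (q.resolvent α g : E))
      - (g - α • (q.resolvent α g : E)) - (f - g) := by abel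
  have h8 : ‖f - g‖ < ε / 4 := by rwa [norm_sub_rev]
  rw [h6]
  calc _ ≤ _ := (norm_sub_le _ _).trans (add_le_add_left (norm_sub_le _ _) _)
    _ < ε := by linarith

/-- The resolvent identity. -/
theorem NonnegClosed.resolvent_identity (hq : q.NonnegClosed) {β : ℝ} (hα : 0 < α) (hβ : 0 < β)
    (f : E) : q.resolvent α f - β • q.resolvent (β + α) (q.resolvent α f : E) =
      q.resolvent (β + α) f :=
  hq.eq_resolvent (by positivity) fun h => by
    have h1 := hq.resolvent_spec hα f h
    have h2 := hq.resolvent_spec (add_pos hβ hα) (q.resolvent α f : E) h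
    simp only [map_sub, map_smul, LinearMap.sub_apply, LinearMap.smul_apply, smul_eq_mul,
      Submodule.coe_sub, Submodule.coe_smul, inner_sub_left, real_inner_smul_left]
    linear_combination h1 - β * h2

/-- The resolvent as a minimizer. -/
theorem NonnegClosed.eq_resolvent_of_le (hq : q.NonnegClosed) (hα : 0 < α) (f : E) {v : q.domain}
    (h1 : q.form v v ≤ q.form (q.resolvent α f) (q.resolvent α f))
    (h2 : ‖(v : E) - α⁻¹ • f‖ ≤ ‖(q.resolvent α f : E) - α⁻¹ • f‖) : v = q.resolvent α f := by
  set u := q.resolvent α f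
  have h3 := hq.resolvent_spec hα f (v - u)
  have h4 : ‖(v : E) - α⁻¹ • f‖ ^ 2 ≤ ‖(u : E) - α⁻¹ • f‖ ^ 2 := by gcongr
  -- The functional q(w) + α‖w - f/α‖² takes at `v` its value at u plus q(v - u) + α‖v - u‖²,
  -- because the resolvent equation `h3` cancels the linear terms.
  have h5 : q.form (v - u) (v - u) + α * ‖((v - u : q.domain) : E)‖ ^ 2 ≤ 0 := by
    have hn : ∀ w : E, α * ‖w - α⁻¹ • f‖ ^ 2 = α * ‖w‖ ^ 2 - 2 * ⟪f, w⟫_ℝ + α * ‖α⁻¹ • f‖ ^ 2 :=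
      fun w => by
        rw [norm_sub_sq_real, real_inner_smul_right, real_inner_comm]
        field_simp
    have h6 := mul_le_mul_of_nonneg_left h4 hα.le
    rw [hn, hn] at h6
    rw [map_sub, Submodule.coe_sub, inner_sub_right, inner_sub_right,
      real_inner_self_eq_norm_sq] at h3
    rw [form_sub_self, Submodule.coe_sub, norm_sub_sq_real, q.symm v u,
      real_inner_comm (u : E) (v : E)]
    linarith
  have h6 := hq.nonneg (v - u)
  have h7 : ‖((v - u : q.domain) : E)‖ ^ 2 = 0 := by
    have : 0 ≤ ‖((v - u : q.domain) : E)‖ ^ 2 := sq_nonneg _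
    nlinarith
  exact sub_eq_zero.1 (Subtype.ext (by simpa using h7))

/-! ### Operators of forms -/

/-- Density of the domain makes the relation `operatorGraph` single-valued, so the conversion to a
partial linear map loses nothing. -/
theorem mem_operator_graph (hd : q.DenselyDefined) {p : E × E} :
    p ∈ q.operator.graph ↔ p ∈ q.operatorGraph := by
  unfold operator
  rw [Submodule.toLinearPMap_graph_eq]
  rintro ⟨a, b⟩ ⟨f, hf, hfb⟩ (rfl : a = 0)
  have hf0 : f = 0 := Subtype.ext hf
  have h1 : ∀ h ∈ q.domain, ⟪b, h⟫_ℝ = 0 := fun h hh => by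
    rw [← hfb ⟨h, hh⟩, hf0]; simp
  exact hd.eq_zero_of_inner_left ℝ h1

theorem NonnegClosed.resolvent_mem_graph (hq : q.NonnegClosed) (hd : q.DenselyDefined)
    (hα : 0 < α) (f : E) :
    ((q.resolvent α f : E), f - α • (q.resolvent α f : E)) ∈ q.operator.graph := by
  rw [mem_operator_graph hd]
  refine ⟨_, rfl, fun h => ?_⟩
  rw [inner_sub_left, real_inner_smul_left, ← hq.resolvent_spec hα f h]
  ring

/-- The link between the operator resolvent used to define excessive functions and the variational
resolvent used in the arguments. -/
theorem NonnegClosed.isResolvent_iff (hq : q.NonnegClosed) (hd : q.DenselyDefined) (hα : 0 < α)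
    {f u : E} : IsResolvent q.operator α f u ↔ u = q.resolvent α f := by
  constructor
  · rintro ⟨hu, h⟩
    have := (mem_operator_graph hd).1 (q.operator.mem_graph ⟨u, hu⟩)
    obtain ⟨u', hu', h'⟩ := this
    dsimp at hu' h'
    rw [← hu']
    congr 1
    refine hq.eq_resolvent hα fun k => ?_
    rw [h', ← h, inner_add_left, real_inner_smul_left, hu']
  · rintro rfl
    have h1 := hq.resolvent_mem_graph hd hα f
    rw [LinearPMap.mem_graph_iff] at h1
    obtain ⟨y, hy, hy'⟩ := h1
    dsimp at hy hy'
    have hm : (q.resolvent α f : E) ∈ q.operator.domain := hy ▸ y.2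
    have : (⟨q.resolvent α f, hm⟩ : q.operator.domain) = y := Subtype.ext hy.symm
    exact ⟨hm, by rw [this, hy']; abel⟩

theorem operator_dense (hq : q.NonnegClosed) (hd : q.DenselyDefined) :
    Dense (q.operator.domain : Set E) := fun f =>
  mem_closure_of_tendsto (hq.tendsto_resolvent hd f) (by
    filter_upwards [eventually_gt_atTop 0] with α hα
    exact q.operator.domain.smul_mem _
      (LinearPMap.mem_domain_of_mem_graph (hq.resolvent_mem_graph hd hα f)))

theorem exists_form_operator (hd : q.DenselyDefined) (f : q.operator.domain) :
    ∃ f' : q.domain, (f' : E) = f ∧ ∀ h : q.domain, q.form f' h = ⟪q.operator f, (h : E)⟫_ℝ :=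
  (mem_operator_graph hd).1 (q.operator.mem_graph f)

theorem operator_inner_symm (hd : q.DenselyDefined) (f g : q.operator.domain) :
    ⟪q.operator f, (g : E)⟫_ℝ = ⟪(f : E), q.operator g⟫_ℝ := by
  obtain ⟨f', hf, hf'⟩ := exists_form_operator hd f
  obtain ⟨g', hg, hg'⟩ := exists_form_operator hd g
  rw [← hg, ← hf', q.symm, hg', hf, real_inner_comm]

/-- The operator of a nonnegative densely defined closed form is self-adjoint. -/
theorem operator_isSelfAdjoint [CompleteSpace E] (hq : q.NonnegClosed) (hd : q.DenselyDefined) :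
    IsSelfAdjoint q.operator := by
  have hD := operator_dense hq hd
  rw [LinearPMap.isSelfAdjoint_def]
  refine le_antisymm ?_ (LinearPMap.IsFormalAdjoint.le_adjoint hD
    (operator_inner_symm hd))
  have hA := LinearPMap.adjoint_isFormalAdjoint hD
  have key : ∀ g : q.operator.adjoint.domain,
      ((g : E), q.operator.adjoint g) ∈ q.operator.graph := fun g => by
    -- With A the operator, A + 1 is onto. The solution u of (A + 1)u = (A* + 1)g must equal g, as
    -- both have the same inner product with every v = (A + 1)f. Hence g lies in the domain of A.
    set k := q.operator.adjoint g + (g : E)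
    have h0 := hq.resolvent_mem_graph hd one_pos k
    set u := q.resolvent 1 k
    rw [one_smul] at h0
    have hug : (u : E) = g := by
      rw [← sub_eq_zero]
      refine ext_inner_left ℝ fun v => ?_
      have hv := hq.resolvent_mem_graph hd one_pos v
      obtain ⟨f, hf, hf'⟩ := (LinearPMap.mem_graph_iff _).1 hv
      obtain ⟨w, hw, hw'⟩ := (LinearPMap.mem_graph_iff _).1 h0
      dsimp at hf hf' hw hw'
      have h1 := operator_inner_symm hd f w
      have h2 : ⟪q.operator.adjoint g, (f : E)⟫_ℝ = ⟪(g : E), q.operator f⟫_ℝ := hA g f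
      have h3 : v = q.operator f + (f : E) := by rw [hf', hf]; simp
      have h4 : k = q.operator w + (w : E) := by rw [hw', hw]; simp
      have h5 : ⟪v, (u : E)⟫_ℝ = ⟪(f : E), k⟫_ℝ := by
        rw [h3, h4, inner_add_left, inner_add_right, ← hw, h1]
      have h6 : ⟪v, (g : E)⟫_ℝ = ⟪(f : E), k⟫_ℝ := by
        rw [h3, inner_add_left, inner_add_right, real_inner_comm (g : E), ← h2, real_inner_comm]
      rw [inner_zero_right, inner_sub_right, h5, h6, sub_self]
    have h7 : q.operator.adjoint g = k - u := by rw [hug]; simp [k]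
    rwa [h7, ← hug]
  exact LinearPMap.le_of_le_graph fun p hp => by
    obtain ⟨y, hy, hy'⟩ := (LinearPMap.mem_graph_iff _).1 hp
    have := key y
    rwa [hy, hy'] at this

theorem operator_nonneg (hq : q.NonnegClosed) (hd : q.DenselyDefined) (f : q.operator.domain) :
    0 ≤ ⟪(f : E), q.operator f⟫_ℝ := by
  obtain ⟨f', hf, hf'⟩ := exists_form_operator hd f
  rw [← hf, real_inner_comm, ← hf']
  exact hq.nonneg f'

/-- Form domains are determined by the operator. -/
theorem domain_le_of_operator_eq {q' : SymForm E} (hq : q.NonnegClosed) (hd : q.DenselyDefined)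
    (hq' : q'.NonnegClosed) (hd' : q'.DenselyDefined) (h : q.operator = q'.operator) :
    q.domain ≤ q'.domain := fun f hf => by
  have hr : ∀ᶠ α : ℝ in atTop, (q.resolvent α f : E) = q'.resolvent α f := by
    filter_upwards [eventually_gt_atTop 0] with α hα
    rw [← hq'.isResolvent_iff hd' hα, ← h, hq.isResolvent_iff hd hα]
  have ht := hq.tendsto_resolvent hd f
  -- The form value of αGf is expressed by the resolvent alone, so q and q' agree on it and it is
  -- bounded in terms of q(f). A weak limit therefore exists in the domain of q', and it can only be
  -- f.
  obtain ⟨v, -, -, hv⟩ := hq'.exists_weak_limit (S := Set.univ) (l := (atTop : Filter ℝ))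
    (u := fun α => α • q'.resolvent α f) (M := (q.shift 1).form ⟨f, hf⟩ ⟨f, hf⟩)
    (fun w hw => ext_inner_left ℝ fun v => by simpa using hw v trivial) (by
      filter_upwards [hr, eventually_gt_atTop 0] with α h1 hα
      refine le_trans (le_of_eq ?_) (hq.shift_resolvent_le hα ⟨f, hf⟩)
      rw [shift_self, shift_self, hq.form_resolvent_self hα, hq'.form_resolvent_self hα]
      simp only [Submodule.coe_smul, h1]) (fun s _ => ⟨⟪s, f⟫_ℝ, by
      refine (tendsto_const_nhds.inner ht).congr' ?_
      filter_upwards [hr] with α h1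
      simp [h1]⟩)
  have : f = v := ext_inner_left ℝ fun e => by
    refine tendsto_nhds_unique ?_ (hv e)
    refine (tendsto_const_nhds.inner ht).congr' ?_
    filter_upwards [hr] with α h1
    simp [h1]
  exact this ▸ v.2

end SymForm

theorem IsDirichletForm.nonnegClosed {X : Type*} [MeasurableSpace X] {μ : Weight X}
    {q : SymForm (Ell2 μ)} (hq : IsDirichletForm q) : q.NonnegClosed := ⟨hq.nonneg, hq.closed⟩

/-! ## Square summable functions -/

section ell2

variable {X : Type*} [Countable X] [MeasurableSpace X] [DiscreteMeasurableSpace X] {μ : Weight X}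

theorem Weight.lintegral_measure (μ : Weight X) (g : X → ℝ≥0∞) :
    ∫⁻ x, g x ∂μ.measure = ∑' x, ENNReal.ofReal (μ x) * g x := by
  simp [Weight.measure, lintegral_sum_measure, lintegral_smul_measure, lintegral_dirac]

theorem Weight.integrable_iff (μ : Weight X) {f : X → ℝ} (hf : ∀ x, 0 ≤ f x) :
    Integrable f μ.measure ↔ Summable fun x => f x * μ x := by
  have hm : AEStronglyMeasurable f μ.measure := Measurable.of_discrete.aestronglyMeasurable
  rw [Integrable, and_iff_right hm, HasFiniteIntegral, μ.lintegral_measure]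
  have : ∀ x, ENNReal.ofReal (μ x) * ‖f x‖ₑ = ENNReal.ofReal (f x * μ x) := fun x => by
    rw [Real.enorm_eq_ofReal (hf x), ← ENNReal.ofReal_mul (μ.pos x).le, mul_comm]
  simp_rw [this]
  constructor
  · intro h
    have := ENNReal.summable_toReal h.ne
    refine this.congr fun x => ENNReal.toReal_ofReal (mul_nonneg (hf x) (μ.pos x).le)
  · intro h
    exact h.tsum_ofReal_lt_top

theorem Weight.hasSum_integral (μ : Weight X) {f : X → ℝ} (hf : Integrable f μ.measure) :
    HasSum (fun x => f x * μ x) (∫ x, f x ∂μ.measure) := by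
  have := hasSum_integral_measure (show Integrable f (Measure.sum _) from hf)
  refine this.congr_fun fun x => ?_
  simp [ENNReal.toReal_ofReal (μ.pos x).le, mul_comm]

theorem Weight.memLp_iff (μ : Weight X) {f : X → ℝ} :
    MemLp f 2 μ.measure ↔ Summable fun x => f x ^ 2 * μ x := by
  rw [memLp_two_iff_integrable_sq Measurable.of_discrete.aestronglyMeasurable]
  exact μ.integrable_iff fun x => sq_nonneg _

namespace Ell2

theorem ext {f g : Ell2 μ} (h : ∀ x, f x = g x) : f = g :=
  Lp.ext (μ.ae_measure_iff.2 h)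

theorem neg_apply (f : Ell2 μ) (x : X) : (-f) x = -f x :=
  μ.ae_measure_iff.1 (Lp.coeFn_neg f) x

theorem sub_apply (f g : Ell2 μ) (x : X) : (f - g) x = f x - g x :=
  μ.ae_measure_iff.1 (Lp.coeFn_sub f g) x

theorem sum_apply {ι : Type*} (s : Finset ι) (f : ι → Ell2 μ) (x : X) :
    (∑ i ∈ s, f i) x = ∑ i ∈ s, f i x := by
  classical
  induction s using Finset.induction_on with
  | empty => simpa using zero_apply x
  | insert a s ha ih => rw [Finset.sum_insert ha, Finset.sum_insert ha, add_apply, ih]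

theorem hasSum_inner (f g : Ell2 μ) : HasSum (fun x => f x * g x * μ x) ⟪f, g⟫_ℝ := by
  rw [L2.inner_def]
  refine (μ.hasSum_integral (L2.integrable_inner f g)).congr_fun fun x => ?_
  simp [mul_comm]

theorem hasSum_norm_sq (f : Ell2 μ) : HasSum (fun x => f x ^ 2 * μ x) (‖f‖ ^ 2) := by
  rw [← real_inner_self_eq_norm_sq]
  exact (hasSum_inner f f).congr_fun fun x => by ring

/-- The element of `ℓ²(X, μ)` given by a square summable function. -/
def mk (f : X → ℝ) (hf : Summable fun x => f x ^ 2 * μ x) : Ell2 μ :=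
  (μ.memLp_iff.2 hf).toLp f

@[simp]
theorem mk_apply (f : X → ℝ) (hf : Summable fun x => f x ^ 2 * μ x) (x : X) : mk f hf x = f x :=
  μ.ae_measure_iff.1 (MemLp.coeFn_toLp _) x

theorem exists_of_abs_le (f : Ell2 μ) {g : X → ℝ} (hg : ∀ x, |g x| ≤ |f x|) :
    ∃ g' : Ell2 μ, ∀ x, g' x = g x := by
  refine ⟨mk g ?_, mk_apply g _⟩
  refine Summable.of_nonneg_of_le (fun x => ?_) (fun x => ?_) (hasSum_norm_sq f).summable
  · have := (μ.pos x).le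
    positivity
  · exact mul_le_mul_of_nonneg_right (sq_le_sq.2 (hg x)) (μ.pos x).le

theorem norm_le_of_abs_le {f g : Ell2 μ} (h : ∀ x, |g x| ≤ |f x|) : ‖g‖ ≤ ‖f‖ := by
  have : ‖g‖ ^ 2 ≤ ‖f‖ ^ 2 := hasSum_le (fun x =>
    mul_le_mul_of_nonneg_right (sq_le_sq.2 (h x)) (μ.pos x).le) (hasSum_norm_sq g) (hasSum_norm_sq f)
  exact le_of_sq_le_sq this (norm_nonneg _)

open Classical in
/-- The indicator function of a finite set. -/
def indicator (μ : Weight X) (s : Finset X) : Ell2 μ :=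
  mk (fun x => if x ∈ s then 1 else 0) (summable_of_ne_finset_zero (s := s) fun x hx => by simp [hx])

open Classical in
theorem indicator_apply (s : Finset X) (x : X) : indicator μ s x = if x ∈ s then 1 else 0 :=
  mk_apply _ _ x

/-- The indicator function of a vertex. -/
def delta (μ : Weight X) (x : X) : Ell2 μ := indicator μ {x}

theorem delta_self (x : X) : delta μ x x = 1 := by simp [delta, indicator_apply]

theorem delta_of_ne {x y : X} (h : y ≠ x) : delta μ x y = 0 := by simp [delta, indicator_apply, h]

theorem inner_delta (f : Ell2 μ) (x : X) : ⟪delta μ x, f⟫_ℝ = f x * μ x := by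
  refine (hasSum_inner _ f).unique ?_
  convert hasSum_single x fun y hy => ?_ using 1
  · simp [delta_self]
  · simp [delta_of_ne hy]

theorem eq_zero_of_inner_delta (w : Ell2 μ) (h : ∀ s ∈ Set.range (delta μ), ⟪s, w⟫_ℝ = 0) :
    w = 0 := ext fun x => by
  have := h _ ⟨x, rfl⟩
  rw [inner_delta] at this
  rw [zero_apply]
  exact (mul_eq_zero.1 this).resolve_right (μ.pos x).ne'

theorem apply_eq_inner (f : Ell2 μ) (x : X) : f x = (μ x)⁻¹ * ⟪delta μ x, f⟫_ℝ := by
  rw [inner_delta]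
  have := (μ.pos x).ne'
  field_simp

theorem continuous_apply (x : X) : Continuous fun f : Ell2 μ => f x := by
  simp_rw [apply_eq_inner _ x]
  fun_prop

theorem tendsto_apply {ι : Type*} {l : Filter ι} {u : ι → Ell2 μ} {f : Ell2 μ}
    (h : Tendsto u l (𝓝 f)) (x : X) : Tendsto (fun i => u i x) l (𝓝 (f x)) :=
  ((continuous_apply x).tendsto f).comp h

/-- The finitely supported functions. -/
def finSupp (μ : Weight X) : Submodule ℝ (Ell2 μ) where
  carrier := {f | (Function.support f).Finite}
  zero_mem' := by
    have : Function.support ((0 : Ell2 μ) : X → ℝ) = ∅ := by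
      ext x
      rw [Function.mem_support, zero_apply]
      simp
    rw [Set.mem_ofPred_eq, this]; exact Set.finite_empty
  add_mem' := fun {f g} hf hg => by
    refine (hf.union hg).subset fun x hx => ?_
    by_contra h
    simp only [Set.mem_union, Function.mem_support, not_or, not_not] at h
    exact hx (by rw [add_apply, h.1, h.2, add_zero])
  smul_mem' := fun c f hf => by
    refine Set.Finite.subset hf fun x hx => ?_
    by_contra h
    simp only [Function.mem_support, not_not] at h
    exact hx (by rw [smul_apply, h, mul_zero])

theorem mem_finSupp {f : Ell2 μ} : f ∈ finSupp μ ↔ (Function.support f).Finite := Iff.rfl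

theorem indicator_mem_finSupp (s : Finset X) : indicator μ s ∈ finSupp μ :=
  s.finite_toSet.subset fun x hx => by
    by_contra h
    exact hx (by simpa [indicator_apply] using h)

theorem delta_mem_finSupp (x : X) : delta μ x ∈ finSupp μ := indicator_mem_finSupp _

theorem eq_sum_delta {f : Ell2 μ} {s : Finset X} (h : ∀ x, f x ≠ 0 → x ∈ s) :
    f = ∑ x ∈ s, f x • delta μ x := ext fun y => by
  rw [sum_apply]
  by_cases hy : y ∈ s
  · rw [Finset.sum_eq_single_of_mem y hy fun x _ hx => by
      rw [smul_apply, delta_of_ne hx.symm, mul_zero], smul_apply, delta_self, mul_one]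
  · rw [Finset.sum_eq_zero fun x hx => by
      rw [smul_apply, delta_of_ne (by rintro rfl; exact hy hx), mul_zero]]
    by_contra h0
    exact hy (h y h0)

theorem dense_finSupp (μ : Weight X) : Dense (finSupp μ : Set (Ell2 μ)) := by
  rw [Submodule.dense_iff_topologicalClosure_eq_top, Submodule.topologicalClosure_eq_top_iff,
    Submodule.eq_bot_iff]
  intro w hw
  refine eq_zero_of_inner_delta w ?_
  rintro _ ⟨x, rfl⟩
  exact (Submodule.mem_orthogonal _ _).1 hw _ (delta_mem_finSupp x)

end Ell2

/-! ## Dirichlet forms -/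

/-- A bounded family in the domain of a nonnegative closed form that converges pointwise converges
weakly in the form domain. -/
theorem SymForm.NonnegClosed.exists_pointwise_limit {q : SymForm (Ell2 μ)} (hq : q.NonnegClosed)
    {ι : Type*} {l : Filter ι} [l.NeBot] {u : ι → q.domain} {M : ℝ}
    (hu : ∀ᶠ i in l, (q.shift 1).form (u i) (u i) ≤ M) {f : X → ℝ}
    (hf : ∀ x, Tendsto (fun i => (u i : Ell2 μ) x) l (𝓝 (f x))) :
    ∃ v : q.domain, (∀ x, (v : Ell2 μ) x = f x) ∧ (q.shift 1).form v v ≤ M ∧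
      ∀ w : q.domain, Tendsto (fun i => (q.shift 1).form (u i) w) l
        (𝓝 ((q.shift 1).form v w)) := by
  obtain ⟨v, h1, h2, h3⟩ := hq.exists_weak_limit (S := Set.range (Ell2.delta μ))
    Ell2.eq_zero_of_inner_delta hu (by
      rintro _ ⟨x, rfl⟩
      simp only [Ell2.inner_delta]
      exact ⟨_, (hf x).mul_const _⟩)
  refine ⟨v, fun x => ?_, h1, h2⟩
  have h4 := h3 (Ell2.delta μ x)
  simp only [Ell2.inner_delta] at h4
  exact mul_right_cancel₀ (μ.pos x).ne' (tendsto_nhds_unique h4 ((hf x).mul_const _))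

namespace IsDirichletForm

variable {q : SymForm (Ell2 μ)}

/-- Normal contractions operate on `q + ⟪·, ·⟫`. -/
theorem shift_contraction (hq : IsDirichletForm q) (C : ℝ → ℝ) (h0 : C 0 = 0) (hC : ∀ s t, |C s - C t| ≤ |s - t|)
    (f : q.domain) : ∃ g : q.domain, (∀ x, (g : Ell2 μ) x = C ((f : Ell2 μ) x)) ∧
      (q.shift 1).form g g ≤ (q.shift 1).form f f := by
  obtain ⟨g, hg, hgf⟩ := hq.contraction C h0 hC f
  refine ⟨g, hg, ?_⟩
  rw [SymForm.shift_self, SymForm.shift_self]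
  have : ‖(g : Ell2 μ)‖ ≤ ‖(f : Ell2 μ)‖ := Ell2.norm_le_of_abs_le fun x => by
    simpa [hg, h0] using hC ((f : Ell2 μ) x) 0
  gcongr

theorem exists_posPart (hq : IsDirichletForm q) (f : q.domain) : ∃ g : q.domain,
    (∀ x, (g : Ell2 μ) x = max ((f : Ell2 μ) x) 0) ∧
      (q.shift 1).form g g ≤ (q.shift 1).form f f :=
  hq.shift_contraction (fun s => max s 0) (by simp)
    (fun s t => by simpa using abs_max_sub_max_le_abs s t 0) f

/-- The positive and the negative part of a function have nonpositive mixed energy. -/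
theorem shift_pos_neg_nonpos (hq : IsDirichletForm q) {f g : q.domain} {k : X → ℝ}
    (hf : ∀ x, (f : Ell2 μ) x = max (k x) 0) (hg : ∀ x, (g : Ell2 μ) x = max (-k x) 0) :
    (q.shift 1).form f g ≤ 0 := by
  -- The functions f and g are the positive and negative parts of k, so |f - g| = f + g. Contracting
  -- by the absolute value and expanding both squares leaves the sign of the mixed term.
  obtain ⟨a, ha, hle⟩ := hq.shift_contraction (fun s => |s|) (by simp)
    (fun s t => abs_abs_sub_abs_le_abs_sub s t) (f - g)
  have : a = f + g := Subtype.ext (Ell2.ext fun x => by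
    rw [ha, Submodule.coe_sub, Submodule.coe_add, Ell2.sub_apply, Ell2.add_apply, hf, hg]
    rcases le_total (k x) 0 with h | h
    · rw [max_eq_right h, max_eq_left (by linarith), zero_sub, abs_neg, abs_of_nonneg (by linarith)]
      ring
    · rw [max_eq_left h, max_eq_right (by linarith), sub_zero, abs_of_nonneg h]
      ring)
  rw [this] at hle
  have h1 := (q.shift 1).form_add_self f g
  have h2 := (q.shift 1).form_sub_self f g
  linarith

variable {α : ℝ}

/-- If a normal contraction fixes the values of `f / α`, then it fixes those of the resolvent. -/
theorem contraction_resolvent (hq : IsDirichletForm q) (hα : 0 < α) (C : ℝ → ℝ) (h0 : C 0 = 0)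
    (hC : ∀ s t, |C s - C t| ≤ |s - t|) {f : Ell2 μ} (hf : ∀ x, C (α⁻¹ * f x) = α⁻¹ * f x) (x : X) :
    C ((q.resolvent α f : Ell2 μ) x) = (q.resolvent α f : Ell2 μ) x := by
  obtain ⟨g, hg, hle⟩ := hq.contraction C h0 hC (q.resolvent α f)
  -- The resolvent is the unique minimizer of q(v) + α‖v - f/α‖². Applying C increases neither term,
  -- since C fixes the values of f/α.
  have := hq.nonnegClosed.eq_resolvent_of_le hα f hle (Ell2.norm_le_of_abs_le fun y => by
    rw [Ell2.sub_apply, Ell2.sub_apply, Ell2.smul_apply, hg, ← hf y]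
    conv_rhs => rw [hf y]
    exact hC _ _)
  rw [← hg, this]

theorem resolvent_nonneg (hq : IsDirichletForm q) (hα : 0 < α) {f : Ell2 μ} (hf : ∀ x, 0 ≤ f x) (x : X) :
    0 ≤ (q.resolvent α f : Ell2 μ) x := by
  have := hq.contraction_resolvent hα (fun s => max s 0) (by simp)
    (fun s t => by simpa using abs_max_sub_max_le_abs s t 0)
    (fun x => max_eq_left (mul_nonneg (inv_nonneg.2 hα.le) (hf x))) x
  exact max_eq_left_iff.1 this

theorem resolvent_mono (hq : IsDirichletForm q) (hα : 0 < α) {f g : Ell2 μ} (h : ∀ x, f x ≤ g x) (x : X) :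
    (q.resolvent α f : Ell2 μ) x ≤ (q.resolvent α g : Ell2 μ) x := by
  have h1 := hq.resolvent_nonneg hα (f := g - f) (fun x => by
    rw [Ell2.sub_apply]; linarith [h x]) x
  have h2 := hq.nonnegClosed.resolvent_add hα (g - f) f
  rw [sub_add_cancel] at h2
  rw [h2, Submodule.coe_add, Ell2.add_apply]
  linarith

/-- The sub-Markov property: truncation to the interval from -M/α to M/α is a normal contraction
that fixes the values of f/α. -/
theorem abs_resolvent_le (hq : IsDirichletForm q) (hα : 0 < α) {f : Ell2 μ} {M : ℝ} (hf : ∀ x, |f x| ≤ M) (x : X) :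
    |α * (q.resolvent α f : Ell2 μ) x| ≤ M := by
  have hM : 0 ≤ M := (abs_nonneg _).trans (hf x)
  have hM' : 0 ≤ α⁻¹ * M := by positivity
  have h1 := hq.contraction_resolvent hα (fun s => max (-(α⁻¹ * M)) (min s (α⁻¹ * M)))
    (by simp [hM'])
    (fun s t => by
      refine (abs_max_sub_max_le_max _ _ _ _).trans ?_
      rw [sub_self, abs_zero, max_eq_right (abs_nonneg _)]
      refine (abs_min_sub_min_le_max _ _ _ _).trans ?_
      rw [sub_self, abs_zero, max_eq_left (abs_nonneg _)])
    (f := f) (fun x => by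
      have h2 := abs_le.1 (hf x)
      have h3 : α⁻¹ * f x ≤ α⁻¹ * M := mul_le_mul_of_nonneg_left h2.2 (by positivity)
      have h4 : α⁻¹ * -M ≤ α⁻¹ * f x := mul_le_mul_of_nonneg_left h2.1 (by positivity)
      rw [min_eq_left h3, max_eq_right (by linarith)]) x
  have h2 : |(q.resolvent α f : Ell2 μ) x| ≤ α⁻¹ * M := by
    rw [← h1, abs_le]
    exact ⟨le_max_left _ _, max_le (by linarith) (min_le_right _ _)⟩
  rw [abs_mul, abs_of_pos hα]
  rwa [inv_mul_eq_div, le_div_iff₀ hα, mul_comm] at h2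

end IsDirichletForm

end ell2

/-! ## Finite parts of the energy -/

namespace WeightedGraph

variable {X : Type*} (G : WeightedGraph X) (μ : Weight X) (V : X → ℝ)

/-- The part of the energy of `f` that lives on a finite set of vertices. -/
def partialEnergy (A : Finset X) (f : X → ℝ) : ℝ :=
  1 / 2 * ∑ x ∈ A, ∑ y ∈ A, G.b x y * (f x - f y) ^ 2 + ∑ x ∈ A, V x * f x ^ 2 * μ x

variable {G μ V} {f g : X → ℝ}

theorem partialEnergy_le_energy (hV : ∀ x, 0 ≤ V x) (hf : G.FiniteEnergy μ V f) (A : Finset X) :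
    G.partialEnergy μ V A f ≤ G.energy μ V f f := by
  have h1 := hf.summable_edge hf
  have h2 := hf.summable_vertex hf
  unfold partialEnergy energy
  refine add_le_add (mul_le_mul_of_nonneg_left ?_ (by norm_num)) ?_
  · rw [← Finset.sum_product']
    refine (Finset.sum_congr rfl fun p _ => by ring).trans_le
      (h1.sum_le_tsum (A ×ˢ A) fun p _ => ?_)
    exact mul_nonneg (G.nonneg _ _) (mul_self_nonneg _)
  · refine (Finset.sum_congr rfl fun p _ => by ring).trans_le (h2.sum_le_tsum A fun x _ => ?_)
    have h3 := hV x
    have h4 := (μ.pos x).le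
    rw [mul_assoc (V x)]
    exact mul_nonneg (mul_nonneg h3 (mul_self_nonneg _)) h4

/-- Partial energies are finite sums, hence continuous under pointwise convergence and monotone
under contractions. This lemma turns such bounds into bounds for the full energy and plays the role
of Fatou's lemma. -/
theorem finiteEnergy_of_partialEnergy_le (hV : ∀ x, 0 ≤ V x) {M : ℝ}
    (h : ∀ A, G.partialEnergy μ V A f ≤ M) : G.FiniteEnergy μ V f ∧ G.energy μ V f f ≤ M := by
  classical
  have he : ∀ x y, 0 ≤ G.b x y * (f x - f y) ^ 2 := fun x y =>
    mul_nonneg (G.nonneg _ _) (sq_nonneg _)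
  have hv : ∀ x, 0 ≤ V x * f x ^ 2 * μ x := fun x =>
    mul_nonneg (mul_nonneg (hV x) (sq_nonneg _)) (μ.pos x).le
  have key : ∀ (S : Finset (X × X)) (T : Finset X),
      1 / 2 * ∑ p ∈ S, G.b p.1 p.2 * (f p.1 - f p.2) ^ 2 + ∑ x ∈ T, V x * f x ^ 2 * μ x ≤ M := by
    intro S T
    -- Collecting all endpoints makes A × A contain the arbitrary finite set `S` of pairs.
    let A := S.image Prod.fst ∪ S.image Prod.snd ∪ T
    refine le_trans ?_ (h A)
    unfold partialEnergy
    refine add_le_add (mul_le_mul_of_nonneg_left ?_ (by norm_num)) ?_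
    · rw [← Finset.sum_product']
      refine Finset.sum_le_sum_of_subset_of_nonneg (fun p hp => ?_) fun p _ _ => he _ _
      simp only [Finset.mem_product, A, Finset.mem_union, Finset.mem_image]
      exact ⟨Or.inl (Or.inl ⟨p, hp, rfl⟩), Or.inl (Or.inr ⟨p, hp, rfl⟩)⟩
    · exact Finset.sum_le_sum_of_subset_of_nonneg Finset.subset_union_right fun p _ _ => hv _
  have s1 : Summable fun p : X × X => G.b p.1 p.2 * (f p.1 - f p.2) ^ 2 :=
    summable_of_sum_le (c := 2 * M) (fun p => he _ _) fun S => by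
      have := key S ∅
      rw [Finset.sum_empty] at this
      linarith
  have s2 : Summable fun x => V x * f x ^ 2 * μ x :=
    summable_of_sum_le (c := M) (fun p => hv _) fun T => by
      have := key ∅ T
      rw [Finset.sum_empty] at this
      linarith
  refine ⟨⟨s1, s2.congr fun x => by rw [abs_of_nonneg (hV x)]⟩, ?_⟩
  have h1 : ∀ T : Finset X, 1 / 2 * ∑' p : X × X, G.b p.1 p.2 * (f p.1 - f p.2) ^ 2 ≤
      M - ∑ x ∈ T, V x * f x ^ 2 * μ x := fun T => by
    have := s1.tsum_le_of_sum_le (a₂ := 2 * (M - ∑ x ∈ T, V x * f x ^ 2 * μ x)) fun S => by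
      linarith [key S T]
    linarith
  have h2 := s2.tsum_le_of_sum_le
    (a₂ := M - 1 / 2 * ∑' p : X × X, G.b p.1 p.2 * (f p.1 - f p.2) ^ 2) fun T => by
      linarith [h1 T]
  unfold energy
  rw [tsum_congr fun p : X × X =>
      show G.b p.1 p.2 * ((f p.1 - f p.2) * (f p.1 - f p.2)) = _ by rw [← sq],
    tsum_congr fun x => show V x * f x * f x * μ x = V x * f x ^ 2 * μ x by ring]
  linarith

theorem partialEnergy_mono (hV : ∀ x, 0 ≤ V x) (h1 : ∀ x y, |f x - f y| ≤ |g x - g y|)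
    (h2 : ∀ x, |f x| ≤ |g x|) (A : Finset X) :
    G.partialEnergy μ V A f ≤ G.partialEnergy μ V A g := by
  unfold partialEnergy
  refine add_le_add (mul_le_mul_of_nonneg_left ?_ (by norm_num)) ?_
  · exact Finset.sum_le_sum fun x _ => Finset.sum_le_sum fun y _ =>
      mul_le_mul_of_nonneg_left (sq_le_sq.2 (h1 x y)) (G.nonneg _ _)
  · exact Finset.sum_le_sum fun x _ => mul_le_mul_of_nonneg_right
      (mul_le_mul_of_nonneg_left (sq_le_sq.2 (h2 x)) (hV x)) (μ.pos x).le

theorem tendsto_partialEnergy {ι : Type*} {l : Filter ι} {u : ι → X → ℝ}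
    (h : ∀ x, Tendsto (fun i => u i x) l (𝓝 (f x))) (A : Finset X) :
    Tendsto (fun i => G.partialEnergy μ V A (u i)) l (𝓝 (G.partialEnergy μ V A f)) := by
  unfold partialEnergy
  refine Tendsto.add (Tendsto.const_mul _ ?_) ?_
  · exact tendsto_finsetSum _ fun x _ => tendsto_finsetSum _ fun y _ =>
      (((h x).sub (h y)).pow 2).const_mul _
  · exact tendsto_finsetSum _ fun x _ => (((h x).pow 2).const_mul _).mul_const _

theorem energy_self_nonneg (hV : ∀ x, 0 ≤ V x) : 0 ≤ G.energy μ V f f := by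
  unfold energy
  refine add_nonneg (mul_nonneg (by norm_num) (tsum_nonneg fun p => ?_)) (tsum_nonneg fun x => ?_)
  · exact mul_nonneg (G.nonneg _ _) (mul_self_nonneg _)
  · rw [mul_assoc (V x)]
    exact mul_nonneg (mul_nonneg (hV x) (mul_self_nonneg _)) (μ.pos x).le

theorem FiniteEnergy.of_contraction (hV : ∀ x, 0 ≤ V x) (hg : G.FiniteEnergy μ V g)
    (h1 : ∀ x y, |f x - f y| ≤ |g x - g y|) (h2 : ∀ x, |f x| ≤ |g x|) :
    G.FiniteEnergy μ V f ∧ G.energy μ V f f ≤ G.energy μ V g g :=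
  finiteEnergy_of_partialEnergy_le hV fun A =>
    (partialEnergy_mono hV h1 h2 A).trans (partialEnergy_le_energy hV hg A)

theorem FiniteEnergy.summable_row (hf : G.FiniteEnergy μ V f) (x : X) :
    Summable fun y => G.b x y * (f x - f y) ^ 2 :=
  hf.1.comp_injective (i := fun y => (x, y)) fun _ _ h => congrArg Prod.snd h

theorem FiniteEnergy.formalDomain (hf : G.FiniteEnergy μ V f) : G.FormalDomain f := fun x => by
  refine Summable.of_nonneg_of_le (fun y => mul_nonneg (G.nonneg _ _) (abs_nonneg _)) (fun y => ?_)
    (((G.summable x).mul_left (|f x| + 1)).add (hf.summable_row x))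
  have h1 : |f y| ≤ |f x| + |f x - f y| := by
    have := abs_sub_abs_le_abs_sub (f y) (f x)
    rw [abs_sub_comm] at this
    linarith
  have h2 : |f x - f y| ≤ 1 + (f x - f y) ^ 2 := by
    rw [← sq_abs (f x - f y)]
    nlinarith [sq_nonneg (|f x - f y| - 1), abs_nonneg (f x - f y)]
  have := mul_le_mul_of_nonneg_left (h1.trans (add_le_add_right h2 _)) (G.nonneg x y)
  linarith

theorem FormalDomain.summable (hf : G.FormalDomain f) (x : X) :
    Summable fun y => G.b x y * (f x - f y) := by
  have h1 : Summable fun y => G.b x y * f y :=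
    ((hf x).congr fun y => by rw [abs_mul, abs_of_nonneg (G.nonneg x y)]).of_abs
  exact (((G.summable x).mul_right (f x)).sub h1).congr fun y => by ring

/-- The formal operator is continuous with respect to bounded pointwise convergence. -/
theorem tendsto_formalOp {ι : Type*} {l : Filter ι} {u : ι → X → ℝ} {M : ℝ}
    (hb : ∀ᶠ i in l, ∀ x, |u i x| ≤ M) (h : ∀ x, Tendsto (fun i => u i x) l (𝓝 (f x))) (x : X) :
    Tendsto (fun i => G.formalOp μ V (u i) x) l (𝓝 (G.formalOp μ V f x)) := by
  unfold formalOp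
  refine Tendsto.add (Tendsto.const_mul _ ?_) ((h x).const_mul _)
  -- The row sums of b are finite, so a uniform bound on the functions suffices and local finiteness
  -- plays no role.
  refine tendsto_tsum_of_dominated_convergence (bound := fun y => G.b x y * (2 * M))
    ((G.summable x).mul_right _) (fun y => ((h x).sub (h y)).const_mul _) ?_
  filter_upwards [hb] with i hi y
  rw [Real.norm_eq_abs, abs_mul, abs_of_nonneg (G.nonneg x y)]
  refine mul_le_mul_of_nonneg_left ?_ (G.nonneg x y)
  have := abs_sub (u i x) (u i y)
  linarith [hi x, hi y]

theorem formalOp_smul (c : ℝ) (f : X → ℝ) (x : X) :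
    G.formalOp μ V (fun y => c * f y) x = c * G.formalOp μ V f x := by
  unfold formalOp
  rw [tsum_congr fun y => show G.b x y * (c * f x - c * f y) = c * (G.b x y * (f x - f y)) by ring,
    tsum_mul_left]
  ring

theorem formalOp_one (x : X) : G.formalOp μ V (fun _ => 1) x = V x := by
  simp [formalOp]

theorem hasSum_slice_left {F : X × X → ℝ} {x : X} {s : ℝ} (h : HasSum (fun y => F (x, y)) s)
    (h0 : ∀ p : X × X, p.1 ≠ x → F p = 0) : HasSum F s := by
  have hi : Function.Injective fun y : X => (x, y) := fun _ _ h => congrArg Prod.snd h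
  refine (hi.hasSum_iff fun p hp => h0 p fun h1 => hp ⟨p.2, ?_⟩).1 h
  rw [← h1]

theorem hasSum_slice_right {F : X × X → ℝ} {x : X} {s : ℝ} (h : HasSum (fun y => F (y, x)) s)
    (h0 : ∀ p : X × X, p.2 ≠ x → F p = 0) : HasSum F s := by
  have hi : Function.Injective fun y : X => (y, x) := fun _ _ h => congrArg Prod.fst h
  refine (hi.hasSum_iff fun p hp => h0 p fun h1 => hp ⟨p.1, ?_⟩).1 h
  rw [← h1]

end WeightedGraph

/-! ## The Neumann form -/

section neumann

open WeightedGraph Ell2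

variable {X : Type*} [Countable X] [MeasurableSpace X] [DiscreteMeasurableSpace X]
  {G : WeightedGraph X} {μ : Weight X} {V : X → ℝ}

/-- Green's formula for a single vertex. The edge sum is supported on the row and the column through
x, which contribute equally by symmetry of b and absorb the factor 1/2. -/
theorem energy_delta {f : X → ℝ} (hf : G.FormalDomain f) (x : X) :
    G.energy μ V f (delta μ x) = μ x * G.formalOp μ V f x := by
  have h0 := (hf.summable x).hasSum
  set S := ∑' y, G.b x y * (f x - f y) with hS
  have h1 : HasSum (fun p : X × X => G.b p.1 p.2 * ((f p.1 - f p.2) * delta μ x p.1)) S := by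
    refine hasSum_slice_left (x := x) (h0.congr_fun fun y => ?_) fun p hp => ?_
    · simp [delta_self]
    · rw [delta_of_ne hp]; ring
  have h2 : HasSum (fun p : X × X => G.b p.1 p.2 * ((f p.1 - f p.2) * delta μ x p.2)) (-S) := by
    refine hasSum_slice_right (x := x) (h0.neg.congr_fun fun y => ?_) fun p hp => ?_
    · simp only [delta_self, mul_one]; rw [G.symm]; ring
    · rw [delta_of_ne hp]; ring
  have h3 : ∑' p : X × X, G.b p.1 p.2 * ((f p.1 - f p.2) * (delta μ x p.1 - delta μ x p.2)) =
      S - -S := by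
    rw [← (h1.sub h2).tsum_eq]
    exact tsum_congr fun p => by ring
  have h4 : ∑' y, V y * f y * delta μ x y * μ y = V x * f x * μ x := by
    rw [tsum_eq_single x fun y hy => by rw [delta_of_ne hy]; ring, delta_self]; ring
  unfold energy formalOp
  rw [h3, h4, ← hS]
  have := (μ.pos x).ne'
  field_simp
  ring

theorem finiteEnergy_delta (x : X) : G.FiniteEnergy μ V (delta μ x) := by
  have h0 := (G.summable x).hasSum
  constructor
  · have h1 : Summable fun p : X × X => G.b p.1 p.2 * delta μ x p.1 :=
      (hasSum_slice_left (x := x) (h0.congr_fun fun y => by simp [delta_self]) fun p hp => by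
        rw [delta_of_ne hp]; ring).summable
    have h2 : Summable fun p : X × X => G.b p.1 p.2 * delta μ x p.2 :=
      (hasSum_slice_right (x := x) (h0.congr_fun fun y => by
        simp only [delta_self, mul_one]; exact G.symm _ _) fun p hp => by
        rw [delta_of_ne hp]; ring).summable
    refine Summable.of_nonneg_of_le (fun p => mul_nonneg (G.nonneg _ _) (sq_nonneg _))
      (fun p => ?_) (h1.add h2)
    rw [← mul_add]
    refine mul_le_mul_of_nonneg_left ?_ (G.nonneg _ _)
    have h : ∀ y, delta μ x y = 0 ∨ delta μ x y = 1 := fun y => by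
      rcases eq_or_ne y x with rfl | h
      · exact Or.inr (delta_self _)
      · exact Or.inl (delta_of_ne h)
    rcases h p.1 with h1 | h1 <;> rcases h p.2 with h2 | h2 <;> rw [h1, h2] <;> norm_num
  · exact summable_of_ne_finset_zero (s := {x}) fun y hy => by
      rw [delta_of_ne (by simpa using hy)]; ring

theorem neumannForm_apply (f g : (neumannForm G μ V).domain) :
    (neumannForm G μ V).form f g = G.energy μ V (f : Ell2 μ) (g : Ell2 μ) := rfl

theorem mem_neumannForm_domain {f : Ell2 μ} :
    f ∈ (neumannForm G μ V).domain ↔ G.FiniteEnergy μ V f := Iff.rfl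

theorem finSupp_le_neumannForm : finSupp μ ≤ (neumannForm G μ V).domain := fun f hf => by
  rw [eq_sum_delta (f := f) (s := (mem_finSupp.1 hf).toFinset) fun x hx => by simpa using hx]
  exact Submodule.sum_mem _ fun x _ => Submodule.smul_mem _ _
    (mem_neumannForm_domain.2 (finiteEnergy_delta x))

/-- The ℓ² limit is also a pointwise limit. Letting m tend to infinity in the partial energies of
u_n - u_m bounds the energy of u_n - f. -/
theorem neumannForm_nonnegClosed (hV : ∀ x, 0 ≤ V x) : (neumannForm G μ V).NonnegClosed where
  nonneg f := energy_self_nonneg hV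
  closed u hu hq := by
    obtain ⟨f, hf⟩ := cauchySeq_tendsto_of_complete hu
    have hx := fun x => tendsto_apply hf x
    have key : ∀ ε > 0, ∃ N, ∀ n ≥ N,
        G.FiniteEnergy μ V (fun x => (u n : Ell2 μ) x - f x) ∧
        G.energy μ V (fun x => (u n : Ell2 μ) x - f x) (fun x => (u n : Ell2 μ) x - f x) ≤ ε := by
      intro ε hε
      have h1 := hq.eventually (gt_mem_nhds hε)
      obtain ⟨⟨N₁, N₂⟩, hN⟩ := eventually_atTop.1 h1
      refine ⟨max N₁ N₂, fun n hn => finiteEnergy_of_partialEnergy_le hV fun A => ?_⟩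
      refine le_of_tendsto (tendsto_partialEnergy (u := fun m x => (u n : Ell2 μ) x - (u m : Ell2 μ) x)
        (fun x => tendsto_const_nhds.sub (hx x)) A) ?_
      filter_upwards [eventually_ge_atTop N₂] with m hm
      have h2 := (hN (n, m) ⟨le_of_max_le_left hn, hm⟩).le
      have h3 := partialEnergy_le_energy hV (u n - u m).2 A
      have h4 : ((u n - u m : (neumannForm G μ V).domain) : Ell2 μ) =
        fun x => (u n : Ell2 μ) x - (u m : Ell2 μ) x := funext fun x => by
          rw [Submodule.coe_sub, Ell2.sub_apply]
      rw [h4] at h3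
      refine h3.trans (le_trans (le_of_eq ?_) h2)
      rw [neumannForm_apply, h4]
    have hfun : ∀ n, ((u n : Ell2 μ) - f : Ell2 μ) = fun x => (u n : Ell2 μ) x - f x := fun n =>
      funext fun x => Ell2.sub_apply _ _ x
    have hfm : f ∈ (neumannForm G μ V).domain := by
      obtain ⟨N, hN⟩ := key 1 one_pos
      have h1 : (u N : Ell2 μ) - f ∈ (neumannForm G μ V).domain := by
        rw [mem_neumannForm_domain, hfun]
        exact (hN N le_rfl).1
      simpa using Submodule.sub_mem _ (u N).2 h1
    refine ⟨⟨f, hfm⟩, hf, ?_⟩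
    rw [Metric.tendsto_atTop]
    intro ε hε
    obtain ⟨N, hN⟩ := key (ε / 2) (by positivity)
    refine ⟨N, fun n hn => ?_⟩
    have h1 := (hN n hn).2
    rw [Real.dist_eq, sub_zero, neumannForm_apply, abs_of_nonneg (energy_self_nonneg hV),
      Submodule.coe_sub, hfun]
    linarith

theorem denselyDefined_of_finSupp_le {q : SymForm (Ell2 μ)} (h : finSupp μ ≤ q.domain) :
    q.DenselyDefined := (dense_finSupp μ).mono h

theorem isDirichletForm_neumannForm (hV : ∀ x, 0 ≤ V x) : IsDirichletForm (neumannForm G μ V) where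
  nonneg := (neumannForm_nonnegClosed hV).nonneg
  dense := denselyDefined_of_finSupp_le finSupp_le_neumannForm
  closed := (neumannForm_nonnegClosed hV).closed
  contraction C h0 hC f := by
    have habs : ∀ x, |C ((f : Ell2 μ) x)| ≤ |(f : Ell2 μ) x| := fun x => by
      simpa [h0] using hC ((f : Ell2 μ) x) 0
    obtain ⟨g, hg⟩ := exists_of_abs_le (f : Ell2 μ) habs
    have := FiniteEnergy.of_contraction (f := g) hV f.2 (fun x y => by
      rw [hg, hg]; exact hC _ _) (fun x => by rw [hg]; exact habs x)
    exact ⟨⟨g, this.1⟩, hg, this.2⟩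

/-- The operator of a Dirichlet form that is a restriction of the Neumann form and contains the
finitely supported functions is a Markovian realization. -/
theorem isMarkovianRealization_operator {q : SymForm (Ell2 μ)} (hq : IsDirichletForm q)
    (hfin : finSupp μ ≤ q.domain) (hN : q.domain ≤ (neumannForm G μ V).domain)
    (hE : ∀ f g : q.domain, q.form f g = G.energy μ V (f : Ell2 μ) (g : Ell2 μ)) :
    IsMarkovianRealization G μ V q.operator := by
  have hlb : ∀ f, 0 ≤ q.form f f := hq.nonneg
  have hF : q.IsFormOf q.operator := ⟨hq.dense, ⟨0, fun f => by simpa using hlb f⟩, hq.closed, rfl⟩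
  refine ⟨⟨SymForm.operator_isSelfAdjoint hq.nonnegClosed hq.dense, ⟨0, fun f => by
    simpa using SymForm.operator_nonneg hq.nonnegClosed hq.dense f⟩,
    ⟨q, hF, fun φ hφ => hfin hφ⟩, fun f => ?_⟩, q, hF, hq⟩
  obtain ⟨f', hf', h⟩ := SymForm.exists_form_operator hq.dense f
  have hfd : G.FormalDomain (f : Ell2 μ) := by
    rw [← hf']
    exact FiniteEnergy.formalDomain (mem_neumannForm_domain.1 (hN f'.2))
  refine ⟨hfd, fun x => ?_⟩
  -- Testing the form equation against the indicator of a vertex recovers the formal operator there.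
  have h1 := h ⟨delta μ x, hfin (delta_mem_finSupp x)⟩
  rw [hE, real_inner_comm, inner_delta, hf', energy_delta hfd] at h1
  exact mul_right_cancel₀ (μ.pos x).ne' (by rw [← h1, mul_comm])

end neumann

/-! ## Closures of subspaces in form norm -/

namespace SymForm

variable {E : Type*} [NormedAddCommGroup E] [InnerProductSpace ℝ E] {q : SymForm E}

/-- The restriction of a form to a smaller domain. -/
def restrict (q : SymForm E) (p : Submodule ℝ E) (h : p ≤ q.domain) : SymForm E where
  domain := p
  form := q.form.compl₁₂ (Submodule.inclusion h) (Submodule.inclusion h)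
  symm _ _ := q.symm _ _

theorem NonnegClosed.form_add_le (hq : q.NonnegClosed) (f g : q.domain) :
    q.form (f + g) (f + g) ≤ 2 * q.form f f + 2 * q.form g g := by
  have h1 := hq.nonneg (f - g)
  rw [form_sub_self] at h1
  rw [form_add_self]
  linarith

/-- The closure of a subspace with respect to the form norm. -/
def NonnegClosed.formClosure (hq : q.NonnegClosed) (S : Submodule ℝ E) : Submodule ℝ E where
  carrier := {f | ∃ f' : q.domain, (f' : E) = f ∧ ∀ ε > 0, ∃ φ : q.domain, (φ : E) ∈ S ∧
    (q.shift 1).form (f' - φ : q.domain) (f' - φ : q.domain) < ε}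
  zero_mem' := ⟨0, rfl, fun ε hε => ⟨0, S.zero_mem, by simpa using hε⟩⟩
  add_mem' := by
    rintro _ _ ⟨f, rfl, hf⟩ ⟨g, rfl, hg⟩
    refine ⟨f + g, rfl, fun ε hε => ?_⟩
    obtain ⟨φ, hφ, h1⟩ := hf (ε / 4) (by positivity)
    obtain ⟨ψ, hψ, h2⟩ := hg (ε / 4) (by positivity)
    refine ⟨φ + ψ, S.add_mem hφ hψ, ?_⟩
    have h3 := (hq.shift zero_le_one).form_add_le (f - φ : q.domain) (g - ψ : q.domain)
    rw [show (f + g - (φ + ψ) : q.domain) = (f - φ) + (g - ψ) by abel]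
    linarith
  smul_mem' := by
    rintro c _ ⟨f, rfl, hf⟩
    refine ⟨c • f, rfl, fun ε hε => ?_⟩
    obtain ⟨φ, hφ, h1⟩ := hf (ε / (c ^ 2 + 1)) (by positivity)
    refine ⟨c • φ, S.smul_mem c hφ, ?_⟩
    have h3 := (q.shift 1).form_smul_self c (f - φ : q.domain)
    rw [← smul_sub]
    refine h3.trans_lt ?_
    rw [lt_div_iff₀ (by positivity)] at h1
    have := (hq.shift zero_le_one).nonneg (f - φ : q.domain)
    nlinarith

variable {S : Submodule ℝ E}

theorem NonnegClosed.mem_formClosure (hq : q.NonnegClosed) {f : q.domain} :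
    (f : E) ∈ hq.formClosure S ↔ ∀ ε > 0, ∃ φ : q.domain, (φ : E) ∈ S ∧
      (q.shift 1).form (f - φ : q.domain) (f - φ : q.domain) < ε := by
  constructor
  · rintro ⟨f', hf, h⟩
    obtain rfl : f' = f := Subtype.ext hf
    exact h
  · exact fun h => ⟨f, rfl, h⟩

theorem NonnegClosed.formClosure_le (hq : q.NonnegClosed) : hq.formClosure S ≤ q.domain := by
  rintro _ ⟨f, rfl, -⟩
  exact f.2

theorem NonnegClosed.le_formClosure (hq : q.NonnegClosed) (hS : S ≤ q.domain) :
    S ≤ hq.formClosure S := fun f hf =>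
  ⟨⟨f, hS hf⟩, rfl, fun ε hε => ⟨⟨f, hS hf⟩, hf, by simpa using hε⟩⟩

theorem NonnegClosed.restrict_formClosure (hq : q.NonnegClosed) (S : Submodule ℝ E) :
    (q.restrict (hq.formClosure S) hq.formClosure_le).NonnegClosed where
  nonneg f := hq.nonneg _
  closed u hu h := by
    let v : ℕ → q.domain := fun n => Submodule.inclusion hq.formClosure_le (u n)
    obtain ⟨f, hf, hqf⟩ := hq.closed v hu h
    have h1 : Tendsto (fun n => (q.shift 1).form (v n - f : q.domain) (v n - f : q.domain)) atTop
        (𝓝 0) := by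
      have := hqf.add ((tendsto_iff_norm_sub_tendsto_zero.1 hf).pow 2)
      rw [zero_pow two_ne_zero, add_zero] at this
      refine this.congr fun n => ?_
      rw [shift_self, Submodule.coe_sub, one_mul]
    have hfm : (f : E) ∈ hq.formClosure S := hq.mem_formClosure.2 fun ε hε => by
      obtain ⟨n, hn⟩ := (h1.eventually (gt_mem_nhds (show 0 < ε / 4 by positivity))).exists
      obtain ⟨φ, hφ, h2⟩ := (hq.mem_formClosure (f := v n)).1 (u n).2 (ε / 4) (by positivity)
      refine ⟨φ, hφ, ?_⟩
      have h3 := (hq.shift zero_le_one).form_add_le (-(v n - f) : q.domain) (v n - φ : q.domain)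
      rw [show (f - φ : q.domain) = -(v n - f) + (v n - φ) by abel]
      have h4 : (q.shift 1).form (-(v n - f) : q.domain) (-(v n - f) : q.domain) =
        (q.shift 1).form (v n - f : q.domain) (v n - f : q.domain) := by
          simp only [map_neg, LinearMap.neg_apply, neg_neg]
      linarith
    exact ⟨⟨f, hfm⟩, hf, hqf⟩

end SymForm

section dirichlet

open Ell2

variable {X : Type*} [Countable X] [MeasurableSpace X] [DiscreteMeasurableSpace X] {μ : Weight X}
  {q : SymForm (Ell2 μ)}

/-- Closures in form norm are stable under bounded pointwise convergence. -/
theorem SymForm.NonnegClosed.mem_formClosure_of_tendsto (hq : q.NonnegClosed)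
    {S : Submodule ℝ (Ell2 μ)} {ι : Type*} {l : Filter ι} [l.NeBot] {u : ι → q.domain} {M : ℝ}
    (hS : ∀ᶠ i in l, (u i : Ell2 μ) ∈ hq.formClosure S)
    (hu : ∀ᶠ i in l, (q.shift 1).form (u i) (u i) ≤ M) {f : Ell2 μ}
    (hf : ∀ x, Tendsto (fun i => (u i : Ell2 μ) x) l (𝓝 (f x))) : f ∈ hq.formClosure S := by
  classical
  -- The restriction to the closure is itself a closed form, so weak limits stay in it. The value 0
  -- in `v` is only a filler for indices at which u is not in the closure.
  let r := q.restrict (hq.formClosure S) hq.formClosure_le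
  let v : ι → r.domain := fun i =>
    if h : (u i : Ell2 μ) ∈ hq.formClosure S then ⟨u i, h⟩ else 0
  have hv : ∀ᶠ i in l, (v i : Ell2 μ) = u i := by
    filter_upwards [hS] with i hi
    simp [v, hi]
  obtain ⟨w, hw, -⟩ := (hq.restrict_formClosure S).exists_pointwise_limit (u := v) (M := M) (by
    filter_upwards [hv, hu] with i h1 h2
    refine le_trans (le_of_eq ?_) h2
    have : Submodule.inclusion hq.formClosure_le (v i) = u i := Subtype.ext h1
    rw [← this]; rfl) (f := f) (fun x => by
    refine (hf x).congr' ?_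
    filter_upwards [hv] with i h1
    rw [h1])
  have : f = w := ext fun x => (hw x).symm
  exact this ▸ w.2

/-- The part of a Dirichlet form on the closure of the finitely supported functions is a Dirichlet
form. -/
theorem IsDirichletForm.restrict_finSupp (hq : IsDirichletForm q) (hfin : finSupp μ ≤ q.domain) :
    IsDirichletForm (q.restrict (hq.nonnegClosed.formClosure (finSupp μ))
      hq.nonnegClosed.formClosure_le) where
  nonneg f := hq.nonneg _
  dense := (dense_finSupp μ).mono (hq.nonnegClosed.le_formClosure hfin)
  closed := (hq.nonnegClosed.restrict_formClosure _).closed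
  contraction C h0 hC f := by
    let f' : q.domain := Submodule.inclusion hq.nonnegClosed.formClosure_le f
    obtain ⟨g, hg, hgf⟩ := hq.contraction C h0 hC f'
    have happ := hq.nonnegClosed.mem_formClosure (f := f').1 f.2
    choose φ hφ hφf using fun n : ℕ => happ (1 / ((n : ℝ) + 1)) (by positivity)
    -- Since C 0 = 0, contracting a finitely supported approximant keeps its support finite. The
    -- contracted functions have bounded form norm and converge pointwise to C ∘ f.
    choose ψ hψ hψφ using fun n => hq.shift_contraction C h0 hC (φ n)
    have hlim : Tendsto (fun n => (φ n : Ell2 μ)) atTop (𝓝 (f' : Ell2 μ)) := by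
      rw [tendsto_iff_norm_sub_tendsto_zero]
      have h2 : Tendsto (fun n => ‖(φ n : Ell2 μ) - f'‖ ^ 2) atTop (𝓝 0) := by
        refine squeeze_zero (fun n => by positivity) (fun n => ?_)
          tendsto_one_div_add_atTop_nhds_zero_nat
        have h3 := (hφf n).le
        rw [SymForm.shift_self, Submodule.coe_sub, norm_sub_rev] at h3
        linarith [hq.nonneg (f' - φ n)]
      simpa [Real.sqrt_sq] using h2.sqrt
    have hCc : Continuous C := (LipschitzWith.of_dist_le_mul (K := 1) fun s t => by
      simpa [Real.dist_eq] using hC s t).continuous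
    have hmem : (g : Ell2 μ) ∈ hq.nonnegClosed.formClosure (finSupp μ) := by
      refine hq.nonnegClosed.mem_formClosure_of_tendsto (l := atTop) (u := ψ)
        (M := 2 * (q.shift 1).form f' f' + 2) (Eventually.of_forall fun n => ?_)
        (Eventually.of_forall fun n => (hψφ n).trans ?_) fun x => ?_
      · refine hq.nonnegClosed.le_formClosure hfin ((mem_finSupp.1 (hφ n)).subset fun x hx => ?_)
        rw [Function.mem_support, hψ] at hx
        exact fun h => hx (by rw [h, h0])
      · have h3 := (hq.nonnegClosed.shift zero_le_one).form_add_le f' (-(f' - φ n) : q.domain)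
        have h4 : (q.shift 1).form (-(f' - φ n) : q.domain) (-(f' - φ n) : q.domain) =
          (q.shift 1).form (f' - φ n : q.domain) (f' - φ n : q.domain) := by
            simp only [map_neg, LinearMap.neg_apply, neg_neg]
        rw [h4, show (f' + -(f' - φ n) : q.domain) = φ n by abel] at h3
        have h5 : 1 / ((n : ℝ) + 1) ≤ 1 := by
          rw [div_le_one (by positivity)]; linarith [Nat.cast_nonneg (α := ℝ) n]
        linarith [hφf n]
      · simp only [hψ, hg]
        exact (hCc.tendsto _).comp (tendsto_apply hlim x)
    exact ⟨⟨g, hmem⟩, hg, hgf⟩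

/-- If there is only one Markovian realization, then the finitely supported functions are dense in
the domain of the Neumann form. -/
theorem neumannForm_domain_le_of_existsUnique {G : WeightedGraph X} {V : X → ℝ}
    (hV : ∀ x, 0 ≤ V x)
    (h : ∃! H : Ell2 μ →ₗ.[ℝ] Ell2 μ, IsMarkovianRealization G μ V H) :
    (neumannForm G μ V).domain ≤
      (neumannForm_nonnegClosed (G := G) hV).formClosure (finSupp μ) := by
  have hN := isDirichletForm_neumannForm (G := G) (μ := μ) hV
  have hD := hN.restrict_finSupp finSupp_le_neumannForm
  have h1 := isMarkovianRealization_operator (G := G) (V := V) hN finSupp_le_neumannForm le_rfl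
    fun _ _ => rfl
  have h2 := isMarkovianRealization_operator (G := G) (V := V) hD
    (hN.nonnegClosed.le_formClosure finSupp_le_neumannForm) hN.nonnegClosed.formClosure_le
    fun _ _ => rfl
  exact SymForm.domain_le_of_operator_eq hN.nonnegClosed hN.dense hD.nonnegClosed hD.dense
    (h.unique h1 h2)

end dirichlet

/-! ## Forms of Markovian realizations -/

section markovian

open WeightedGraph Ell2 SymForm

variable {X : Type*} [Countable X] [MeasurableSpace X] [DiscreteMeasurableSpace X]
  {G : WeightedGraph X} {μ : Weight X} {V : X → ℝ}

theorem formalOp_delta {x y : X} (h : y ≠ x) :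
    G.formalOp μ V (delta μ x) y = -((μ y)⁻¹ * G.b x y) := by
  unfold formalOp
  rw [tsum_eq_single x fun z hz => by rw [delta_of_ne hz, delta_of_ne h]; ring, delta_of_ne h,
    delta_self, G.symm y x]
  ring

theorem inner_of_support {s : Finset X} {φ : Ell2 μ} (hs : ∀ x, φ x ≠ 0 → x ∈ s) (g : Ell2 μ) :
    ⟪g, φ⟫_ℝ = ∑ x ∈ s, g x * φ x * μ x :=
  (hasSum_inner g φ).unique (hasSum_sum_of_ne_finset_zero fun x hx => by
    have : φ x = 0 := by
      by_contra h
      exact hx (hs x h)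
    rw [this]; ring)

theorem energy_of_support {s : Finset X} {φ : Ell2 μ} (hs : ∀ x, φ x ≠ 0 → x ∈ s)
    (hφ : G.FiniteEnergy μ V φ) :
    G.energy μ V φ φ = ∑ x ∈ s, G.formalOp μ V φ x * φ x * μ x := by
  let φ' : (neumannForm G μ V).domain := ⟨φ, hφ⟩
  let d : X → (neumannForm G μ V).domain := fun x => ⟨delta μ x, finiteEnergy_delta x⟩
  have h1 : φ' = ∑ x ∈ s, φ x • d x := Subtype.ext (by
    rw [AddSubmonoidClass.coe_finsetSum]
    exact eq_sum_delta hs)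
  have h2 : (neumannForm G μ V).form φ' φ' = ∑ x ∈ s, φ x * (neumannForm G μ V).form φ' (d x) := by
    conv_lhs => rw [h1, map_sum, ← h1]
    exact Finset.sum_congr rfl fun x _ => by rw [map_smul, smul_eq_mul]
  rw [neumannForm_apply] at h2
  rw [h2]
  refine Finset.sum_congr rfl fun x _ => ?_
  rw [neumannForm_apply, energy_delta hφ.formalDomain]
  ring

theorem exists_abs_le_of_mem_finSupp {φ : Ell2 μ} (hφ : φ ∈ finSupp μ) : ∃ M, ∀ x, |φ x| ≤ M := by
  refine ⟨∑ x ∈ (mem_finSupp.1 hφ).toFinset, |φ x|, fun x => ?_⟩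
  by_cases h : φ x = 0
  · rw [h, abs_zero]
    exact Finset.sum_nonneg fun _ _ => abs_nonneg _
  · exact Finset.single_le_sum (f := fun x => |φ x|) (fun _ _ => abs_nonneg _) (by simpa using h)

/-- A lower bound for `⟪f - T f, f⟫` in terms of the kernel of a positivity preserving symmetric
operator `T`. -/
theorem kernel_le_inner {T : Ell2 μ →L[ℝ] Ell2 μ}
    (hT : ∀ f g, ⟪T f, g⟫_ℝ = ⟪f, T g⟫_ℝ) (hpos : ∀ x y, 0 ≤ T (delta μ x) y) {w : X → ℝ}
    (hw : ∀ s x, T (indicator μ s) x ≤ w x) (hw1 : ∀ x, w x ≤ 1) (A : Finset X) (f : Ell2 μ) :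
    1 / 2 * ∑ x ∈ A, ∑ y ∈ A, T (delta μ x) y * μ y * (f x - f y) ^ 2 +
      ∑ x ∈ A, (1 - w x) * f x ^ 2 * μ x ≤ ⟪f - T f, f⟫_ℝ := by
  classical
  -- Both sides are continuous in f, because only the finite set `A` enters on the left. It is
  -- enough to treat finitely supported f, for which all sums are finite.
  have hcl : IsClosed {f : Ell2 μ | 1 / 2 * ∑ x ∈ A, ∑ y ∈ A, T (delta μ x) y * μ y *
      (f x - f y) ^ 2 + ∑ x ∈ A, (1 - w x) * f x ^ 2 * μ x ≤ ⟪f - T f, f⟫_ℝ} := by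
    have hc := fun x => Ell2.continuous_apply (μ := μ) x
    refine isClosed_le ?_ (by fun_prop)
    refine Continuous.add (continuous_const.mul ?_) ?_
    · exact continuous_finsetSum _ fun x _ => continuous_finsetSum _ fun y _ =>
        continuous_const.mul (((hc x).sub (hc y)).pow 2)
    · exact continuous_finsetSum _ fun x _ => (continuous_const.mul ((hc x).pow 2)).mul
        continuous_const
  refine hcl.closure_subset_iff.2 (fun f hf => ?_) (dense_finSupp μ f)
  let F := (mem_finSupp.1 hf).toFinset ∪ A
  have hF : ∀ x, f x ≠ 0 → x ∈ F := fun x hx => Finset.mem_union_left _ (by simpa using hx)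
  set t : X → X → ℝ := fun x y => T (delta μ x) y * μ y with ht
  have ht' : ∀ x y, t x y = ⟪delta μ y, T (delta μ x)⟫_ℝ := fun x y => (inner_delta _ _).symm
  have htsymm : ∀ x y, t x y = t y x := fun x y => by
    rw [ht', ht', ← hT, real_inner_comm]
  have htpos : ∀ x y, 0 ≤ t x y := fun x y => mul_nonneg (hpos x y) (μ.pos y).le
  -- The row sum over `F` is T applied to the indicator of `F`. The missing mass up to μ(x) is what
  -- produces the killing term with weight 1 - w(x).
  have htsum : ∀ x, ∑ y ∈ F, t x y ≤ w x * μ x := fun x => by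
    have h1 : ∑ y ∈ F, t x y = T (indicator μ F) x * μ x := by
      rw [← inner_delta, real_inner_comm, hT, real_inner_comm,
        inner_of_support (s := F) (fun y hy => by simpa [indicator_apply] using hy)]
      exact Finset.sum_congr rfl fun y hy => by rw [indicator_apply, if_pos hy]; ring
    rw [h1]
    exact mul_le_mul_of_nonneg_right (hw F x) (μ.pos x).le
  have hTf : ∀ y, T f y = ∑ x ∈ F, f x * T (delta μ x) y := fun y => by
    conv_lhs => rw [eq_sum_delta hF, map_sum, Ell2.sum_apply]
    exact Finset.sum_congr rfl fun x _ => by rw [map_smul, Ell2.smul_apply]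
  have h1 : ⟪f - T f, f⟫_ℝ = ∑ x ∈ F, f x ^ 2 * μ x - ∑ x ∈ F, ∑ y ∈ F, t x y * (f x * f y) := by
    rw [inner_sub_left, inner_of_support hF, inner_of_support hF]
    congr 1
    · exact Finset.sum_congr rfl fun x _ => by ring
    · rw [Finset.sum_comm]
      refine Finset.sum_congr rfl fun y _ => ?_
      rw [hTf, Finset.sum_mul, Finset.sum_mul]
      exact Finset.sum_congr rfl fun x _ => by simp only [ht]; ring
  have h2 : 1 / 2 * ∑ x ∈ F, ∑ y ∈ F, t x y * (f x - f y) ^ 2 =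
      ∑ x ∈ F, (∑ y ∈ F, t x y) * f x ^ 2 - ∑ x ∈ F, ∑ y ∈ F, t x y * (f x * f y) := by
    have h3 : ∑ x ∈ F, ∑ y ∈ F, t x y * f y ^ 2 = ∑ x ∈ F, (∑ y ∈ F, t x y) * f x ^ 2 := by
      rw [Finset.sum_comm]
      refine Finset.sum_congr rfl fun x _ => ?_
      rw [Finset.sum_mul]
      exact Finset.sum_congr rfl fun y _ => by rw [htsymm]
    have h4 : ∑ x ∈ F, ∑ y ∈ F, t x y * f x ^ 2 = ∑ x ∈ F, (∑ y ∈ F, t x y) * f x ^ 2 :=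
      Finset.sum_congr rfl fun x _ => by rw [Finset.sum_mul]
    have h5 : ∑ x ∈ F, ∑ y ∈ F, t x y * (f x - f y) ^ 2 = ∑ x ∈ F, ∑ y ∈ F, t x y * f x ^ 2 +
        ∑ x ∈ F, ∑ y ∈ F, t x y * f y ^ 2 - 2 * ∑ x ∈ F, ∑ y ∈ F, t x y * (f x * f y) := by
      rw [Finset.mul_sum, ← Finset.sum_add_distrib, ← Finset.sum_sub_distrib]
      refine Finset.sum_congr rfl fun x _ => ?_
      rw [Finset.mul_sum, ← Finset.sum_add_distrib, ← Finset.sum_sub_distrib]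
      exact Finset.sum_congr rfl fun y _ => by ring
    rw [h5, h3, h4]
    ring
  have h6 : ∑ x ∈ A, ∑ y ∈ A, t x y * (f x - f y) ^ 2 ≤
      ∑ x ∈ F, ∑ y ∈ F, t x y * (f x - f y) ^ 2 := by
    rw [← Finset.sum_product', ← Finset.sum_product']
    exact Finset.sum_le_sum_of_subset_of_nonneg
      (Finset.product_subset_product Finset.subset_union_right Finset.subset_union_right)
      fun p _ _ => mul_nonneg (htpos _ _) (sq_nonneg _)
  have h7 : ∑ x ∈ A, (1 - w x) * f x ^ 2 * μ x ≤ ∑ x ∈ F, (1 - w x) * f x ^ 2 * μ x :=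
    Finset.sum_le_sum_of_subset_of_nonneg Finset.subset_union_right fun x _ _ =>
      mul_nonneg (mul_nonneg (by linarith [hw1 x]) (sq_nonneg _)) (μ.pos x).le
  have h8 : ∑ x ∈ F, (1 - w x) * f x ^ 2 * μ x ≤
      ∑ x ∈ F, f x ^ 2 * μ x - ∑ x ∈ F, (∑ y ∈ F, t x y) * f x ^ 2 := by
    rw [← Finset.sum_sub_distrib]
    refine Finset.sum_le_sum fun x _ => ?_
    have := mul_le_mul_of_nonneg_right (htsum x) (sq_nonneg (f x))
    linarith
  rw [Set.mem_ofPred_eq, h1]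
  linarith

/-! ### Recovering b and V from the resolvents of a Markovian realization. -/

/-- The resolvents of `q` are resolvents of the formal operator. -/
def IsFormalResolvent (G : WeightedGraph X) (V : X → ℝ) (q : SymForm (Ell2 μ)) : Prop :=
  ∀ α : ℝ, 0 < α → ∀ (f : Ell2 μ) (x : X),
    G.formalOp μ V (fun y => α * (q.resolvent α f : Ell2 μ) y) x =
      α * (f x - α * (q.resolvent α f : Ell2 μ) x)

theorem IsRealization.isFormalResolvent {H : Ell2 μ →ₗ.[ℝ] Ell2 μ} (hH : IsRealization G μ V H)
    {q : SymForm (Ell2 μ)} (hq : q.NonnegClosed) (hqH : q.IsFormOf H) :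
    IsFormalResolvent G V q := fun α hα f x => by
  have h1 := hq.resolvent_mem_graph hqH.dense hα f
  rw [hqH.operator_eq] at h1
  obtain ⟨y, hy, hy'⟩ := (LinearPMap.mem_graph_iff _).1 h1
  have h2 := (hH.formal y).2 x
  dsimp at hy hy'
  rw [hy', hy, Ell2.sub_apply, Ell2.smul_apply] at h2
  rw [WeightedGraph.formalOp_smul, ← h2]

variable {q : SymForm (Ell2 μ)}

theorem tendsto_resolvent_apply (hq : IsDirichletForm q) (f : Ell2 μ) (x : X) :
    Tendsto (fun α : ℝ => α * (q.resolvent α f : Ell2 μ) x) atTop (𝓝 (f x)) :=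
  (tendsto_apply (hq.nonnegClosed.tendsto_resolvent hq.dense f) x).congr fun α => by
    rw [Ell2.smul_apply]

/-- The expression equals the formal operator applied to αGφ. These functions are bounded by the
supremum of |φ| and converge pointwise to φ. -/
theorem tendsto_mul_sub_resolvent (hq : IsDirichletForm q) (hR : IsFormalResolvent G V q)
    {φ : Ell2 μ} (hφ : φ ∈ finSupp μ) (x : X) :
    Tendsto (fun α : ℝ => α * (φ x - α * (q.resolvent α φ : Ell2 μ) x)) atTop
      (𝓝 (G.formalOp μ V φ x)) := by
  obtain ⟨M, hM⟩ := exists_abs_le_of_mem_finSupp hφ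
  refine (tendsto_formalOp (l := atTop) (M := M)
    (u := fun (α : ℝ) y => α * (q.resolvent α φ : Ell2 μ) y) ?_
    (tendsto_resolvent_apply hq φ) x).congr' ?_
  · filter_upwards [eventually_gt_atTop 0] with α hα
    exact hq.abs_resolvent_le hα hM
  · filter_upwards [eventually_gt_atTop 0] with α hα
    exact hR α hα φ x

/-- By the previous lemma, α⟨φ - αGφ, φ⟩ converges to the energy of φ, and it dominates q(αGφ). Weak
compactness in the form domain places φ there, and the bound survives in the limit. -/
theorem exists_form_le_energy (hq : IsDirichletForm q) (hR : IsFormalResolvent G V q)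
    {φ : Ell2 μ} (hφ : φ ∈ finSupp μ) :
    ∃ φ' : q.domain, (φ' : Ell2 μ) = φ ∧ q.form φ' φ' ≤ G.energy μ V φ φ := by
  have hn := hq.nonnegClosed
  have hs : ∀ x, φ x ≠ 0 → x ∈ (mem_finSupp.1 hφ).toFinset := fun x hx => by simpa using hx
  have hlim : Tendsto (fun α : ℝ => α * ⟪φ - α • (q.resolvent α φ : Ell2 μ), φ⟫_ℝ) atTop
      (𝓝 (G.energy μ V φ φ)) := by
    rw [energy_of_support hs (finSupp_le_neumannForm hφ)]
    refine (tendsto_finsetSum _ fun x _ => ((tendsto_mul_sub_resolvent hq hR hφ x).mul_const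
      (φ x)).mul_const (μ x)).congr fun α => ?_
    rw [inner_of_support hs, Finset.mul_sum]
    exact Finset.sum_congr rfl fun x _ => by rw [Ell2.sub_apply, Ell2.smul_apply]; ring
  -- The approximating forms are below the energy only up to ε and eventually. The element found is
  -- the same for every ε, since it is determined by φ.
  have key : ∀ ε > 0, ∃ φ' : q.domain, (φ' : Ell2 μ) = φ ∧
      q.form φ' φ' ≤ G.energy μ V φ φ + ε := fun ε hε => by
    obtain ⟨v, hv, hvM, -⟩ := hn.exists_pointwise_limit (l := (atTop : Filter ℝ))
      (u := fun α => α • q.resolvent α φ) (M := G.energy μ V φ φ + ε + ‖φ‖ ^ 2) (by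
        filter_upwards [eventually_gt_atTop 0, hlim.eventually (gt_mem_nhds
          (lt_add_of_pos_right _ hε))] with α hα h1
        rw [shift_self, hn.form_resolvent_self hα]
        have h2 : ‖((α • q.resolvent α φ : q.domain) : Ell2 μ)‖ ^ 2 ≤ ‖φ‖ ^ 2 := by
          have := norm_scaledResolvent_le hn hα φ
          rw [scaledResolvent_apply] at this
          rw [Submodule.coe_smul]
          gcongr
        have h3 : 0 ≤ α * ‖φ - α • (q.resolvent α φ : Ell2 μ)‖ ^ 2 := by positivity
        linarith) (f := φ) (fun x => (tendsto_resolvent_apply hq φ x).congr fun α => by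
          rw [Submodule.coe_smul, Ell2.smul_apply])
    have hvφ : (v : Ell2 μ) = φ := Ell2.ext hv
    refine ⟨v, hvφ, ?_⟩
    rw [shift_self, hvφ] at hvM
    linarith
  obtain ⟨φ', h1, -⟩ := key 1 one_pos
  refine ⟨φ', h1, le_of_forall_pos_le_add fun ε hε => ?_⟩
  obtain ⟨v, h2, h3⟩ := key ε hε
  rwa [show φ' = v from Subtype.ext (h1.trans h2.symm)]

/-- The forms α⟨f - αGf, f⟩ lie below q(f) and dominate their own jump and killing parts over `A`.
Letting α → ∞, the weights become b and V. Finitely supported functions need not be dense in D(q)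
for this. -/
theorem partialEnergy_le_form (hq : IsDirichletForm q) (hR : IsFormalResolvent G V q)
    (f : q.domain) (A : Finset X) : G.partialEnergy μ V A (f : Ell2 μ) ≤ q.form f f := by
  classical
  have hn := hq.nonnegClosed
  let p : ℝ → Finset X → X → ℝ := fun α s x => α * (q.resolvent α (indicator μ s) : Ell2 μ) x
  -- `w` plays the role of αG1. The constant 1 need not be in ℓ², so it is replaced by the supremum
  -- over indicators of finite sets.
  let w : ℝ → X → ℝ := fun α x => ⨆ s, p α s x
  have hind : ∀ s x, |indicator μ s x| ≤ 1 := fun s x => by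
    rw [indicator_apply]; split_ifs <;> simp
  have hp1 : ∀ α, 0 < α → ∀ s x, |p α s x| ≤ 1 := fun α hα s x =>
    hq.abs_resolvent_le hα (hind s) x
  have hbdd : ∀ α, 0 < α → ∀ x, BddAbove (Set.range fun s => p α s x) := fun α hα x =>
    ⟨1, by rintro _ ⟨s, rfl⟩; exact (abs_le.1 (hp1 α hα s x)).2⟩
  have hpw : ∀ α, 0 < α → ∀ s x, p α s x ≤ w α x := fun α hα s x => le_ciSup (hbdd α hα x) s
  have hw1 : ∀ α, 0 < α → ∀ x, w α x ≤ 1 := fun α hα x =>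
    ciSup_le fun s => (abs_le.1 (hp1 α hα s x)).2
  have hw0 : ∀ α, 0 < α → ∀ x, 0 ≤ w α x := fun α hα x =>
    (mul_nonneg hα.le (hq.resolvent_nonneg hα (fun y => by
      rw [indicator_apply]; split_ifs <;> simp) x)).trans (hpw α hα ∅ x)
  have hpmono : ∀ α, 0 < α → ∀ x, Monotone fun s => p α s x := fun α hα x s s' hss =>
    mul_le_mul_of_nonneg_left (hq.resolvent_mono hα (fun y => by
      rw [indicator_apply, indicator_apply]
      by_cases hy : y ∈ s
      · rw [if_pos hy, if_pos (hss hy)]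
      · rw [if_neg hy]; split_ifs <;> simp) x) hα.le
  have hwform : ∀ α, 0 < α → ∀ x, G.formalOp μ V (w α) x = α * (1 - w α x) := fun α hα x => by
    have h1 : ∀ y, Tendsto (fun s => p α s y) atTop (𝓝 (w α y)) := fun y =>
      tendsto_atTop_ciSup (hpmono α hα y) (hbdd α hα y)
    have h2 := tendsto_formalOp (G := G) (μ := μ) (V := V) (u := p α) (M := 1)
      (Eventually.of_forall fun s y => hp1 α hα s y) h1 x
    refine tendsto_nhds_unique h2 ((((tendsto_const_nhds (x := (1 : ℝ))).sub (h1 x)).const_mul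
      α).congr' ?_)
    filter_upwards [eventually_ge_atTop {x}] with s hs
    have hx : indicator μ s x = 1 := by
      rw [indicator_apply, if_pos (Finset.singleton_subset_iff.1 hs)]
    rw [hR α hα, hx]
  have hwlim : ∀ x, Tendsto (fun α => w α x) atTop (𝓝 1) := fun x => by
    have h1 := tendsto_resolvent_apply hq (delta μ x) x
    rw [delta_self] at h1
    refine tendsto_of_tendsto_of_tendsto_of_le_of_le' h1 tendsto_const_nhds ?_ ?_
    · filter_upwards [eventually_gt_atTop 0] with α hα
      exact hpw α hα {x} x
    · filter_upwards [eventually_gt_atTop 0] with α hα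
      exact hw1 α hα x
  -- As α → ∞ the functions `w α` are bounded and tend to 1, so the formal operator applied to them
  -- tends to its value on the constant 1, which is V.
  have hkill : ∀ x, Tendsto (fun α => α * (1 - w α x)) atTop (𝓝 (V x)) := fun x => by
    have h1 := tendsto_formalOp (G := G) (μ := μ) (V := V) (u := w) (M := 1) (l := atTop) (by
      filter_upwards [eventually_gt_atTop 0] with α hα y
      rw [abs_of_nonneg (hw0 α hα y)]
      exact hw1 α hα y) hwlim x
    rw [WeightedGraph.formalOp_one] at h1
    refine h1.congr' ?_
    filter_upwards [eventually_gt_atTop 0] with α hα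
    exact hwform α hα x
  -- Off the diagonal, α²Gδ_x(y) converges to minus the formal operator of δ_x at y, that is, to
  -- b(x,y)/μ(y).
  have hjump : ∀ x y, x ≠ y → Tendsto (fun α => α * (α * (q.resolvent α (delta μ x) : Ell2 μ) y *
      μ y)) atTop (𝓝 (G.b x y)) := fun x y hxy => by
    have h1 := ((tendsto_mul_sub_resolvent hq hR (delta_mem_finSupp x) y).mul_const (μ y)).neg
    rw [formalOp_delta hxy.symm, delta_of_ne hxy.symm] at h1
    have h2 := (μ.pos y).ne'
    rw [show -(-((μ y)⁻¹ * G.b x y) * μ y) = G.b x y by field_simp] at h1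
    exact h1.congr fun α => by ring
  refine le_of_tendsto (f := fun α : ℝ => α * (1 / 2 * ∑ x ∈ A, ∑ y ∈ A,
    α * (q.resolvent α (delta μ x) : Ell2 μ) y * μ y * ((f : Ell2 μ) x - (f : Ell2 μ) y) ^ 2 +
      ∑ x ∈ A, (1 - w α x) * (f : Ell2 μ) x ^ 2 * μ x)) (x := atTop) ?_ ?_
  · have h1 := Tendsto.add (Tendsto.const_mul (1 / 2 : ℝ) (tendsto_finsetSum A fun x _ =>
      tendsto_finsetSum A fun y _ => show Tendsto (fun α : ℝ =>
        α * (α * (q.resolvent α (delta μ x) : Ell2 μ) y * μ y) *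
          ((f : Ell2 μ) x - (f : Ell2 μ) y) ^ 2) atTop
          (𝓝 (G.b x y * ((f : Ell2 μ) x - (f : Ell2 μ) y) ^ 2)) by
        rcases eq_or_ne x y with rfl | hxy
        · simp
        · exact (hjump x y hxy).mul_const _)) (tendsto_finsetSum A fun x _ =>
            ((hkill x).mul_const ((f : Ell2 μ) x ^ 2)).mul_const (μ x))
    refine h1.congr fun α => ?_
    rw [mul_add, mul_left_comm α, Finset.mul_sum A _ α, Finset.mul_sum A _ α]
    refine congrArg₂ _ (congrArg _ (Finset.sum_congr rfl fun x _ => ?_))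
      (Finset.sum_congr rfl fun x _ => by ring)
    rw [Finset.mul_sum]
    exact Finset.sum_congr rfl fun y _ => by ring
  · filter_upwards [eventually_gt_atTop 0] with α hα
    have hT := kernel_le_inner (T := scaledResolvent hn hα) (w := w α) (fun f g => by
      rw [scaledResolvent_apply, scaledResolvent_apply, real_inner_smul_left,
        real_inner_smul_right, hn.resolvent_symm hα]) (fun x y => by
      rw [scaledResolvent_apply, Ell2.smul_apply]
      refine mul_nonneg hα.le (hq.resolvent_nonneg hα (fun z => ?_) y)
      rw [delta, indicator_apply]; split_ifs <;> simp) (fun s x => by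
      rw [scaledResolvent_apply, Ell2.smul_apply]
      exact hpw α hα s x) (hw1 α hα) A (f : Ell2 μ)
    simp only [scaledResolvent_apply, Ell2.smul_apply] at hT
    have h1 := hn.inner_resolvent_le hα f
    have h2 : 0 ≤ α * ‖(f : Ell2 μ) - α • (q.resolvent α f : Ell2 μ)‖ ^ 2 := by positivity
    have h3 := mul_le_mul_of_nonneg_left hT hα.le
    linarith

/-- If the finitely supported functions are dense in the domain of the Neumann form, then the form
of every Markovian realization is the Neumann form. -/
theorem operator_eq_neumannOp (hV : ∀ x, 0 ≤ V x) (hq : IsDirichletForm q)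
    (hR : IsFormalResolvent G V q)
    (hd : (neumannForm G μ V).domain ≤
      (neumannForm_nonnegClosed (G := G) hV).formClosure (finSupp μ)) :
    q.operator = neumannOp G μ V := by
  set N := neumannForm G μ V with hNdef
  have hn := hq.nonnegClosed
  have hN : N.NonnegClosed := neumannForm_nonnegClosed hV
  have hle : ∀ f : q.domain, ∃ f' : N.domain, (f' : Ell2 μ) = f ∧ N.form f' f' ≤ q.form f f :=
    fun f => by
      have := finiteEnergy_of_partialEnergy_le hV (partialEnergy_le_form hq hR f)
      exact ⟨⟨f, this.1⟩, rfl, this.2⟩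
  have hqN : q.domain ≤ N.domain := fun f hf => by
    obtain ⟨f', h, -⟩ := hle ⟨f, hf⟩
    have h' : (f' : Ell2 μ) = f := h
    exact h' ▸ f'.2
  have hfin : finSupp μ ≤ q.domain := fun φ hφ => by
    obtain ⟨φ', h, -⟩ := exists_form_le_energy hq hR hφ
    rw [← h]; exact φ'.2
  let i : q.domain →ₗ[ℝ] N.domain := Submodule.inclusion hqN
  have hself : ∀ φ : q.domain, (φ : Ell2 μ) ∈ finSupp μ → q.form φ φ = N.form (i φ) (i φ) := by
    intro φ hφ
    obtain ⟨f', h1, h2⟩ := hle φ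
    obtain ⟨φ', h3, h4⟩ := exists_form_le_energy hq hR hφ
    rw [show f' = i φ from Subtype.ext h1] at h2
    rw [show φ' = φ from Subtype.ext h3] at h4
    exact le_antisymm h4 h2
  have hpol : ∀ φ ψ : q.domain, (φ : Ell2 μ) ∈ finSupp μ → (ψ : Ell2 μ) ∈ finSupp μ →
      q.form φ ψ = N.form (i φ) (i ψ) := by
    intro φ ψ hφ hψ
    have h1 := hself (φ + ψ) (Submodule.add_mem _ hφ hψ)
    rw [map_add i, form_add_self, form_add_self, hself φ hφ, hself ψ hψ] at h1
    linarith
  -- Approximants of f in the norm of N are bounded in the norm of q too, as the forms agree on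
  -- finitely supported functions. Their weak limit in D(q) is again f, so one sequence converges
  -- weakly to f in both form spaces.
  have happrox : ∀ f : N.domain, ∃ (f' : q.domain) (φ : ℕ → q.domain), i f' = f ∧
      (∀ n, (φ n : Ell2 μ) ∈ finSupp μ) ∧
      (∀ w : q.domain, Tendsto (fun n => (q.shift 1).form (φ n) w) atTop
        (𝓝 ((q.shift 1).form f' w))) ∧
      ∀ w : N.domain, Tendsto (fun n => (N.shift 1).form (i (φ n) : N.domain) w) atTop
        (𝓝 ((N.shift 1).form f w)) := by
    intro f
    choose φ hφ hφf using fun n : ℕ =>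
      (hN.mem_formClosure (f := f)).1 (hd f.2) (1 / ((n : ℝ) + 1)) (by positivity)
    let φ' : ℕ → q.domain := fun n => ⟨φ n, hfin (hφ n)⟩
    have hiφ : ∀ n, i (φ' n) = φ n := fun n => Subtype.ext rfl
    have hlim : Tendsto (fun n => (φ n : Ell2 μ)) atTop (𝓝 (f : Ell2 μ)) := by
      rw [tendsto_iff_norm_sub_tendsto_zero]
      have h2 : Tendsto (fun n => ‖(φ n : Ell2 μ) - f‖ ^ 2) atTop (𝓝 0) := by
        refine squeeze_zero (fun n => by positivity) (fun n => ?_)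
          tendsto_one_div_add_atTop_nhds_zero_nat
        have h3 := (hφf n).le
        rw [shift_self, Submodule.coe_sub, norm_sub_rev] at h3
        linarith [hN.nonneg (f - φ n)]
      simpa [Real.sqrt_sq] using h2.sqrt
    have hb : ∀ n, (N.shift 1).form (φ n) (φ n) ≤ 2 * (N.shift 1).form f f + 2 := fun n => by
      have h3 := (hN.shift zero_le_one).form_add_le f (-(f - φ n) : N.domain)
      have h4 : (N.shift 1).form (-(f - φ n) : N.domain) (-(f - φ n) : N.domain) =
        (N.shift 1).form (f - φ n : N.domain) (f - φ n : N.domain) := by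
          simp only [map_neg, LinearMap.neg_apply, neg_neg]
      rw [h4, show (f + -(f - φ n) : N.domain) = φ n by abel] at h3
      have h5 : 1 / ((n : ℝ) + 1) ≤ 1 := by
        rw [div_le_one (by positivity)]; linarith [Nat.cast_nonneg (α := ℝ) n]
      linarith [hφf n]
    obtain ⟨v, hv, -, hvw⟩ := hn.exists_pointwise_limit (l := atTop) (u := φ')
      (Eventually.of_forall fun n => by
        refine le_trans (le_of_eq ?_) (hb n)
        rw [shift_self, shift_self, hself _ (hφ n), hiφ]) (tendsto_apply hlim)
    obtain ⟨v', hv', -, hvw'⟩ := hN.exists_pointwise_limit (l := atTop) (u := φ)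
      (Eventually.of_forall hb) (tendsto_apply hlim)
    refine ⟨v, φ', Subtype.ext (Ell2.ext hv), hφ, hvw, fun w => ?_⟩
    rw [← show v' = f from Subtype.ext (Ell2.ext hv')]
    simpa only [hiφ] using hvw' w
  have hNq : N.domain ≤ q.domain := fun f hf => by
    obtain ⟨f', -, h, -⟩ := happrox ⟨f, hf⟩
    rw [← show (f' : Ell2 μ) = f from congrArg Subtype.val h]
    exact f'.2
  have hshift : ∀ φ ψ : q.domain, q.form φ ψ = N.form (i φ) (i ψ) ↔
      (q.shift 1).form φ ψ = (N.shift 1).form (i φ) (i ψ) := fun φ ψ => by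
    rw [shift_apply, shift_apply]
    exact (add_left_inj _).symm
  -- Weak convergence is linear in one slot, so the identity of the forms is extended from finitely
  -- supported functions one argument at a time.
  have h1 : ∀ f ψ : q.domain, (ψ : Ell2 μ) ∈ finSupp μ → q.form f ψ = N.form (i f) (i ψ) := by
    intro f ψ hψ
    obtain ⟨f', φ, hf, hφ, ha, hb⟩ := happrox (i f)
    obtain rfl : f' = f := Subtype.ext (congrArg (fun z : N.domain => (z : Ell2 μ)) hf)
    rw [hshift]
    exact tendsto_nhds_unique (ha ψ) ((hb (i ψ)).congr fun n =>
      ((hshift _ _).1 (hpol _ _ (hφ n) hψ)).symm)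
  have h2 : ∀ f g : q.domain, q.form f g = N.form (i f) (i g) := by
    intro f g
    obtain ⟨f', φ, hf, hφ, ha, hb⟩ := happrox (i f)
    obtain rfl : f' = f := Subtype.ext (congrArg (fun z : N.domain => (z : Ell2 μ)) hf)
    rw [hshift]
    exact tendsto_nhds_unique (ha g) ((hb (i g)).congr fun n => by
      refine ((hshift _ _).1 ?_).symm
      rw [q.symm, h1 g _ (hφ n), N.symm])
  have hgraph : q.operatorGraph = N.operatorGraph := by
    ext p
    constructor
    · rintro ⟨f, hf, h⟩
      refine ⟨i f, hf, fun k => ?_⟩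
      rw [show k = i ⟨k, hNq k.2⟩ from Subtype.ext rfl, ← h2, h]
      rfl
    · rintro ⟨f, hf, h⟩
      refine ⟨⟨f, hNq f.2⟩, hf, fun k => ?_⟩
      rw [h2]
      exact h (i k)
  unfold neumannOp SymForm.operator
  rw [hgraph]

/-- Markov uniqueness is equivalent to the density of the finitely supported functions in the
domain of the Neumann form. -/
theorem existsUnique_isMarkovianRealization_iff (hV : ∀ x, 0 ≤ V x) :
    (∃! H : Ell2 μ →ₗ.[ℝ] Ell2 μ, IsMarkovianRealization G μ V H) ↔
      (neumannForm G μ V).domain ≤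
        (neumannForm_nonnegClosed (G := G) hV).formClosure (finSupp μ) := by
  refine ⟨neumannForm_domain_le_of_existsUnique hV, fun hd => ⟨neumannOp G μ V,
    isMarkovianRealization_operator (isDirichletForm_neumannForm hV) finSupp_le_neumannForm le_rfl
    fun _ _ => rfl, ?_⟩⟩
  rintro H ⟨hH, q, hqH, hq⟩
  rw [← hqH.operator_eq]
  exact operator_eq_neumannOp hV hq (hH.isFormalResolvent hq.nonnegClosed hqH) hd

end markovian

/-! ## Excessive functions and capacities -/

section capacity

open WeightedGraph Ell2 SymForm

variable {X : Type*} [Countable X] [MeasurableSpace X] [DiscreteMeasurableSpace X]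
  {G : WeightedGraph X} {μ : Weight X} {V : X → ℝ}

theorem isResolvent_neumannOp_iff (hV : ∀ x, 0 ≤ V x) {α : ℝ} (hα : 0 < α) {f u : Ell2 μ} :
    IsResolvent (neumannOp G μ V) α f u ↔ u = (neumannForm G μ V).resolvent α f :=
  (neumannForm_nonnegClosed hV).isResolvent_iff (isDirichletForm_neumannForm hV).dense hα

theorem IsOneExcessive.mul_resolvent_le (hV : ∀ x, 0 ≤ V x) {h : Ell2 μ}
    (hh : IsOneExcessive G μ V h) {β : ℝ} (hβ : 0 < β) (x : X) :
    β * ((neumannForm G μ V).resolvent (β + 1) h : Ell2 μ) x ≤ h x := by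
  have h1 : ((((neumannForm G μ V).resolvent (β + 1) h : Ell2 μ) x : ℝ) : EReal) ≤
      neumannResolvent G μ V (β + 1) h x := by
    unfold neumannResolvent
    refine le_iSup_of_le h (le_iSup_of_le _ (le_iSup_of_le (fun y => ⟨hh.1 y, le_rfl⟩)
      (le_iSup_of_le ((isResolvent_neumannOp_iff hV (by positivity)).2 rfl) le_rfl)))
  have h2 := (mul_le_mul_of_nonneg_left h1 (EReal.coe_nonneg.2 hβ.le)).trans (hh.2 β hβ x)
  rwa [← EReal.coe_mul, EReal.coe_le_coe_iff] at h2

/-- By the resolvent identity, h - β(H + β + 1)⁻¹h = (H + β + 1)⁻¹f for h = (H + 1)⁻¹f, with H the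
Neumann operator, and this is nonnegative. Monotonicity of the resolvent covers every f' below h in
the defining supremum. -/
theorem isOneExcessive_resolvent (hV : ∀ x, 0 ≤ V x) {f : Ell2 μ} (hf : ∀ x, 0 ≤ f x) :
    IsOneExcessive G μ V ((neumannForm G μ V).resolvent 1 f : Ell2 μ) := by
  have hD := isDirichletForm_neumannForm (G := G) (μ := μ) hV
  refine ⟨hD.resolvent_nonneg one_pos hf, fun β hβ x => ?_⟩
  set h := (neumannForm G μ V).resolvent 1 f
  have hβ1 : 0 < β + 1 := by positivity
  have h1 : β * ((neumannForm G μ V).resolvent (β + 1) (h : Ell2 μ) : Ell2 μ) x ≤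
      (h : Ell2 μ) x := by
    have h2 := hD.nonnegClosed.resolvent_identity one_pos hβ f
    have h3 := hD.resolvent_nonneg hβ1 hf x
    rw [← h2, Submodule.coe_sub, Submodule.coe_smul, Ell2.sub_apply, Ell2.smul_apply] at h3
    linarith
  have h2 : neumannResolvent G μ V (β + 1) (h : Ell2 μ) x ≤ ((β⁻¹ * (h : Ell2 μ) x : ℝ) : EReal) := by
    unfold neumannResolvent
    refine iSup_le fun k => iSup_le fun u => iSup_le fun hk => iSup_le fun hu => ?_
    rw [(isResolvent_neumannOp_iff hV hβ1).1 hu, EReal.coe_le_coe_iff, inv_mul_eq_div,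
      le_div_iff₀ hβ, mul_comm]
    exact (mul_le_mul_of_nonneg_left (hD.resolvent_mono hβ1 (fun y => (hk y).2) x) hβ.le).trans h1
  refine (mul_le_mul_of_nonneg_left h2 (EReal.coe_nonneg.2 hβ.le)).trans ?_
  rw [← EReal.coe_mul, EReal.coe_le_coe_iff, mul_inv_cancel_left₀ hβ.ne']

theorem Ell2.exists_pos (μ : Weight X) : ∃ f : Ell2 μ, ∀ x, 0 < f x := by
  have := Encodable.ofCountable X
  obtain ⟨ε, hε, c, hc, -⟩ := posSumOfEncodable one_pos X
  refine ⟨Ell2.mk (fun x => Real.sqrt (ε x / μ x)) (hc.summable.congr fun x => ?_), fun x => ?_⟩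
  · have := (μ.pos x)
    rw [Real.sq_sqrt (div_nonneg (hε x).le this.le)]
    field_simp
  · rw [Ell2.mk_apply]
    exact Real.sqrt_pos.2 (div_pos (hε x) (μ.pos x))

/-- There are strictly positive `1`-excessive functions in the domain of the Neumann form. -/
theorem exists_pos_isOneExcessive (hV : ∀ x, 0 ≤ V x) :
    ∃ h : (neumannForm G μ V).domain, IsOneExcessive G μ V (h : Ell2 μ) ∧
      ∀ x, 0 < (h : Ell2 μ) x := by
  obtain ⟨f, hf⟩ := Ell2.exists_pos μ
  have hD := isDirichletForm_neumannForm (G := G) (μ := μ) hV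
  have h0 := hD.resolvent_nonneg one_pos (f := f) fun x => (hf x).le
  refine ⟨(neumannForm G μ V).resolvent 1 f, isOneExcessive_resolvent hV fun x => (hf x).le,
    fun x => (h0 x).lt_of_ne fun hx => ?_⟩
  have hR : IsFormalResolvent G V (neumannForm G μ V) :=
    (isMarkovianRealization_operator (G := G) (V := V) hD finSupp_le_neumannForm le_rfl
      fun _ _ => rfl).1.isFormalResolvent hD.nonnegClosed
      ⟨hD.dense, ⟨0, fun f => by simpa using hD.nonneg f⟩, hD.closed, rfl⟩
  -- A zero of h would be a minimum, so the formal operator would be nonpositive there, whereas the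
  -- resolvent equation gives it the value f(x) > 0.
  have h1 := hR 1 one_pos f x
  simp only [one_mul, ← hx, sub_zero] at h1
  have h2 : G.formalOp μ V (fun y => ((neumannForm G μ V).resolvent 1 f : Ell2 μ) y) x ≤ 0 := by
    unfold formalOp
    dsimp only
    rw [← hx, mul_zero, add_zero]
    refine mul_nonpos_of_nonneg_of_nonpos (inv_nonneg.2 (μ.pos x).le) (tsum_nonpos fun y => ?_)
    rw [zero_sub]
    exact mul_nonpos_of_nonneg_of_nonpos (G.nonneg _ _) (neg_nonpos.2 (h0 y))
  linarith [hf x]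

/-- `1`-excessive functions have nonnegative mixed energy with nonnegative functions. -/
theorem IsOneExcessive.shift_nonneg (hV : ∀ x, 0 ≤ V x) {h : (neumannForm G μ V).domain}
    (hh : IsOneExcessive G μ V (h : Ell2 μ)) {v : (neumannForm G μ V).domain}
    (hv : ∀ x, 0 ≤ (v : Ell2 μ) x) : 0 ≤ ((neumannForm G μ V).shift 1).form h v := by
  have hN : (neumannForm G μ V).NonnegClosed := neumannForm_nonnegClosed hV
  have hD : IsDirichletForm (neumannForm G μ V) := isDirichletForm_neumannForm hV
  -- The resolvent at β of the shifted form is the resolvent at β + 1 of the original one. The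
  -- shifted form of h and v is thus the limit of β⟨h - β(H^(N) + β + 1)⁻¹h, v⟩, whose terms are
  -- nonnegative by excessivity.
  have hsres : ∀ β : ℝ, 0 < β → ((neumannForm G μ V).shift 1).resolvent β (h : Ell2 μ) =
      (neumannForm G μ V).resolvent (β + 1) (h : Ell2 μ) := fun β hβ =>
    ((hN.shift zero_le_one).eq_resolvent hβ fun k => by
      have := hN.resolvent_spec (α := β + 1) (by positivity) (h : Ell2 μ) k
      rw [shift_apply]
      linarith).symm
  obtain ⟨w, hw, -, hlim⟩ := hN.exists_pointwise_limit (l := (atTop : Filter ℝ))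
    (u := fun β => β • ((neumannForm G μ V).shift 1).resolvent β (h : Ell2 μ)) (M := (((neumannForm G μ V).shift 1).shift 1).form h h)
    (by
      filter_upwards [eventually_gt_atTop 0] with β hβ
      have h1 := (hN.shift zero_le_one).shift_resolvent_le hβ h
      rw [shift_self] at h1
      nlinarith [sq_nonneg ‖((β • ((neumannForm G μ V).shift 1).resolvent β (h : Ell2 μ) : (neumannForm G μ V).domain) : Ell2 μ)‖])
    (f := (h : Ell2 μ)) (fun x => (tendsto_apply
      ((hN.shift zero_le_one).tendsto_resolvent hD.dense (h : Ell2 μ)) x).congr fun β => by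
        rw [Submodule.coe_smul])
  obtain rfl : w = h := Subtype.ext (Ell2.ext hw)
  refine ge_of_tendsto (hlim v) ?_
  filter_upwards [eventually_gt_atTop 0] with β hβ
  refine le_of_le_of_eq ?_ ((hN.shift zero_le_one).form_resolvent hβ (w : Ell2 μ) v).symm
  refine mul_nonneg hβ.le ((Ell2.hasSum_inner _ _).nonneg fun x => ?_)
  refine mul_nonneg (mul_nonneg ?_ (hv x)) (μ.pos x).le
  rw [Ell2.sub_apply, Ell2.smul_apply, hsres β hβ]
  linarith [hh.mul_resolvent_le hV hβ x]

/-- Taking the minimum with a superharmonic function does not increase the energy. -/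
theorem exists_min_shift_le {q : SymForm (Ell2 μ)} (hq : IsDirichletForm q) (f : q.domain)
    {h : q.domain} (hh : ∀ v : q.domain, (∀ x, 0 ≤ (v : Ell2 μ) x) → 0 ≤ (q.shift 1).form h v) :
    ∃ g : q.domain, (∀ x, (g : Ell2 μ) x = min ((f : Ell2 μ) x) ((h : Ell2 μ) x)) ∧
      (q.shift 1).form g g ≤ (q.shift 1).form f f := by
  obtain ⟨p, hp, -⟩ := hq.exists_posPart (f - h)
  obtain ⟨n, hn, -⟩ := hq.exists_posPart (-(f - h))
  simp only [Submodule.coe_sub, Submodule.coe_neg, Ell2.sub_apply, Ell2.neg_apply] at hp hn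
  refine ⟨f - p, fun x => ?_, ?_⟩
  · rw [Submodule.coe_sub, Ell2.sub_apply, hp]
    rcases le_total ((f : Ell2 μ) x) ((h : Ell2 μ) x) with h1 | h1
    · rw [max_eq_right (by linarith), min_eq_left h1, sub_zero]
    · rw [max_eq_left (by linarith), min_eq_right h1]; ring
  · have hneg := hq.shift_pos_neg_nonpos hp hn
    have hpos := hh p fun x => by rw [hp]; exact le_max_right _ _
    -- Here f - p and h - n are two expressions for f ∧ h. In f = (f ∧ h) + p the mixed term is the
    -- form at (h, p) minus the form at (p, n), and both contributions are nonnegative.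
    have h1 : f - p = h - n := Subtype.ext (Ell2.ext fun x => by
      rw [Submodule.coe_sub, Submodule.coe_sub, Ell2.sub_apply, Ell2.sub_apply, hp, hn]
      rcases le_total ((f : Ell2 μ) x) ((h : Ell2 μ) x) with h1 | h1
      · rw [max_eq_right (by linarith), max_eq_left (by linarith)]; ring
      · rw [max_eq_left (by linarith), max_eq_right (by linarith)]; ring)
    have h2 := (q.shift 1).form_add_self (f - p : q.domain) p
    rw [show (f - p + p : q.domain) = f by abel] at h2
    have h3 : (q.shift 1).form (f - p : q.domain) p = (q.shift 1).form h p - (q.shift 1).form p n := by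
      rw [h1, (q.shift 1).symm p n]
      exact congrArg (fun F : q.domain →ₗ[ℝ] ℝ => F p) (map_sub (q.shift 1).form h n)
    have h4 := (hq.nonnegClosed.shift zero_le_one).nonneg p
    linarith

theorem cap_eq_iInf_shift (h : X → ℝ) (U : Set X) :
    cap G μ V h U =
    ⨅ (f : (neumannForm G μ V).domain) (_ : ∀ x, U.indicator h x ≤ (f : Ell2 μ) x),
      ENNReal.ofReal (((neumannForm G μ V).shift 1).form f f) := by
  refine iInf_congr fun f => iInf_congr fun _ => ?_
  have := shift_self (q := neumannForm G μ V) 1 f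
  rw [this, one_mul]

theorem cap_mono (h : X → ℝ) (h0 : ∀ x, 0 ≤ h x) {U W : Set X} (hUW : U ⊆ W) :
    cap G μ V h U ≤ cap G μ V h W :=
  le_iInf₂ fun f hf => iInf₂_le_of_le f
    (fun x => (Set.indicator_le_indicator_apply_of_subset hUW (h0 x)).trans (hf x)) le_rfl

/-- If the finitely supported functions are dense in the domain of the Neumann form, then the
boundary has vanishing capacity. -/
theorem capBoundary_eq_zero (hV : ∀ x, 0 ≤ V x)
    (hd : (neumannForm G μ V).domain ≤
      (neumannForm_nonnegClosed (G := G) hV).formClosure (finSupp μ))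
    (h : (neumannForm G μ V).domain) :
    capBoundary G μ V (h : Ell2 μ) = 0 := by
  have hD := isDirichletForm_neumannForm (G := G) (μ := μ) hV
  refine le_antisymm (ENNReal.le_of_forall_pos_le_add fun ε hε _ => ?_) zero_le
  obtain ⟨φ, hφ, hφε⟩ := (hD.nonnegClosed.mem_formClosure (f := h)).1 (hd h.2) ε
    (NNReal.coe_pos.2 hε)
  obtain ⟨g, hg, hgle⟩ := hD.shift_contraction (fun s => |s|) (by simp)
    (fun s t => abs_abs_sub_abs_le_abs_sub s t) (h - φ)
  rw [zero_add]
  refine (iInf_le _ (mem_finSupp.1 hφ).toFinset).trans ?_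
  rw [cap_eq_iInf_shift]
  refine iInf₂_le_of_le g (fun x => ?_) ?_
  · by_cases hx : (φ : Ell2 μ) x = 0
    · rw [Set.indicator_of_mem (by simpa using hx), hg, Submodule.coe_sub, Ell2.sub_apply, hx,
        sub_zero]
      exact le_abs_self _
    · rw [Set.indicator_of_notMem (by simpa using hx), hg]
      exact abs_nonneg _
  · refine (ENNReal.ofReal_le_ofReal (hgle.trans hφε.le)).trans ?_
    rw [ENNReal.ofReal_coe_nnreal]

/-- If there are sets of arbitrarily small capacity such that the functions that vanish on them can
be approximated by finitely supported functions, then all functions can be approximated. -/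
theorem neumannForm_domain_le_of_cap (hV : ∀ x, 0 ≤ V x) {h : (neumannForm G μ V).domain}
    (hh : IsOneExcessive G μ V (h : Ell2 μ)) (hpos : ∀ x, 0 < (h : Ell2 μ) x)
    (hU : ∀ ε : ℝ≥0∞, 0 < ε → ∃ U : Set X, cap G μ V (h : Ell2 μ) U < ε ∧
      ∀ g : (neumannForm G μ V).domain, (∀ x ∈ U, (g : Ell2 μ) x = 0) →
        (g : Ell2 μ) ∈ (neumannForm_nonnegClosed (G := G) hV).formClosure (finSupp μ)) :
    (neumannForm G μ V).domain ≤
      (neumannForm_nonnegClosed (G := G) hV).formClosure (finSupp μ) := by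
  have hN : (neumannForm G μ V).NonnegClosed := neumannForm_nonnegClosed hV
  have hD : IsDirichletForm (neumannForm G μ V) := isDirichletForm_neumannForm hV
  have hseq : ∀ n : ℕ, ∃ (U : Set X) (f : (neumannForm G μ V).domain), (∀ x ∈ U, (h : Ell2 μ) x ≤ (f : Ell2 μ) x) ∧
      ((neumannForm G μ V).shift 1).form f f < 1 / ((n : ℝ) + 1) ∧ ∀ g : (neumannForm G μ V).domain, (∀ x ∈ U, (g : Ell2 μ) x = 0) →
        (g : Ell2 μ) ∈ hN.formClosure (finSupp μ) := fun n => by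
    obtain ⟨U, h1, h2⟩ := hU (ENNReal.ofReal (1 / ((n : ℝ) + 1)))
      (ENNReal.ofReal_pos.2 (by positivity))
    rw [cap_eq_iInf_shift] at h1
    simp only [iInf_lt_iff] at h1
    obtain ⟨f, hf, hfn⟩ := h1
    refine ⟨U, f, fun x hx => ?_, (ENNReal.ofReal_lt_ofReal_iff (by positivity)).1 hfn, h2⟩
    have := hf x
    rwa [Set.indicator_of_mem hx] at this
  choose U k hk hkn hUg using hseq
  have hk1 : ∀ n, ((neumannForm G μ V).shift 1).form (k n) (k n) ≤ 1 := fun n => (hkn n).le.trans (by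
    rw [div_le_one (by positivity)]; linarith [Nat.cast_nonneg (α := ℝ) n])
  have hk0 : Tendsto (fun n => (k n : Ell2 μ)) atTop (𝓝 0) := by
    rw [tendsto_zero_iff_norm_tendsto_zero]
    have h2 : Tendsto (fun n => ‖(k n : Ell2 μ)‖ ^ 2) atTop (𝓝 0) := by
      refine squeeze_zero (fun n => by positivity) (fun n => ?_)
        tendsto_one_div_add_atTop_nhds_zero_nat
      have h3 := (hkn n).le
      rw [shift_self] at h3
      linarith [hN.nonneg (k n)]
    simpa [Real.sqrt_sq] using h2.sqrt
  -- On U_n the bound c k_n ≥ ch ≥ f makes (f - c k_n)₊ vanish. Since k_n → 0 in ℓ², these functions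
  -- converge pointwise to f.
  have step1 : ∀ c : ℝ, 0 ≤ c → ∀ f : (neumannForm G μ V).domain, (∀ x, 0 ≤ (f : Ell2 μ) x) →
      (∀ x, (f : Ell2 μ) x ≤ c * (h : Ell2 μ) x) → (f : Ell2 μ) ∈ hN.formClosure (finSupp μ) := by
    intro c hc f hf0 hf
    choose u hu hule using fun n => hD.exists_posPart (f - c • k n)
    simp only [Submodule.coe_sub, Submodule.coe_smul, Ell2.sub_apply, Ell2.smul_apply] at hu
    refine hN.mem_formClosure_of_tendsto (l := atTop) (u := u)
      (M := 2 * ((neumannForm G μ V).shift 1).form f f + 2 * c ^ 2) (Eventually.of_forall fun n => hUg n (u n) ?_)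
      (Eventually.of_forall fun n => (hule n).trans ?_) fun x => ?_
    · intro x hx
      rw [hu, max_eq_right]
      have := mul_le_mul_of_nonneg_left (hk n x hx) hc
      linarith [hf x]
    · have h1 := (hN.shift zero_le_one).form_add_le f (-(c • k n) : (neumannForm G μ V).domain)
      have h2 : ((neumannForm G μ V).shift 1).form (-(c • k n) : (neumannForm G μ V).domain) (-(c • k n) : (neumannForm G μ V).domain) =
          c ^ 2 * ((neumannForm G μ V).shift 1).form (k n) (k n) := by
        rw [← ((neumannForm G μ V).shift 1).form_smul_self c (k n)]
        simp only [map_neg, LinearMap.neg_apply, neg_neg]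
      rw [h2, ← sub_eq_add_neg] at h1
      have h3 := mul_le_mul_of_nonneg_left (hk1 n) (sq_nonneg c)
      refine h1.trans ?_
      linarith
    · simp only [hu]
      have h1 := tendsto_apply hk0 x
      rw [Ell2.zero_apply] at h1
      have h2 := ((tendsto_const_nhds (x := (f : Ell2 μ) x)).sub (h1.const_mul c)).max
        (tendsto_const_nhds (x := (0 : ℝ)))
      rwa [mul_zero, sub_zero, max_eq_left (hf0 x)] at h2
  have step2 : ∀ f : (neumannForm G μ V).domain, (∀ x, 0 ≤ (f : Ell2 μ) x) →
      (f : Ell2 μ) ∈ hN.formClosure (finSupp μ) := by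
    intro f hf0
    -- Multiples of h inherit the sign property of h, so f ∧ nh has form norm at most that of f.
    -- Strict positivity of h makes the sequence eventually equal to f at each vertex.
    choose u hu hule using fun n : ℕ => exists_min_shift_le hD f (h := (n : ℝ) • h)
      fun v hv => by
        have h1 := mul_nonneg (Nat.cast_nonneg (α := ℝ) n) (hh.shift_nonneg hV hv)
        refine h1.trans_eq ?_
        exact (congrArg (fun F : (neumannForm G μ V).domain →ₗ[ℝ] ℝ => F v)
          (map_smul ((neumannForm G μ V).shift 1).form (n : ℝ) h)).symm
    simp only [Submodule.coe_smul, Ell2.smul_apply] at hu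
    refine hN.mem_formClosure_of_tendsto (l := atTop) (u := u)
      (M := ((neumannForm G μ V).shift 1).form f f) (Eventually.of_forall fun n => step1 n n.cast_nonneg _ ?_ ?_)
      (Eventually.of_forall hule) fun x => ?_
    · exact fun x => by
        rw [hu]; exact le_min (hf0 x) (mul_nonneg n.cast_nonneg (hpos x).le)
    · exact fun x => by rw [hu]; exact min_le_right _ _
    · refine tendsto_const_nhds.congr' ?_
      obtain ⟨m, hm⟩ := exists_nat_ge ((f : Ell2 μ) x / (h : Ell2 μ) x)
      filter_upwards [eventually_ge_atTop m] with n hn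
      rw [hu, min_eq_left]
      rw [← div_le_iff₀ (hpos x)]
      exact hm.trans (Nat.cast_le.2 hn)
  intro f hf
  obtain ⟨p, hp, -⟩ := hD.exists_posPart ⟨f, hf⟩
  obtain ⟨n, hn, -⟩ := hD.exists_posPart (-⟨f, hf⟩)
  have h1 : f = p - n := Ell2.ext fun x => by
    rw [Ell2.sub_apply, hp, hn, Submodule.coe_neg, Ell2.neg_apply]
    rcases le_total (f x) 0 with h1 | h1
    · rw [max_eq_right h1, max_eq_left (by linarith)]; ring
    · rw [max_eq_left h1, max_eq_right (by linarith)]; ring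
  rw [h1]
  exact Submodule.sub_mem _ (step2 p fun x => by rw [hp]; exact le_max_right _ _)
    (step2 n fun x => by rw [hn]; exact le_max_right _ _)

theorem neumannForm_domain_le_of_capBoundary (hV : ∀ x, 0 ≤ V x)
    {h : (neumannForm G μ V).domain} (hh : IsOneExcessive G μ V (h : Ell2 μ))
    (hpos : ∀ x, 0 < (h : Ell2 μ) x) (hc : capBoundary G μ V (h : Ell2 μ) = 0) :
    (neumannForm G μ V).domain ≤
      (neumannForm_nonnegClosed (G := G) hV).formClosure (finSupp μ) :=
  neumannForm_domain_le_of_cap hV hh hpos fun ε hε => by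
    rw [← hc] at hε
    obtain ⟨K, hK⟩ := iInf_lt_iff.1 hε
    refine ⟨_, hK, fun g hg => (neumannForm_nonnegClosed hV).le_formClosure
      finSupp_le_neumannForm (K.finite_toSet.subset fun x hx => ?_)⟩
    by_contra h1
    exact hx (hg x h1)

end capacity

/-! ## Paths in a set and cutoff functions -/

namespace EdgeLength

variable {X : Type*} {G : WeightedGraph X} (s : EdgeLength G)

/-- There is a path of length `r` from `x` to `z` that stays inside `A`. -/
inductive Reach (A : Set X) : X → ℝ → X → Prop
  | refl (x : X) : x ∈ A → Reach A x 0 x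
  | head (x y z : X) (r : ℝ) : x ∈ A → 0 < G.b x y → Reach A y r z → Reach A x (s.σ x y + r) z

variable {s} {A : Set X}

theorem Reach.nonneg {x z : X} {r : ℝ} (h : s.Reach A x r z) : 0 ≤ r := by
  induction h with
  | refl => exact le_rfl
  | head x y z r _ _ _ ih => exact add_nonneg (s.nonneg _ _) ih

theorem Reach.mem_left {x z : X} {r : ℝ} (h : s.Reach A x r z) : x ∈ A := by
  cases h <;> assumption

theorem Reach.tail {x z w : X} {r : ℝ} (h : s.Reach A x r z) (hb : 0 < G.b z w) (hw : w ∈ A) :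
    s.Reach A x (r + s.σ z w) w := by
  induction h with
  | refl x hx =>
    rw [zero_add, ← add_zero (s.σ x w)]
    exact .head x w w 0 hx hb (.refl w hw)
  | head x y z r hx hxy _ ih =>
    rw [add_assoc]
    exact .head x y w _ hx hxy (ih hb)

/-- The vertices that can be reached from `x` by a path in `A` of length less than `R`. -/
def reachBall (s : EdgeLength G) (A : Set X) (x : X) (R : ℝ) : Set X :=
  {z | ∃ r < R, s.Reach A x r z}

/-- One step of König's argument: the ball is contained in the union of {x} and finitely many balls
around neighbors, with radius reduced by the length of the edge. -/
theorem exists_infinite_reachBall (hG : G.LocallyFinite) {x : X} {R : ℝ}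
    (h : (s.reachBall A x R).Infinite) :
    x ∈ A ∧ 0 < R ∧ ∃ y, 0 < G.b x y ∧ (s.reachBall A y (R - s.σ x y)).Infinite := by
  obtain ⟨z, r, hr, hz⟩ := h.nonempty
  refine ⟨hz.mem_left, hz.nonneg.trans_lt hr, ?_⟩
  by_contra! hc
  refine h ((((hG x).biUnion fun y hy => hc y hy).union
    (Set.finite_singleton x)).subset ?_)
  rintro w ⟨t, ht, hw⟩
  cases hw with
  | refl => exact Or.inr rfl
  | head _ y _ r hx hxy hyw =>
    exact Or.inl (Set.mem_biUnion (show y ∈ {y | 0 < G.b x y} from hxy) ⟨r, by linarith, hyw⟩)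

/-- A version of König's lemma: if balls are infinite, then there is an infinite path of finite
length. -/
theorem exists_path_of_infinite_reachBall (hG : G.LocallyFinite) {x : X} {R : ℝ}
    (h : (s.reachBall A x R).Infinite) : ∃ k : ℕ → X, (∀ n, k n ∈ A) ∧
      (∀ n, 0 < G.b (k n) (k (n + 1))) ∧ Summable fun n => s.σ (k n) (k (n + 1)) := by
  have step : ∀ p : {p : X × ℝ // (s.reachBall A p.1 p.2).Infinite},
      ∃ p' : {p : X × ℝ // (s.reachBall A p.1 p.2).Infinite},
        0 < G.b p.1.1 p'.1.1 ∧ p'.1.2 = p.1.2 - s.σ p.1.1 p'.1.1 := by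
    rintro ⟨⟨x, R⟩, h⟩
    obtain ⟨-, -, y, hy, hinf⟩ := exists_infinite_reachBall hG h
    exact ⟨⟨(y, _), hinf⟩, hy, rfl⟩
  choose F hF using step
  let p : ℕ → {p : X × ℝ // (s.reachBall A p.1 p.2).Infinite} := fun n => F^[n] ⟨(x, R), h⟩
  have hp : ∀ n, p (n + 1) = F (p n) := fun n => Function.iterate_succ_apply' F n _
  -- The radius left over measures the length used so far. It stays positive because the balls
  -- remain nonempty, so the total length is at most R.
  have hsum : ∀ n, ∑ i ∈ Finset.range n, s.σ (p i).1.1 (p (i + 1)).1.1 = R - (p n).1.2 := by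
    intro n
    induction n with
    | zero => simp [p]
    | succ n ih =>
      have := (hF (p n)).2
      rw [Finset.sum_range_succ, ih, hp, this]
      ring
  refine ⟨fun n => (p n).1.1, fun n => (exists_infinite_reachBall hG (p n).2).1, fun n => ?_,
    summable_of_sum_range_le (c := R) (fun n => s.nonneg _ _) fun n => ?_⟩
  · dsimp only
    rw [hp]
    exact (hF (p n)).1
  · rw [hsum]
    linarith [(exists_infinite_reachBall hG (p n).2).2.1]

/-- The candidates for the values of the cutoff function. -/
def cutoffSet (s : EdgeLength G) (A : Set X) (K : Finset X) (x : X) : Set ℝ :=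
  -- The extra 0 takes the positive part and gives the value 0 where no path from `K` inside `A`
  -- arrives.
  insert 0 {t | ∃ k ∈ K, ∃ r, s.Reach A k r x ∧ t = 1 - r}

/-- The cutoff function `x ↦ (1 - d(x, K))₊`, where `d` is the path metric of the subset `A`. -/
def cutoff (s : EdgeLength G) (A : Set X) (K : Finset X) (x : X) : ℝ := sSup (s.cutoffSet A K x)

theorem cutoffSet_le_one {K : Finset X} {x : X} {t : ℝ} (ht : t ∈ s.cutoffSet A K x) : t ≤ 1 := by
  rcases ht with rfl | ⟨k, _, r, hr, rfl⟩
  · exact zero_le_one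
  · linarith [hr.nonneg]

theorem le_cutoff {K : Finset X} {x : X} {t : ℝ} (ht : t ∈ s.cutoffSet A K x) :
    t ≤ s.cutoff A K x := le_csSup ⟨1, fun _ h => cutoffSet_le_one h⟩ ht

theorem cutoff_nonneg (K : Finset X) (x : X) : 0 ≤ s.cutoff A K x :=
  le_cutoff (Set.mem_insert _ _)

theorem cutoff_le_one (K : Finset X) (x : X) : s.cutoff A K x ≤ 1 :=
  csSup_le ⟨0, Set.mem_insert _ _⟩ fun _ h => cutoffSet_le_one h

theorem cutoff_eq_one {K : Finset X} {x : X} (hx : x ∈ K) (hA : x ∈ A) : s.cutoff A K x = 1 :=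
  le_antisymm (cutoff_le_one K x) (le_cutoff (Or.inr ⟨x, hx, 0, .refl x hA, by ring⟩))

theorem cutoff_sub_le {K : Finset X} {x y : X} (hy : y ∈ A) (hxy : 0 < G.b x y) :
    s.cutoff A K x - s.cutoff A K y ≤ s.σ x y := by
  suffices s.cutoff A K x ≤ s.cutoff A K y + s.σ x y by linarith
  refine csSup_le ⟨0, Set.mem_insert _ _⟩ ?_
  rintro _ (rfl | ⟨k, hk, r, hr, rfl⟩)
  · exact add_nonneg (cutoff_nonneg K y) (s.nonneg _ _)
  · have := le_cutoff (s := s) (K := K) (Or.inr ⟨k, hk, _, hr.tail hxy hy, rfl⟩)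
    linarith

theorem abs_cutoff_sub_le {K : Finset X} {x y : X} (hx : x ∈ A) (hy : y ∈ A) (hxy : 0 < G.b x y) :
    |s.cutoff A K x - s.cutoff A K y| ≤ s.σ x y := by
  rw [abs_le]
  have h1 := cutoff_sub_le (s := s) (K := K) hy hxy
  have h2 := cutoff_sub_le (s := s) (K := K) hx (by rwa [G.symm])
  rw [s.symm] at h2
  constructor <;> linarith

/-- A nonzero value requires a path of length less than 1 from `K`, so the support lies in a finite
union of unit balls. -/
theorem cutoff_support_finite {K : Finset X} (h : ∀ k, (s.reachBall A k 1).Finite) :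
    {x | s.cutoff A K x ≠ 0}.Finite := by
  refine (K.finite_toSet.biUnion fun k _ => h k).subset fun x hx => ?_
  by_contra hc
  refine hx (le_antisymm (csSup_le ⟨0, Set.mem_insert _ _⟩ ?_) (cutoff_nonneg K x))
  rintro _ (rfl | ⟨k, hk, r, hr, rfl⟩)
  · exact le_rfl
  · by_contra! h1
    exact hc (Set.mem_biUnion hk ⟨r, by linarith, hr⟩)

/-! ### Path metrics near the Cauchy boundary, and the energy of cutoffs. -/

/-- Vertices of a locally finite graph are isolated with respect to path metrics. -/
theorem exists_le_pathDist (hG : G.LocallyFinite) (hc : G.Connected) (a : X) :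
    ∃ δ > 0, ∀ y, y ≠ a → δ ≤ s.pathDist a y := by
  have hδ : ∃ δ > 0, ∀ y, 0 < G.b a y → δ ≤ s.σ a y := by
    rcases (hG a).toFinset.eq_empty_or_nonempty with h | h
    · refine ⟨1, one_pos, fun y hy => ?_⟩
      have : y ∈ (hG a).toFinset := by simpa using hy
      simp [h] at this
    · obtain ⟨z, hz, hmin⟩ := (hG a).toFinset.exists_min_image (s.σ a) h
      exact ⟨s.σ a z, (s.pos_iff a z).2 (by simpa using hz), fun y hy => hmin y (by simpa using hy)⟩
  obtain ⟨δ, hδ, hle⟩ := hδ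
  refine ⟨δ, hδ, fun y hy => ?_⟩
  have : Nonempty (G.toSimpleGraph.Walk a y) := hc.preconnected a y
  refine le_ciInf fun p => ?_
  cases p with
  | nil => exact absurd rfl hy
  | cons h p => exact (hle _ h).trans (le_add_of_nonneg_right (s.length_nonneg p))

theorem pathDist_le {x y : X} (h : 0 < G.b x y) : s.pathDist x y ≤ s.σ x y :=
  (ciInf_le (s.bddBelow x y) (.cons h .nil)).trans (by simp [length])

/-- In the complement of a neighborhood of the Cauchy boundary there is no infinite path of finite
length. -/
theorem not_summable_of_notMem (hG : G.LocallyFinite) (hc : G.Connected) :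
    letI := s.pathMetric hc
    ∀ {O : Set (UniformSpace.Completion X)}, IsOpen O →
      (Set.range ((↑) : X → UniformSpace.Completion X))ᶜ ⊆ O → ∀ {k : ℕ → X},
      (∀ n, (k n : UniformSpace.Completion X) ∉ O) → (∀ n, 0 < G.b (k n) (k (n + 1))) →
      ¬ Summable fun n => s.σ (k n) (k (n + 1)) := by
  let _ := s.pathMetric hc
  intro O hO hr k hk hb hs
  have hcs : CauchySeq k := cauchySeq_of_dist_le_of_summable _ (fun n => pathDist_le (hb n)) hs
  obtain ⟨z, hz⟩ := cauchySeq_tendsto_of_complete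
    (hcs.map (UniformSpace.Completion.uniformContinuous_coe X) :
      CauchySeq fun n => (k n : UniformSpace.Completion X))
  have hzO : z ∉ O := fun hzO => by
    obtain ⟨n, hn⟩ := (hz.eventually (hO.mem_nhds hzO)).exists
    exact hk n hn
  obtain ⟨a, rfl⟩ : z ∈ Set.range ((↑) : X → UniformSpace.Completion X) := by
    by_contra h
    exact hzO (hr h)
  have hka : Tendsto k atTop (𝓝 a) :=
    (UniformSpace.Completion.isUniformInducing_coe X).isInducing.tendsto_nhds_iff.2 hz
  obtain ⟨δ, hδ, hle⟩ := exists_le_pathDist (s := s) hG hc a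
  -- The limit a avoids O, hence is a vertex, and vertices are isolated. The path would eventually
  -- be constant, but b has no loops.
  have h1 : ∀ᶠ n in atTop, k n = a := by
    filter_upwards [Metric.tendsto_nhds.1 hka δ hδ] with n hn
    by_contra h
    have h2 : dist a (k n) < δ := by rwa [dist_comm]
    exact absurd h2 (not_lt.2 (hle _ h))
  obtain ⟨n, hn⟩ := eventually_atTop.1 h1
  have h2 := hb n
  rw [hn n le_rfl, hn (n + 1) (Nat.le_succ n), G.loopless] at h2
  exact lt_irrefl _ h2

/-- The Leibniz rule, with the gradient of the cutoff controlled by σ and its total weight at x by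
μ(x). The cutoff is Lipschitz only along edges inside `A`. On edges leaving `A` one value of g is
zero and 0 ≤ cutoff ≤ 1 suffices. -/
theorem partialEnergy_cutoff_le {μ : Weight X} {V : X → ℝ} (hV : ∀ x, 0 ≤ V x)
    (hs : s.StronglyIntrinsic μ)
    {g : X → ℝ} (hg : ∀ x, x ∉ A → g x = 0) (K B : Finset X) :
    G.partialEnergy μ V B (fun x => s.cutoff A K x * g x) ≤
      2 * G.partialEnergy μ V B g + ∑ x ∈ B, g x ^ 2 * μ x := by
  have h01 : ∀ x, (s.cutoff A K x * g x) ^ 2 ≤ g x ^ 2 := fun x => by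
    rw [mul_pow]
    have h1 := cutoff_nonneg (s := s) (A := A) K x
    have h2 := cutoff_le_one (s := s) (A := A) K x
    exact mul_le_of_le_one_left (sq_nonneg _) (pow_le_one₀ h1 h2)
  have hedge : ∀ x y, G.b x y * (s.cutoff A K x * g x - s.cutoff A K y * g y) ^ 2 ≤
      2 * (G.b x y * (g x - g y) ^ 2) + 2 * (G.b x y * s.σ x y ^ 2 * g x ^ 2) := fun x y => by
    rcases (G.nonneg x y).eq_or_lt with hb | hb
    · simp [← hb]
    have key : (s.cutoff A K x * g x - s.cutoff A K y * g y) ^ 2 ≤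
        2 * (g x - g y) ^ 2 + 2 * (s.σ x y ^ 2 * g x ^ 2) := by
      have hσ : 0 ≤ s.σ x y ^ 2 * g x ^ 2 := by positivity
      by_cases hx : x ∈ A
      · by_cases hy : y ∈ A
        · have h1 : (s.cutoff A K x - s.cutoff A K y) ^ 2 ≤ s.σ x y ^ 2 := by
            rw [← sq_abs (s.cutoff A K x - _)]
            exact pow_le_pow_left₀ (abs_nonneg _) (abs_cutoff_sub_le hx hy hb) 2
          have h2 : (s.cutoff A K y) ^ 2 ≤ 1 := pow_le_one₀ (cutoff_nonneg K y) (cutoff_le_one K y)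
          have h3 := mul_le_mul_of_nonneg_right h1 (sq_nonneg (g x))
          have h4 := mul_le_mul_of_nonneg_right h2 (sq_nonneg (g x - g y))
          -- This is (a + b)² ≤ 2a² + 2b² with a the increment of the cutoff times g(x) and b the
          -- cutoff at y times the increment of g.
          nlinarith [sq_nonneg ((s.cutoff A K x - s.cutoff A K y) * g x -
            s.cutoff A K y * (g x - g y))]
        · have h1 := h01 x
          rw [hg y hy, mul_zero, sub_zero, sub_zero]
          nlinarith [sq_nonneg (g x)]
      · have h1 := h01 y
        rw [hg x hx, mul_zero, zero_sub, zero_sub, neg_sq, neg_sq]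
        nlinarith [sq_nonneg (g y)]
    have := mul_le_mul_of_nonneg_left key hb.le
    linarith
  have hsum : ∑ x ∈ B, ∑ y ∈ B, G.b x y * s.σ x y ^ 2 * g x ^ 2 ≤ ∑ x ∈ B, g x ^ 2 * μ x := by
    refine Finset.sum_le_sum fun x _ => ?_
    rw [← Finset.sum_mul, mul_comm]
    refine mul_le_mul_of_nonneg_left ?_ (sq_nonneg _)
    exact ((hs x).1.sum_le_tsum B fun y _ => mul_nonneg (G.nonneg _ _) (sq_nonneg _)).trans (hs x).2
  have h1 : ∑ x ∈ B, ∑ y ∈ B, G.b x y * (s.cutoff A K x * g x - s.cutoff A K y * g y) ^ 2 ≤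
      2 * ∑ x ∈ B, ∑ y ∈ B, G.b x y * (g x - g y) ^ 2 +
        2 * ∑ x ∈ B, ∑ y ∈ B, G.b x y * s.σ x y ^ 2 * g x ^ 2 := by
    rw [Finset.mul_sum, Finset.mul_sum, ← Finset.sum_add_distrib]
    refine Finset.sum_le_sum fun x _ => ?_
    rw [Finset.mul_sum, Finset.mul_sum, ← Finset.sum_add_distrib]
    exact Finset.sum_le_sum fun y _ => hedge x y
  have h2 : ∑ x ∈ B, V x * (s.cutoff A K x * g x) ^ 2 * μ x ≤ ∑ x ∈ B, V x * g x ^ 2 * μ x :=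
    Finset.sum_le_sum fun x _ => mul_le_mul_of_nonneg_right
      (mul_le_mul_of_nonneg_left (h01 x) (hV x)) (μ.pos x).le
  have h3 : 0 ≤ ∑ x ∈ B, V x * g x ^ 2 * μ x := Finset.sum_nonneg fun x _ =>
    mul_nonneg (mul_nonneg (hV x) (sq_nonneg _)) (μ.pos x).le
  unfold WeightedGraph.partialEnergy
  linarith

open Classical in
/-- Every graph carries a strongly intrinsic path metric. -/
theorem exists_stronglyIntrinsic (G : WeightedGraph X) (μ : Weight X) :
    ∃ s : EdgeLength G, s.StronglyIntrinsic μ := by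
  let deg : X → ℝ := fun x => ∑' z, G.b x z
  have hdeg : ∀ x y, 0 < G.b x y → 0 < deg x := fun x y h =>
    h.trans_le ((G.summable x).le_tsum y fun z _ => G.nonneg x z)
  have hpos : ∀ x y, 0 < G.b x y → 0 < min (μ x / deg x) (μ y / deg y) := fun x y h =>
    lt_min (div_pos (μ.pos x) (hdeg x y h)) (div_pos (μ.pos y) (hdeg y x (by rwa [G.symm])))
  let s : EdgeLength G :=
    -- The minimum over the two endpoints makes σ symmetric, and σ(x,y)² ≤ μ(x)/deg(x) sums to at
    -- most μ(x).
    { σ := fun x y => if 0 < G.b x y then Real.sqrt (min (μ x / deg x) (μ y / deg y)) else 0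
      nonneg := fun x y => by split_ifs <;> positivity
      symm := fun x y => by simp only [G.symm x y, min_comm (μ x / deg x)]
      pos_iff := fun x y => by
        split_ifs with h
        · exact ⟨fun _ => h, fun _ => Real.sqrt_pos.2 (hpos x y h)⟩
        · exact ⟨fun h' => absurd h' (lt_irrefl _), fun h' => absurd h' h⟩ }
  refine ⟨s, fun x => ?_⟩
  have hle : ∀ y, G.b x y * s.σ x y ^ 2 ≤ G.b x y * (μ x / deg x) := fun y => by
    by_cases h : 0 < G.b x y
    · have : s.σ x y = Real.sqrt (min (μ x / deg x) (μ y / deg y)) := if_pos h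
      rw [this, Real.sq_sqrt (hpos x y h).le]
      exact mul_le_mul_of_nonneg_left (min_le_left _ _) h.le
    · have : G.b x y = 0 := le_antisymm (not_lt.1 h) (G.nonneg x y)
      simp [this]
  have hsum := (G.summable x).mul_right (μ x / deg x)
  have h1 : Summable fun y => G.b x y * s.σ x y ^ 2 := Summable.of_nonneg_of_le
    (fun y => mul_nonneg (G.nonneg _ _) (sq_nonneg _)) hle hsum
  refine ⟨h1, (h1.tsum_le_tsum hle hsum).trans ?_⟩
  rw [tsum_mul_right]
  by_cases h : deg x = 0
  · rw [h, div_zero, mul_zero]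
    exact (μ.pos x).le
  · rw [mul_div_cancel₀ _ h]

end EdgeLength

/-! ## The Cauchy boundary -/

section cauchyBoundary

open WeightedGraph Ell2 SymForm EdgeLength

variable {X : Type*} [Countable X] [MeasurableSpace X] [DiscreteMeasurableSpace X]
  {G : WeightedGraph X} {μ : Weight X} {V : X → ℝ}

/-- The completion is Hausdorff, so the image of a finite set is closed and its complement is an
open neighborhood of the Cauchy boundary. -/
theorem capCauchyBoundary_le (d : PseudoMetricSpace X) {h : X → ℝ} (h0 : ∀ x, 0 ≤ h x) :
    capCauchyBoundary G μ V d h ≤ capBoundary G μ V h := by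
  let _ := d
  refine le_iInf fun K => ?_
  refine iInf_le_of_le (((↑) : X → UniformSpace.Completion X) '' (K : Set X))ᶜ
    (iInf_le_of_le (K.finite_toSet.image _).isClosed.isOpen_compl (iInf_le_of_le
      (Set.compl_subset_compl.2 (Set.image_subset_range _ _)) (cap_mono h h0 ?_)))
  exact fun x hx hK => hx ⟨x, hK, rfl⟩

/-- Functions that vanish in a neighborhood of the Cauchy boundary can be approximated by finitely
supported functions. -/
theorem mem_formClosure_of_cutoff (hV : ∀ x, 0 ≤ V x) {s : EdgeLength G}
    (hs : s.StronglyIntrinsic μ) {A : Set X} (hA : ∀ k, (s.reachBall A k 1).Finite)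
    {g : (neumannForm G μ V).domain} (hg : ∀ x, x ∉ A → (g : Ell2 μ) x = 0) :
    (g : Ell2 μ) ∈ (neumannForm_nonnegClosed (G := G) hV).formClosure (finSupp μ) := by
  have hN := neumannForm_nonnegClosed (G := G) (μ := μ) hV
  have habs : ∀ K x, |s.cutoff A K x * (g : Ell2 μ) x| ≤ |(g : Ell2 μ) x| := fun K x => by
    rw [abs_mul, abs_of_nonneg (cutoff_nonneg K x)]
    exact mul_le_of_le_one_left (abs_nonneg _) (cutoff_le_one K x)
  choose u hu using fun K : Finset X => exists_of_abs_le (g : Ell2 μ) (habs K)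
  have huf : ∀ K, (u K : X → ℝ) = fun x => s.cutoff A K x * (g : Ell2 μ) x := fun K =>
    funext (hu K)
  have hfin : ∀ K, u K ∈ finSupp μ := fun K =>
    (cutoff_support_finite (K := K) hA).subset fun x hx => by
      rw [Function.mem_support, hu] at hx
      exact left_ne_zero_of_mul hx
  have hM : ∀ K, G.energy μ V (u K) (u K) ≤
      2 * G.energy μ V (g : Ell2 μ) (g : Ell2 μ) + ‖(g : Ell2 μ)‖ ^ 2 := fun K =>
    (finiteEnergy_of_partialEnergy_le hV fun B => by
      rw [huf]
      refine (partialEnergy_cutoff_le hV hs hg K B).trans (add_le_add ?_ ?_)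
      · exact mul_le_mul_of_nonneg_left (partialEnergy_le_energy hV g.2 B) zero_le_two
      · exact sum_le_hasSum B (fun x _ => mul_nonneg (sq_nonneg _) (μ.pos x).le)
          (hasSum_norm_sq (g : Ell2 μ))).2
  -- As `K` grows, the products equal g at each given vertex from some point on. Norm convergence is
  -- not needed, since the form norms are uniformly bounded.
  refine hN.mem_formClosure_of_tendsto (l := atTop)
    (u := fun K => ⟨u K, finSupp_le_neumannForm (hfin K)⟩)
    (M := 2 * G.energy μ V (g : Ell2 μ) (g : Ell2 μ) + ‖(g : Ell2 μ)‖ ^ 2 + ‖(g : Ell2 μ)‖ ^ 2)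
    (Eventually.of_forall fun K => hN.le_formClosure finSupp_le_neumannForm (hfin K))
    (Eventually.of_forall fun K => ?_) fun x => ?_
  · have h1 := shift_self (q := neumannForm G μ V) 1 ⟨u K, finSupp_le_neumannForm (hfin K)⟩
    rw [h1, one_mul]
    refine add_le_add (hM K) ?_
    have h2 : ‖u K‖ ≤ ‖(g : Ell2 μ)‖ := norm_le_of_abs_le fun x => by rw [hu]; exact habs K x
    exact pow_le_pow_left₀ (norm_nonneg _) h2 2
  · refine tendsto_const_nhds.congr' ?_
    filter_upwards [eventually_ge_atTop {x}] with K hK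
    rw [hu]
    by_cases hx : x ∈ A
    · rw [cutoff_eq_one (Finset.singleton_subset_iff.1 hK) hx, one_mul]
    · rw [hg x hx, mul_zero]

/-- Vanishing capacity provides neighborhoods O of small capacity. In the complement of O all unit
balls are finite, as an infinite one would give an infinite path of finite length avoiding O, so
functions vanishing on O can be cut off. -/
theorem neumannForm_domain_le_of_capCauchyBoundary (hV : ∀ x, 0 ≤ V x) (hG : G.LocallyFinite)
    (hc : G.Connected) {s : EdgeLength G} (hs : s.StronglyIntrinsic μ)
    {h : (neumannForm G μ V).domain} (hh : IsOneExcessive G μ V (h : Ell2 μ))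
    (hpos : ∀ x, 0 < (h : Ell2 μ) x)
    (hcap : capCauchyBoundary G μ V (s.pathMetric hc) (h : Ell2 μ) = 0) :
    (neumannForm G μ V).domain ≤
      (neumannForm_nonnegClosed (G := G) hV).formClosure (finSupp μ) := by
  let _ := s.pathMetric hc
  refine neumannForm_domain_le_of_cap hV hh hpos fun ε hε => ?_
  rw [← hcap] at hε
  simp only [capCauchyBoundary, iInf_lt_iff] at hε
  obtain ⟨O, hO, hr, hcO⟩ := hε
  refine ⟨_, hcO, fun g hg => mem_formClosure_of_cutoff hV hs
    (A := (((↑) : X → UniformSpace.Completion X) ⁻¹' O)ᶜ) (fun k => ?_)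
    fun x hx => hg x (not_not.1 hx)⟩
  by_contra hinf
  obtain ⟨p, hpA, hpb, hps⟩ := exists_path_of_infinite_reachBall hG hinf
  exact not_summable_of_notMem hG hc hO hr hpA hpb hps

end cauchyBoundary
end DiscreteSchrodinger
end
-- The equivalences.
open DiscreteSchrodinger
theorem mainTheorem12 {X : Type*} [Countable X] [Nonempty X]
    [MeasurableSpace X] [DiscreteMeasurableSpace X]
    (G : WeightedGraph X) (μ : Weight X) (V : X → ℝ) (hV : ∀ x, 0 ≤ V x) :
    List.TFAE [
      ∃! H : Ell2 μ →ₗ.[ℝ] Ell2 μ, IsMarkovianRealization G μ V H,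
      ∀ h : (neumannForm G μ V).domain, IsOneExcessive G μ V (h : Ell2 μ) →
        capBoundary G μ V (h : Ell2 μ) = 0,
      ∃ h : (neumannForm G μ V).domain, IsOneExcessive G μ V (h : Ell2 μ) ∧
        (∀ x, 0 < (h : Ell2 μ) x) ∧ capBoundary G μ V (h : Ell2 μ) = 0] ∧
    ∀ hG : G.Connected, G.LocallyFinite →
      List.TFAE [
        ∃! H : Ell2 μ →ₗ.[ℝ] Ell2 μ, IsMarkovianRealization G μ V H,
        ∀ h : (neumannForm G μ V).domain, IsOneExcessive G μ V (h : Ell2 μ) →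
          capBoundary G μ V (h : Ell2 μ) = 0,
        ∃ h : (neumannForm G μ V).domain, IsOneExcessive G μ V (h : Ell2 μ) ∧
          (∀ x, 0 < (h : Ell2 μ) x) ∧ capBoundary G μ V (h : Ell2 μ) = 0,
        ∃ s : EdgeLength G, s.StronglyIntrinsic μ ∧
          ∀ h : (neumannForm G μ V).domain, IsOneExcessive G μ V (h : Ell2 μ) →
            capCauchyBoundary G μ V (s.pathMetric hG) (h : Ell2 μ) = 0,
        ∀ s : EdgeLength G, s.StronglyIntrinsic μ →
          ∀ h : (neumannForm G μ V).domain, IsOneExcessive G μ V (h : Ell2 μ) →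
            capCauchyBoundary G μ V (s.pathMetric hG) (h : Ell2 μ) = 0,
        ∃ s : EdgeLength G, s.StronglyIntrinsic μ ∧
          ∃ h : (neumannForm G μ V).domain, IsOneExcessive G μ V (h : Ell2 μ) ∧
            (∀ x, 0 < (h : Ell2 μ) x) ∧
            capCauchyBoundary G μ V (s.pathMetric hG) (h : Ell2 μ) = 0,
        ∀ s : EdgeLength G, s.StronglyIntrinsic μ →
          ∃ h : (neumannForm G μ V).domain, IsOneExcessive G μ V (h : Ell2 μ) ∧
            (∀ x, 0 < (h : Ell2 μ) x) ∧
            capCauchyBoundary G μ V (s.pathMetric hG) (h : Ell2 μ) = 0] := by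
  have hiff := existsUnique_isMarkovianRealization_iff (G := G) (μ := μ) hV
  obtain ⟨h₀, hh₀, hpos₀⟩ := exists_pos_isOneExcessive (G := G) (μ := μ) hV
  refine ⟨?_, fun hG hlf => ?_⟩
  · tfae_have 1 → 2 := fun h1 h _ => capBoundary_eq_zero hV (hiff.1 h1) h
    tfae_have 2 → 3 := fun h2 => ⟨h₀, hh₀, hpos₀, h2 h₀ hh₀⟩
    tfae_have 3 → 1 := fun ⟨h, hh, hpos, hc⟩ =>
      hiff.2 (neumannForm_domain_le_of_capBoundary hV hh hpos hc)
    tfae_finish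
  · obtain ⟨s₀, hs₀⟩ := EdgeLength.exists_stronglyIntrinsic G μ
    tfae_have 1 → 2 := fun h1 h _ => capBoundary_eq_zero hV (hiff.1 h1) h
    tfae_have 2 → 3 := fun h2 => ⟨h₀, hh₀, hpos₀, h2 h₀ hh₀⟩
    tfae_have 3 → 1 := fun ⟨h, hh, hpos, hc⟩ =>
      hiff.2 (neumannForm_domain_le_of_capBoundary hV hh hpos hc)
    tfae_have 2 → 5 := fun h2 s _ h hh =>
      le_antisymm ((capCauchyBoundary_le _ hh.1).trans (h2 h hh).le) zero_le
    tfae_have 5 → 4 := fun h5 => ⟨s₀, hs₀, h5 s₀ hs₀⟩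
    tfae_have 4 → 6 := fun ⟨s, hs, h4⟩ => ⟨s, hs, h₀, hh₀, hpos₀, h4 h₀ hh₀⟩
    tfae_have 5 → 7 := fun h5 s hs => ⟨h₀, hh₀, hpos₀, h5 s hs h₀ hh₀⟩
    tfae_have 7 → 6 := fun h7 => ⟨s₀, hs₀, h7 s₀ hs₀⟩
    -- The weakest condition, with one metric and one function, already gives density. This makes
    -- the conditions independent of both choices.
    tfae_have 6 → 1 := fun ⟨s, hs, h, hh, hpos, hc⟩ =>
      hiff.2 (neumannForm_domain_le_of_capCauchyBoundary hV hlf hG hs hh hpos hc)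
    tfae_finish
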